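/- Let $L>0$ and let $g\in L^2((0,L)\times(0,L))$ be complex-valued. Consider the control system $$u_t(t,x)-u_x(t,x)=\int_0^L g(x,y)u(t,y)\,dy,\qquad u(t,L)=U(t),\qquad u(0,x)=u^0(x),\qquad t\in(0,T),\ x\in(0,L).\tag{1}$$ For $u^0\in L^2(0,L)$ and $U\in L^2(0,T)$, a (weak) solution is a function $u\in C^0([0,T];L^2(0,L))$ such that, for all $\tau\in[0,T]$ and all $\phi\in C^1([0,\tau]\times[0,L])$ with $\phi(\cdot,0)=0$, $$\int_0^\tau\!\!\int_0^L u\,\overline{\Big(-\phi_t+\phi_x-\int_0^L\overline{g(y,x)}\phi(t,y)\,dy\Big)}dx\,dt+\int_0^L u(\tau,x)\overline{\phi(\tau,x)}\,dx-\int_0^L u^0(x)\overline{\phi(0,x)}\,dx-\int_0^\tau U(t)\overline{\phi(t,L)}\,dt=0.$$ System (1) is exactly controllable at time $T$ if for all $u^0,u^1\in L^2(0,L)$ there is $U\in L^2(0,T)$ such that the corresponding solution satisfies $u(T)=u^1$. For $U\in L^2(0,L)$, consider the kernel equation, in which $x$ plays the role of time, $$\begin{cases}k^*_x(x,y)+k^*_y(x,y)+\displaystyle\int_0^L\overline{g(y,\sigma)}\,k^*(x,\sigma)\,d\sigma-\overline{g(y,x)}=0,&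 x,y\in(0,L),\\ k^*(x,L)=U(x),& x\in(0,L),\\ k^*(L,y)=0,& y\in(0,L).\end{cases}\tag{2}$$ A solution is a function $k^*\in C^0([0,L];L^2(0,L))$ (meaning $x\mapsto k^*(x,\cdot)$) with $k^*(L,\cdot)=0$ that satisfies the first two lines in the weak sense: for all $\xi\in[0,L]$ and all $\phi\in C^1([\xi,L]\times[0,L])$ with $\phi(\cdot,0)=0$, $$\int_\xi^L\!\!\int_0^L k^*\,\overline{\Big(-\phi_x-\phi_y+\int_0^L g(\sigma,y)\phi(x,\sigma)\,d\sigma\Big)}dy\,dx-\int_0^L k^*(\xi,y)\overline{\phi(\xi,y)}\,dy+\int_\xi^L U(x)\overline{\phi(x,L)}\,dx-\int_\xi^L\!\!\int_0^L\overline{g(y,x)}\,\overline{\phi(x,y)}\,dy\,dx=0.$$ Let $T_-=\{(x,y)\in(0,L)^2: x>y\}$ and $T_+=\{(x,y)\in(0,L)^2: x<y\}$. Then: 1. If (1) is exactly controllable at time $L$, then there exists $U\in L^2(0,L)$ such that (2) has a unique solution $k^*\in C^0([0,L];L^2(0,L))$, and this solution satisfies $k^*(0,\cdot)=0$. 2.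 Let $U\in L^2(0,L)$ and let $k^*\in C^0([0,L];L^2(0,L))$ be a corresponding solution of (2). If $k^*(0,\cdot)=0$ and $g\in H^1(T_-)\cap H^1(T_+)$ (that is, the restrictions of $g$ to $T_-$ and to $T_+$ are in $H^1$), then $U\in H^1(0,L)$ and $k^*\in H^1(T_-)\cap H^1(T_+)$. In particular this applies to the $U$ and $k^*$ of part 1. -/

import Mathlib

open MeasureTheory Set
open scoped ComplexConjugate ContDiff

noncomputable section

namespace IntegroDiff

/-- The complex Hilbert space `L²(0,a)`. -/
abbrev L2 (a : ℝ) : Type := Lp ℂ 2 (volume.restrict (Ioo (0 : ℝ) a))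

/-- The open square `(0,L) × (0,L)`. -/
def square (L : ℝ) : Set (ℝ × ℝ) := Ioo 0 L ×ˢ Ioo 0 L

/-- The open triangle `T₋ = {(x,y) ∈ (0,L)² : x > y}`. -/
def triMinus (L : ℝ) : Set (ℝ × ℝ) := {p | p ∈ square L ∧ p.2 < p.1}

/-- The open triangle `T₊ = {(x,y) ∈ (0,L)² : x < y}`. -/
def triPlus (L : ℝ) : Set (ℝ × ℝ) := {p | p ∈ square L ∧ p.1 < p.2}

/-- `F` is the weak derivative of `f` in the direction `v` on the open set `Ω`:
`∫_Ω f ∂_v φ = - ∫_Ω F φ` for all `φ ∈ C_c^∞(Ω)`. -/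
def HasWeakDeriv {E : Type} [NormedAddCommGroup E] [NormedSpace ℝ E] [MeasureSpace E]
    (Ω : Set E) (v : E) (f F : E → ℂ) : Prop :=
  ∀ φ : E → ℂ, ContDiff ℝ ∞ φ → HasCompactSupport φ → tsupport φ ⊆ Ω →
    ∫ p in Ω, f p * fderiv ℝ φ p v = -∫ p in Ω, F p * φ p

/-- The restriction of `f` to the open set `Ω` belongs to the Sobolev space `H¹(Ω)`: it is in
`L²(Ω)`, and it has a weak derivative in `L²(Ω)` in every direction. -/
def MemH1 {E : Type} [NormedAddCommGroup E] [NormedSpace ℝ E] [MeasureSpace E]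
    (Ω : Set E) (f : E → ℂ) : Prop :=
  MemLp f 2 (volume.restrict Ω) ∧
    ∀ v : E, ∃ F : E → ℂ, MemLp F 2 (volume.restrict Ω) ∧ HasWeakDeriv Ω v f F

/-- `u ∈ C⁰([0,T]; L²(0,L))` is the weak solution of
`u_t - u_x = ∫₀ᴸ g(x,y) u(t,y) dy`, `u(t,L) = U(t)`, `u(0,x) = u⁰(x)`, on `(0,T) × (0,L)`.
The test functions are (restrictions to `[0,τ] × [0,L]` of) `C¹` functions `φ` such that
`φ(·,0) = 0` on `[0,τ]`. -/
def IsWeakSolution (T L : ℝ) (g : ℝ → ℝ → ℂ) (u₀ : L2 L) (U : L2 T) (u : ℝ → L2 L) : Prop :=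
  ContinuousOn u (Icc 0 T) ∧
  ∀ τ ∈ Icc 0 T, ∀ φ : ℝ → ℝ → ℂ, ContDiff ℝ 1 (Function.uncurry φ) →
    (∀ t ∈ Icc 0 τ, φ t 0 = 0) →
    (∫ t in (0 : ℝ)..τ, ∫ x in (0 : ℝ)..L,
        u t x * conj (-deriv (fun s => φ s x) t + deriv (fun z => φ t z) x
          - ∫ y in (0 : ℝ)..L, conj (g y x) * φ t y))
      + (∫ x in (0 : ℝ)..L, u τ x * conj (φ τ x))
      - (∫ x in (0 : ℝ)..L, u₀ x * conj (φ 0 x))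
      - (∫ t in (0 : ℝ)..τ, U t * conj (φ t L)) = 0

/-- Exact controllability at time `T` of the system of `IsWeakSolution`. -/
def ExactlyControllable (T L : ℝ) (g : ℝ → ℝ → ℂ) : Prop :=
  ∀ u₀ u₁ : L2 L, ∃ U : L2 T, ∃ u : ℝ → L2 L, IsWeakSolution T L g u₀ U u ∧ u T = u₁

/-- `k ∈ C⁰([0,L]; L²(0,L))`, `k x = k*(x,·)`, is the weak solution of the kernel equation
`k*_x + k*_y + ∫₀ᴸ conj g(y,σ) k*(x,σ) dσ - conj g(y,x) = 0` on `(0,L)²`, with the boundary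
condition `k*(x,L) = U(x)` and the final condition `k*(L,y) = 0`, where `x` plays the role of time.
As for `IsWeakSolution`, the equation is multiplied by the conjugate of a `C¹` function `φ` with
`φ(·,0) = 0` and integrated by parts over `(ξ,L) × (0,L)`, for each `ξ ∈ [0,L]`. -/
def IsKernelSolution (L : ℝ) (g : ℝ → ℝ → ℂ) (U : L2 L) (k : ℝ → L2 L) : Prop :=
  ContinuousOn k (Icc 0 L) ∧ k L = 0 ∧
  ∀ ξ ∈ Icc 0 L, ∀ φ : ℝ → ℝ → ℂ, ContDiff ℝ 1 (Function.uncurry φ) →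
    (∀ x ∈ Icc ξ L, φ x 0 = 0) →
    (∫ x in ξ..L, ∫ y in (0 : ℝ)..L,
        k x y * conj (-deriv (fun s => φ s y) x - deriv (fun z => φ x z) y
          + ∫ σ in (0 : ℝ)..L, g σ y * φ x σ))
      - (∫ y in (0 : ℝ)..L, k ξ y * conj (φ ξ y))
      + (∫ x in ξ..L, U x * conj (φ x L))
      - (∫ x in ξ..L, ∫ y in (0 : ℝ)..L, conj (g y x) * conj (φ x y)) = 0

/-- As an element of `L²((0,L)²)`, the function `k : [0,L] → L²(0,L)` belongs to
`H¹(T₋) ∩ H¹(T₊)`. (The function `κ` of two variables is needed because the representatives of the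
classes `k x` are chosen independently of each other.) -/
def KernelMemH1 (L : ℝ) (k : ℝ → L2 L) : Prop :=
  ∃ κ : ℝ → ℝ → ℂ,
    MemLp (Function.uncurry κ) 2 (volume.restrict (square L)) ∧
    (∀ᵐ x ∂(volume.restrict (Ioo 0 L)), k x =ᵐ[volume.restrict (Ioo 0 L)] κ x) ∧
    MemH1 (triMinus L) (Function.uncurry κ) ∧ MemH1 (triPlus L) (Function.uncurry κ)

end IntegroDiff

end

/-! ### Integration by parts on polyhedra, with test functions that vanish only on the transversal
sides. -/

namespace IntegroDiff

open Filter Topology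

/-! Let `f(x,y) = conj g(y,x) - ∫ conj g(y,σ) k(x,σ) dσ` (`kernelRhs`). The kernel equation is `(∂_x
+ ∂_y) k = f`: transport along lines of direction `(1,1)`, solved backwards from `x = L`, with
inflow `U` through `y = L`.

Part 1. For `U = 0` the equation has a solution `k₀`, by Duhamel's formula and a Volterra fixed
point (`exists_volterra_solution`, `isKernelSolution_zero_of_duhamel`). A trajectory of the control
system that starts from zero becomes, after time reversal and conjugation, a solution of the kernel
equation without source (`IsWeakSolution.kernel_eq`). Steering zero to `-conj k₀(0)` and adding the
two solutions gives a kernel that vanishes at `x = 0`. Uniqueness for a given `U` comes from test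
functions that are constant along the characteristics, which remove the transport term, and from
Gronwall's inequality.

Part 2. Now `k` vanishes at `x = 0` and at `x = L`. A characteristic below the diagonal exits
through `x = L`, and one above it enters through `x = 0`. Hence `k` is minus the forward integral of
`f` below the diagonal and the backward integral of `f` above it (`kernelFormula`), while `U(L-t) =
∫ f(x,t+x) dx`. It remains to find an `L²` derivative of `f` in `y` on each triangle. For the term
`conj g(y,x)` this is the hypothesis. In the integral term the derivative falls on the first
variable of `g`, whose distributional derivative is an `L²` function `G` minus a density `J ∈ L²`
carried by the diagonal (`exists_jump`). This gives `∫ conj G(y,σ) k(x,σ) dσ - conj J(y) k(x,y)`.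
The last product is the crux, as a general `k ∈ C⁰([0,L]; L²)` only makes it integrable. But a line
integral of an `L²` function has an `L²` norm in `x` bounded uniformly in `y`, so the formula for
`k` makes the product square integrable (`memLp_mul_kernelFormula`); no bootstrap is needed.

The derivative in `y` then passes under the line integrals inside each triangle, and together with
`(∂_x + ∂_y) k = f` it controls every direction. Differentiating the formula for `U` also produces
the trace of `f` on `y = L`. Traces are never constructed: the contributions of the diagonal and of
the side `y = L` are rewritten as integrals over the triangles or the square with `L²` densities, by
choosing test functions that vanish exactly where `HasWeakDeriv.integral_eq` requires it. -/

theorem smoothTransition_deriv_bound :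
    ∃ C, 0 ≤ C ∧ ∀ t : ℝ, |deriv Real.smoothTransition t| ≤ C ∧
      (2 < |t| → deriv Real.smoothTransition t = 0) := by
  have hc : Continuous (deriv Real.smoothTransition) :=
    (Real.smoothTransition.contDiff (n := 1)).continuous_deriv le_rfl
  have hz : ∀ t : ℝ, 2 < |t| → deriv Real.smoothTransition t = 0 := by
    intro t ht
    rcases lt_abs.1 ht with h | h
    · have : Real.smoothTransition =ᶠ[𝓝 t] fun _ => (1 : ℝ) := by
        filter_upwards [lt_mem_nhds h] with s hs
        exact Real.smoothTransition.one_of_one_le (by linarith)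
      rw [this.deriv_eq, deriv_const]
    · have : Real.smoothTransition =ᶠ[𝓝 t] fun _ => (0 : ℝ) := by
        filter_upwards [gt_mem_nhds (show t < 0 by linarith)] with s hs
        exact Real.smoothTransition.zero_of_nonpos hs.le
      rw [this.deriv_eq, deriv_const]
  obtain ⟨C, hC⟩ := (isCompact_Icc (a := (-2 : ℝ)) (b := 2)).exists_bound_of_continuousOn
    hc.continuousOn
  refine ⟨max C 0, le_max_right _ _, fun t => ⟨?_, hz t⟩⟩
  by_cases ht : 2 < |t|
  · rw [hz t ht]; simp
  · exact (hC t (abs_le.1 (not_lt.1 ht))).trans (le_max_left _ _)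

/-- Smooth cutoff of the polyhedron `{p | ∀ i, 0 < a i + l i p}`. -/
noncomputable def polyCutoff {ι : Type} [Fintype ι] (a : ι → ℝ) (l : ι → ℝ × ℝ →L[ℝ] ℝ) (n : ℕ)
    (p : ℝ × ℝ) : ℝ :=
  ∏ i, Real.smoothTransition (n * (a i + l i p) - 1)

section Polyhedron

variable {ι : Type} [Fintype ι] {a : ι → ℝ} {l : ι → ℝ × ℝ →L[ℝ] ℝ}

theorem polyCutoff_contDiff (n : ℕ) : ContDiff ℝ ∞ (polyCutoff a l n) := by
  unfold polyCutoff
  refine contDiff_prod fun i _ => Real.smoothTransition.contDiff.comp ?_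
  exact (contDiff_const.mul (contDiff_const.add (l i).contDiff)).sub contDiff_const

theorem polyCutoff_abs_le (n : ℕ) (p : ℝ × ℝ) : |polyCutoff a l n p| ≤ 1 := by
  unfold polyCutoff
  rw [Finset.abs_prod]
  refine Finset.prod_le_one (fun i _ => abs_nonneg _) fun i _ => ?_
  rw [abs_of_nonneg (Real.smoothTransition.nonneg _)]
  exact Real.smoothTransition.le_one _

theorem polyCutoff_support (n : ℕ) :
    Function.support (polyCutoff a l n) ⊆ {p | ∀ i, 1 ≤ n * (a i + l i p)} := by
  intro p hp i
  by_contra h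
  refine hp (Finset.prod_eq_zero (Finset.mem_univ i) ?_)
  exact Real.smoothTransition.zero_of_nonpos (by linarith)

theorem polyCutoff_eventually_one {p : ℝ × ℝ} (hp : ∀ i, 0 < a i + l i p) :
    ∀ᶠ n : ℕ in atTop, polyCutoff a l n =ᶠ[𝓝 p] fun _ => 1 := by
  have h1 : ∀ i, ∀ᶠ n : ℕ in atTop, 2 < n * (a i + l i p) := fun i =>
    ((tendsto_natCast_atTop_atTop (R := ℝ)).atTop_mul_const (hp i)).eventually_gt_atTop 2
  filter_upwards [eventually_all.2 h1] with n hn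
  have h2 : ∀ i, ∀ᶠ q in 𝓝 p, 2 < n * (a i + l i q) := fun i => by
    have : Continuous fun q => (n : ℝ) * (a i + l i q) := by fun_prop
    exact this.continuousAt.eventually (lt_mem_nhds (hn i))
  filter_upwards [eventually_all.2 h2] with q hq
  exact Finset.prod_eq_one fun i _ => Real.smoothTransition.one_of_one_le (by linarith [hq i])

/-- The gradient of the cutoff has size `n`, but the `i`-th factor varies only where `n * (a i + l i
p) ≤ 3`. If `D`, in practice the size of the test function at `p`, is controlled by the distance to
the sides transversal to `v`, the factor `n` is absorbed and the bound is uniform in `n`. Sides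
parallel to `v` contribute nothing because `l i v = 0`. -/
theorem polyCutoff_fderiv_le {C : ℝ} (hC0 : 0 ≤ C)
    (hC : ∀ t : ℝ, |deriv Real.smoothTransition t| ≤ C ∧
      (2 < |t| → deriv Real.smoothTransition t = 0))
    (n : ℕ) {p v : ℝ × ℝ} {M D : ℝ} (hM : 0 ≤ M) (hD : 0 ≤ D)
    (h : ∀ i, D * |l i v| ≤ M * (a i + l i p)) :
    |fderiv ℝ (polyCutoff a l n) p v| * D ≤ Fintype.card ι * (3 * C * M) := by
  classical
  have hd : ∀ i, HasFDerivAt (fun q => Real.smoothTransition (n * (a i + l i q) - 1))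
      (deriv Real.smoothTransition (n * (a i + l i p) - 1) • ((n : ℝ) • l i)) p := fun i => by
    have h1 : HasFDerivAt (fun q => (n : ℝ) * (a i + l i q) - 1) ((n : ℝ) • l i) p :=
      (((l i).hasFDerivAt.const_add (a i)).const_mul (n : ℝ)).sub_const 1
    have h2 : HasDerivAt Real.smoothTransition _ (n * (a i + l i p) - 1) :=
      ((Real.smoothTransition.contDiff (n := 1)).differentiable one_ne_zero _).hasDerivAt
    exact h2.comp_hasFDerivAt p h1
  have hprod := HasFDerivAt.finsetProd (u := Finset.univ) (fun i _ => hd i)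
  have heq : polyCutoff a l n = fun q => ∏ i, Real.smoothTransition (n * (a i + l i q) - 1) := rfl
  rw [heq, hprod.fderiv]
  simp only [_root_.sum_apply, _root_.smul_apply, smul_eq_mul]
  rw [← Finset.card_univ, ← nsmul_eq_mul]
  calc _ ≤ (∑ i, |(∏ j ∈ Finset.univ.erase i, Real.smoothTransition (n * (a j + l j p) - 1)) *
        (deriv Real.smoothTransition (n * (a i + l i p) - 1) * (n * l i v))|) * D := by
        gcongr; exact Finset.abs_sum_le_sum_abs _ _
    _ = ∑ i, |(∏ j ∈ Finset.univ.erase i, Real.smoothTransition (n * (a j + l j p) - 1)) *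
        (deriv Real.smoothTransition (n * (a i + l i p) - 1) * (n * l i v))| * D :=
        Finset.sum_mul _ _ _
    _ ≤ _ := by
        refine Finset.sum_le_card_nsmul _ _ _ fun i _ => ?_
        rw [abs_mul]
        have h1 : |∏ j ∈ Finset.univ.erase i, Real.smoothTransition (n * (a j + l j p) - 1)|
            ≤ 1 := by
          rw [Finset.abs_prod]
          refine Finset.prod_le_one (fun i _ => abs_nonneg _) fun i _ => ?_
          rw [abs_of_nonneg (Real.smoothTransition.nonneg _)]
          exact Real.smoothTransition.le_one _
        have h2 : |deriv Real.smoothTransition (n * (a i + l i p) - 1) * (n * l i v)| * D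
            ≤ 3 * C * M := by
          by_cases ht : 2 < |n * (a i + l i p) - 1|
          · rw [(hC _).2 ht]; simp; positivity
          · have h3 : n * (a i + l i p) ≤ 3 := by linarith [(abs_le.1 (not_lt.1 ht)).2]
            rw [abs_mul, abs_mul, Nat.abs_cast]
            calc _ ≤ C * (n * |l i v|) * D := by gcongr; exact (hC _).1
              _ = C * (n * (D * |l i v|)) := by ring
              _ ≤ C * (n * (M * (a i + l i p))) :=
                mul_le_mul_of_nonneg_left (mul_le_mul_of_nonneg_left (h i) n.cast_nonneg) hC0
              _ = C * M * (n * (a i + l i p)) := by ring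
              _ ≤ C * M * 3 := by gcongr
              _ = _ := by ring
        calc _ ≤ 1 * |deriv Real.smoothTransition (n * (a i + l i p) - 1) * (n * l i v)| * D := by
              gcongr
          _ ≤ _ := by rw [one_mul]; exact h2

/-- A smooth function that vanishes on the sides of a bounded polyhedron which are transversal to
`v` is bounded by the distance to these sides. -/
theorem exists_bound_of_vanishing {Ω : Set (ℝ × ℝ)} (hb : Bornology.IsBounded Ω)
    {v : ℝ × ℝ} {φ : ℝ × ℝ → ℂ} (hφ : ContDiff ℝ ∞ φ)
    (hpos : ∀ p ∈ Ω, ∀ i, 0 < a i + l i p)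
    (hv : ∀ p ∈ Ω, ∀ i, l i v ≠ 0 → φ (p - ((a i + l i p) / l i v) • v) = 0) :
    ∃ M, 0 ≤ M ∧ ∀ p ∈ Ω, ∀ i, ‖φ p‖ * |l i v| ≤ M * (a i + l i p) := by
  obtain ⟨R, hR0, hR⟩ := hb.subset_closedBall_lt 0 0
  have hB : ∀ i, ∃ B, 0 ≤ B ∧ ∀ p ∈ Ω, |a i + l i p| ≤ B := fun i =>
    ⟨|a i| + ‖l i‖ * R, by positivity, fun p hp => by
      refine (abs_add_le _ _).trans ?_
      gcongr
      refine ((l i).le_opNorm p).trans ?_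
      gcongr
      simpa using hR hp⟩
  choose B hB0 hB using hB
  -- The projection of `p` along `v` onto the hyperplane of a side may lie outside `Ω`. The enlarged
  -- ball contains all these projections, so that the mean value inequality applies on a convex set.
  set R' := R + ∑ i, B i / |l i v| * ‖v‖ with hR'
  have hRR : R ≤ R' := by
    have : 0 ≤ ∑ i, B i / |l i v| * ‖v‖ := Finset.sum_nonneg fun i _ => by
      have := hB0 i; positivity
    linarith
  have hdiff : Differentiable ℝ φ := hφ.differentiable (by simp)
  have hcont : Continuous (fderiv ℝ φ) := hφ.continuous_fderiv (by simp)
  obtain ⟨C, hC⟩ := (isCompact_closedBall (0 : ℝ × ℝ) R').exists_bound_of_continuousOn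
    hcont.continuousOn
  refine ⟨max C 0 * ‖v‖, by positivity, fun p hp i => ?_⟩
  by_cases hi : l i v = 0
  · rw [hi]; simp; have := hpos p hp i; positivity
  set p' := p - ((a i + l i p) / l i v) • v with hp'
  have hpp : ‖p - p'‖ = (a i + l i p) / |l i v| * ‖v‖ := by
    rw [hp', sub_sub_cancel, norm_smul, Real.norm_eq_abs, abs_div, abs_of_pos (hpos p hp i)]
  have hpR : p ∈ Metric.closedBall (0 : ℝ × ℝ) R' := Metric.closedBall_subset_closedBall hRR (hR hp)
  have hpR' : p' ∈ Metric.closedBall (0 : ℝ × ℝ) R' := by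
    rw [mem_closedBall_zero_iff]
    have h1 : ‖p'‖ ≤ ‖p‖ + ‖p - p'‖ := by
      have := norm_sub_le p (p - p'); rwa [sub_sub_cancel] at this
    have h2 : ‖p‖ ≤ R := by simpa using hR hp
    have h3 : ‖p - p'‖ ≤ B i / |l i v| * ‖v‖ := by
      rw [hpp]; gcongr; exact (le_abs_self _).trans (hB i p hp)
    have h4 : B i / |l i v| * ‖v‖ ≤ ∑ i, B i / |l i v| * ‖v‖ :=
      Finset.single_le_sum (f := fun i => B i / |l i v| * ‖v‖)
        (fun j _ => by have := hB0 j; positivity) (Finset.mem_univ i)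
    linarith
  have key := (convex_closedBall (0 : ℝ × ℝ) R').norm_image_sub_le_of_norm_fderiv_le
    (𝕜 := ℝ) (f := φ) (C := max C 0) (fun x _ => hdiff x)
    (fun x hx => (hC x hx).trans (le_max_left _ _)) hpR' hpR
  rw [hv p hp i hi, sub_zero, hpp] at key
  have hlv : 0 < |l i v| := abs_pos.2 hi
  calc ‖φ p‖ * |l i v| ≤ max C 0 * ((a i + l i p) / |l i v| * ‖v‖) * |l i v| := by gcongr
    _ = _ := by field_simp

/-- Integration by parts on a bounded polyhedron for a test function that vanishes on the sides
which are transversal to the direction of the derivative. -/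
theorem HasWeakDeriv.integral_eq {Ω : Set (ℝ × ℝ)}
    (hΩ : Ω = {p | ∀ i, 0 < a i + l i p}) (hb : Bornology.IsBounded Ω) {v : ℝ × ℝ}
    {f F : ℝ × ℝ → ℂ} (hf : IntegrableOn f Ω) (hF : IntegrableOn F Ω) (h : HasWeakDeriv Ω v f F)
    {φ : ℝ × ℝ → ℂ} (hφ : ContDiff ℝ ∞ φ)
    (hv : ∀ p ∈ Ω, ∀ i, l i v ≠ 0 → φ (p - ((a i + l i p) / l i v) • v) = 0) :
    ∫ p in Ω, f p * fderiv ℝ φ p v = -∫ p in Ω, F p * φ p := by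
  have hpos : ∀ p ∈ Ω, ∀ i, 0 < a i + l i p := fun p hp => by rw [hΩ] at hp; exact hp
  have hmeas : MeasurableSet Ω := by
    have : Ω = ⋂ i, {p | 0 < a i + l i p} := by rw [hΩ]; ext; simp
    rw [this]
    exact MeasurableSet.iInter fun i => measurableSet_lt measurable_const (by fun_prop)
  obtain ⟨M, hM0, hM⟩ := exists_bound_of_vanishing hb hφ hpos hv
  obtain ⟨C, hC0, hC⟩ := smoothTransition_deriv_bound
  have hdiff : Differentiable ℝ φ := hφ.differentiable (by simp)
  have hcont : Continuous fun p => fderiv ℝ φ p v :=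
    (hφ.continuous_fderiv (by simp)).clm_apply continuous_const
  have hcomp : IsCompact (closure Ω) := hb.isCompact_closure
  obtain ⟨B1, hB1⟩ := hcomp.exists_bound_of_continuousOn hφ.continuous.continuousOn
  obtain ⟨B2, hB2⟩ := hcomp.exists_bound_of_continuousOn hcont.continuousOn
  -- The products `θ n * φ` are admissible test functions. Near each point of `Ω` they eventually
  -- coincide with `φ`, and the term with the derivative of `θ n` is dominated thanks to `hM`.
  let θ := polyCutoff a l
  let ψ : ℕ → ℝ × ℝ → ℂ := fun n p => (θ n p : ℂ) * φ p
  have hθd : ∀ n, ContDiff ℝ ∞ (θ n) := polyCutoff_contDiff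
  have hθc : ∀ n, ContDiff ℝ ∞ fun p => (θ n p : ℂ) := fun n =>
    Complex.ofRealCLM.contDiff.comp (hθd n)
  have hψ : ∀ n, ContDiff ℝ ∞ (ψ n) := fun n => (hθc n).mul hφ
  have hfd : ∀ n p, fderiv ℝ (ψ n) p v
      = (θ n p : ℂ) * fderiv ℝ φ p v + ((fderiv ℝ (θ n) p v : ℝ) : ℂ) * φ p := fun n p => by
    have h1 : HasFDerivAt (fun p => (θ n p : ℂ)) (Complex.ofRealCLM.comp (fderiv ℝ (θ n) p)) p :=
      Complex.ofRealCLM.hasFDerivAt.comp p ((hθd n).differentiable (by simp) p).hasFDerivAt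
    rw [show ψ n = (fun p => (θ n p : ℂ)) * φ from rfl, (h1.mul (hdiff p).hasFDerivAt).fderiv]
    simp [mul_comm]
  have hsupp : ∀ n, tsupport (ψ n) ⊆ {p | ∀ i, 1 ≤ n * (a i + l i p)} := fun n => by
    refine closure_minimal ?_ ?_
    · intro p hp
      refine polyCutoff_support n fun h0 => hp ?_
      change ((polyCutoff a l n p : ℝ) : ℂ) * φ p = 0
      rw [h0]; simp
    · have : {p | ∀ i, 1 ≤ n * (a i + l i p)} = ⋂ i, {p | 1 ≤ n * (a i + l i p)} := by ext; simp
      rw [this]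
      exact isClosed_iInter fun i => isClosed_le continuous_const (by fun_prop)
  have hsub : ∀ n : ℕ, {p | ∀ i, 1 ≤ n * (a i + l i p)} ⊆ Ω := fun n p hp => by
    rw [hΩ]
    intro i
    have := hp i
    by_contra hneg
    have : (n : ℝ) * (a i + l i p) ≤ 0 := mul_nonpos_of_nonneg_of_nonpos n.cast_nonneg (not_lt.1 hneg)
    linarith [hp i]
  have hsuppΩ : ∀ n, tsupport (ψ n) ⊆ Ω := fun n => (hsupp n).trans (hsub n)
  have hcs : ∀ n, HasCompactSupport (ψ n) := fun n =>
    Metric.isCompact_of_isClosed_isBounded (isClosed_tsupport _) (hb.subset (hsuppΩ n))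
  have hid : ∀ n, ∫ p in Ω, f p * fderiv ℝ (ψ n) p v = -∫ p in Ω, F p * ψ n p := fun n =>
    h (ψ n) (hψ n) (hcs n) (hsuppΩ n)
  have hB2' : ∀ p ∈ Ω, ‖fderiv ℝ φ p v‖ ≤ B2 := fun p hp => hB2 p (subset_closure hp)
  have hB1' : ∀ p ∈ Ω, ‖φ p‖ ≤ B1 := fun p hp => hB1 p (subset_closure hp)
  have lim1 : Tendsto (fun n => ∫ p in Ω, f p * fderiv ℝ (ψ n) p v) atTop
      (𝓝 (∫ p in Ω, f p * fderiv ℝ φ p v)) := by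
    refine tendsto_integral_of_dominated_convergence
      (fun p => ‖f p‖ * (B2 + Fintype.card ι * (3 * C * M))) (fun n => ?_) (hf.norm.mul_const _)
      (fun n => ?_) ?_
    · exact hf.aestronglyMeasurable.mul
        (((hψ n).continuous_fderiv (by simp)).clm_apply continuous_const).aestronglyMeasurable
    · refine (ae_restrict_iff' hmeas).2 (Eventually.of_forall fun p hp => ?_)
      rw [norm_mul, hfd]
      gcongr
      refine (norm_add_le _ _).trans (add_le_add ?_ ?_)
      · rw [norm_mul, Complex.norm_real, Real.norm_eq_abs]
        calc _ ≤ 1 * ‖fderiv ℝ φ p v‖ := by gcongr; exact polyCutoff_abs_le n p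
          _ ≤ _ := by rw [one_mul]; exact hB2' p hp
      · rw [norm_mul, Complex.norm_real, Real.norm_eq_abs]
        exact polyCutoff_fderiv_le hC0 hC n hM0 (norm_nonneg _) (hM p hp)
    · refine (ae_restrict_iff' hmeas).2 (Eventually.of_forall fun p hp => ?_)
      refine tendsto_const_nhds.congr' ?_
      filter_upwards [polyCutoff_eventually_one (hpos p hp)] with n hn
      have : ψ n =ᶠ[𝓝 p] φ := by
        filter_upwards [hn] with q hq
        change ((polyCutoff a l n q : ℝ) : ℂ) * φ q = φ q
        rw [hq]; simp
      rw [this.fderiv_eq]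
  have lim2 : Tendsto (fun n => -∫ p in Ω, F p * ψ n p) atTop (𝓝 (-∫ p in Ω, F p * φ p)) := by
    refine (tendsto_integral_of_dominated_convergence
      (fun p => ‖F p‖ * B1) (fun n => ?_) (hF.norm.mul_const _)
      (fun n => ?_) ?_).neg
    · exact hF.aestronglyMeasurable.mul (hψ n).continuous.aestronglyMeasurable
    · refine (ae_restrict_iff' hmeas).2 (Eventually.of_forall fun p hp => ?_)
      rw [norm_mul]
      gcongr
      rw [norm_mul, Complex.norm_real, Real.norm_eq_abs]
      calc _ ≤ 1 * ‖φ p‖ := by gcongr; exact polyCutoff_abs_le n p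
        _ ≤ _ := by rw [one_mul]; exact hB1' p hp
    · refine (ae_restrict_iff' hmeas).2 (Eventually.of_forall fun p hp => ?_)
      refine tendsto_const_nhds.congr' ?_
      filter_upwards [polyCutoff_eventually_one (hpos p hp)] with n hn
      change F p * φ p = F p * (((polyCutoff a l n p : ℝ) : ℂ) * φ p)
      rw [hn.self_of_nhds]; simp
  simp_rw [hid] at lim1
  exact tendsto_nhds_unique lim1 lim2

end Polyhedron

end IntegroDiff

/-! ### The square and the two triangles. -/

namespace IntegroDiff

open Filter Topology

variable {L : ℝ}

theorem isOpen_square : IsOpen (square L) := isOpen_Ioo.prod isOpen_Ioo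

theorem isOpen_triMinus : IsOpen (triMinus L) :=
  isOpen_square.inter (isOpen_lt continuous_snd continuous_fst)

theorem isOpen_triPlus : IsOpen (triPlus L) :=
  isOpen_square.inter (isOpen_lt continuous_fst continuous_snd)

theorem triMinus_subset : triMinus L ⊆ square L := fun _ hp => hp.1

theorem triPlus_subset : triPlus L ⊆ square L := fun _ hp => hp.1

theorem isBounded_square : Bornology.IsBounded (square L) :=
  (Metric.isBounded_Ioo 0 L).prod (Metric.isBounded_Ioo 0 L)

instance : IsFiniteMeasure (volume.restrict (square L)) :=
  ⟨by rw [Measure.restrict_apply_univ]; exact isBounded_square.measure_lt_top⟩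

instance : IsFiniteMeasure (volume.restrict (triMinus L)) :=
  ⟨by rw [Measure.restrict_apply_univ]
      exact (isBounded_square.subset triMinus_subset).measure_lt_top⟩

instance : IsFiniteMeasure (volume.restrict (triPlus L)) :=
  ⟨by rw [Measure.restrict_apply_univ]
      exact (isBounded_square.subset triPlus_subset).measure_lt_top⟩

theorem volume_restrict_square :
    volume.restrict (square L)
      = (volume.restrict (Ioo 0 L)).prod (volume.restrict (Ioo 0 L)) := by
  rw [Measure.prod_restrict]; rfl

theorem volume_diagonal : (volume : Measure (ℝ × ℝ)) {p | p.1 = p.2} = 0 := by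
  have h : MeasurableSet {p : ℝ × ℝ | p.1 = p.2} := measurableSet_eq_fun measurable_fst measurable_snd
  rw [show (volume : Measure (ℝ × ℝ)) = volume.prod volume from rfl, Measure.prod_apply h]
  simp [preimage]

theorem ae_square_cases : ∀ᵐ p ∂(volume.restrict (square L)), p ∈ triMinus L ∨ p ∈ triPlus L := by
  rw [ae_restrict_iff' isOpen_square.measurableSet]
  have h : ∀ᵐ p : ℝ × ℝ, ¬ p.1 = p.2 := by
    rw [ae_iff]; simpa using volume_diagonal
  filter_upwards [h] with p hp hps
  rcases lt_or_gt_of_ne hp with h | h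
  · exact Or.inr ⟨hps, h⟩
  · exact Or.inl ⟨hps, h⟩

theorem triUnion_ae_eq : (triMinus L ∪ triPlus L : Set (ℝ × ℝ)) =ᵐ[volume] square L := by
  have h := ae_square_cases (L := L)
  rw [ae_restrict_iff' isOpen_square.measurableSet] at h
  filter_upwards [h] with p hp
  exact propext ⟨fun h => h.elim (fun h => h.1) fun h => h.1, fun h => hp h⟩

theorem disjoint_tri : Disjoint (triMinus L) (triPlus L) :=
  Set.disjoint_left.2 fun _ h1 h2 => lt_asymm h1.2 h2.2

theorem integral_square_eq_add {f : ℝ × ℝ → ℂ} (hf : IntegrableOn f (square L)) :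
    ∫ p in square L, f p = (∫ p in triMinus L, f p) + ∫ p in triPlus L, f p := by
  rw [← setIntegral_congr_set triUnion_ae_eq, setIntegral_union disjoint_tri
    isOpen_triPlus.measurableSet (hf.mono_set triMinus_subset) (hf.mono_set triPlus_subset)]

/-- Each of the sides `x = 0`, `y = L`, `x = y` imposes a condition only if `v` crosses it. The
vanishing is asked on whole lines because the projection along `v` of a point of the triangle may
leave the closed triangle. -/
theorem HasWeakDeriv.integral_triPlus {v : ℝ × ℝ} {f F : ℝ × ℝ → ℂ}
    (hf : MemLp f 2 (volume.restrict (triPlus L))) (hF : MemLp F 2 (volume.restrict (triPlus L)))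
    (h : HasWeakDeriv (triPlus L) v f F) {φ : ℝ × ℝ → ℂ} (hφ : ContDiff ℝ ∞ φ)
    (h1 : v.1 ≠ 0 → ∀ y, φ (0, y) = 0) (h2 : v.2 ≠ 0 → ∀ x, φ (x, L) = 0)
    (h3 : v.2 - v.1 ≠ 0 → ∀ x, φ (x, x) = 0) :
    ∫ p in triPlus L, f p * fderiv ℝ φ p v = -∫ p in triPlus L, F p * φ p := by
  refine HasWeakDeriv.integral_eq (ι := Fin 3) (a := ![0, L, 0])
    (l := ![ContinuousLinearMap.fst ℝ ℝ ℝ, -ContinuousLinearMap.snd ℝ ℝ ℝ,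
      ContinuousLinearMap.snd ℝ ℝ ℝ - ContinuousLinearMap.fst ℝ ℝ ℝ]) ?_
    (isBounded_square.subset triPlus_subset) (hf.integrable one_le_two)
    (hF.integrable one_le_two) h hφ ?_
  · ext ⟨x, y⟩
    simp only [triPlus, square, mem_ofPred_eq, mem_prod, mem_Ioo, Fin.forall_fin_succ]
    simp
    grind
  · rintro ⟨x, y⟩ -
    simp only [Fin.forall_fin_succ]
    refine ⟨fun hv => ?_, fun hv => ?_, fun hv => ?_, fun i => i.elim0⟩
    · simp at hv
      convert h1 hv (y - x / v.1 * v.2) using 2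
      ext <;> simp [hv]
    · simp at hv
      convert h2 hv (x - (L - y) / -v.2 * v.1) using 2
      ext
      · simp; left; ring
      · simp; field_simp; ring
    · simp at hv
      convert h3 hv (x - (y - x) / (v.2 - v.1) * v.1) using 2
      ext
      · simp
      · simp; field_simp; ring

theorem HasWeakDeriv.integral_triMinus {v : ℝ × ℝ} {f F : ℝ × ℝ → ℂ}
    (hf : MemLp f 2 (volume.restrict (triMinus L))) (hF : MemLp F 2 (volume.restrict (triMinus L)))
    (h : HasWeakDeriv (triMinus L) v f F) {φ : ℝ × ℝ → ℂ} (hφ : ContDiff ℝ ∞ φ)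
    (h1 : v.1 ≠ 0 → ∀ y, φ (L, y) = 0) (h2 : v.2 ≠ 0 → ∀ x, φ (x, 0) = 0)
    (h3 : v.1 - v.2 ≠ 0 → ∀ x, φ (x, x) = 0) :
    ∫ p in triMinus L, f p * fderiv ℝ φ p v = -∫ p in triMinus L, F p * φ p := by
  refine HasWeakDeriv.integral_eq (ι := Fin 3) (a := ![L, 0, 0])
    (l := ![-ContinuousLinearMap.fst ℝ ℝ ℝ, ContinuousLinearMap.snd ℝ ℝ ℝ,
      ContinuousLinearMap.fst ℝ ℝ ℝ - ContinuousLinearMap.snd ℝ ℝ ℝ]) ?_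
    (isBounded_square.subset triMinus_subset) (hf.integrable one_le_two)
    (hF.integrable one_le_two) h hφ ?_
  · ext ⟨x, y⟩
    simp only [triMinus, square, mem_ofPred_eq, mem_prod, mem_Ioo, Fin.forall_fin_succ]
    simp
    grind
  · rintro ⟨x, y⟩ -
    simp only [Fin.forall_fin_succ]
    refine ⟨fun hv => ?_, fun hv => ?_, fun hv => ?_, fun i => i.elim0⟩
    · simp at hv
      convert h1 hv (y - (L - x) / -v.1 * v.2) using 2
      ext
      · simp; field_simp; ring
      · simp; left; ring
    · simp at hv
      convert h2 hv (x - y / v.2 * v.1) using 2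
      ext <;> simp [hv]
    · simp at hv
      convert h3 hv (x - (x - y) / (v.1 - v.2) * v.1) using 2
      ext
      · simp
      · simp; field_simp; ring

/-- Vertical projection keeps `x`, so vanishing for `x ∈ Ioo 0 L` is enough. The test function of
`boundary_square` need not vanish on the rest of the line `y = 0`. -/
theorem HasWeakDeriv.integral_square {f F : ℝ × ℝ → ℂ}
    (hf : MemLp f 2 (volume.restrict (square L))) (hF : MemLp F 2 (volume.restrict (square L)))
    (h : HasWeakDeriv (square L) (0, 1) f F) {φ : ℝ × ℝ → ℂ} (hφ : ContDiff ℝ ∞ φ)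
    (h1 : ∀ x ∈ Ioo 0 L, φ (x, 0) = 0) (h2 : ∀ x ∈ Ioo 0 L, φ (x, L) = 0) :
    ∫ p in square L, f p * fderiv ℝ φ p (0, 1) = -∫ p in square L, F p * φ p := by
  refine HasWeakDeriv.integral_eq (ι := Fin 4) (a := ![0, L, 0, L])
    (l := ![ContinuousLinearMap.fst ℝ ℝ ℝ, -ContinuousLinearMap.fst ℝ ℝ ℝ,
      ContinuousLinearMap.snd ℝ ℝ ℝ, -ContinuousLinearMap.snd ℝ ℝ ℝ]) ?_
    isBounded_square (hf.integrable one_le_two) (hF.integrable one_le_two) h hφ ?_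
  · ext ⟨x, y⟩
    simp only [square, mem_ofPred_eq, mem_prod, mem_Ioo, Fin.forall_fin_succ]
    simp
    grind
  · rintro ⟨x, y⟩ hp
    simp only [Fin.forall_fin_succ]
    refine ⟨fun hv => ?_, fun hv => ?_, fun hv => ?_, fun hv => ?_, fun i => i.elim0⟩
    · simp at hv
    · simp at hv
    · convert h1 x hp.1 using 2
      ext <;> simp
    · convert h2 x hp.1 using 2
      ext <;> simp
      ring

theorem HasWeakDeriv.mono {E : Type} [NormedAddCommGroup E] [NormedSpace ℝ E] [MeasureSpace E]
    {Ω Ω' : Set E} (hs : Ω' ⊆ Ω) (hm : MeasurableSet Ω) {v : E} {f F : E → ℂ}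
    (h : HasWeakDeriv Ω v f F) : HasWeakDeriv Ω' v f F := by
  intro φ hφ hc ht
  have h0 : ∀ p, p ∉ Ω' → φ p = 0 := fun p hp => image_eq_zero_of_notMem_tsupport fun h => hp (ht h)
  have h1 : ∀ p, p ∉ Ω' → fderiv ℝ φ p v = 0 := fun p hp => by
    rw [show fderiv ℝ φ p = 0 from ?_]; · simp
    by_contra hne
    exact hp (ht (support_fderiv_subset ℝ (Function.mem_support.2 hne)))
  have := h φ hφ hc (ht.trans hs)
  rwa [setIntegral_eq_of_subset_of_forall_sdiff_eq_zero hm hs (fun p hp => by rw [h1 p hp.2, mul_zero]),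
    setIntegral_eq_of_subset_of_forall_sdiff_eq_zero hm hs (fun p hp => by rw [h0 p hp.2, mul_zero])]
    at this

end IntegroDiff

/-! ### Classes in `L²(0,L)` and measurability of slices. -/

namespace IntegroDiff

open Filter Topology

variable {L : ℝ}

open Classical in
/-- The class in `L²(0,L)` of a function (zero if the function is not square integrable). -/
noncomputable def toL2 (L : ℝ) (w : ℝ → ℂ) : L2 L :=
  if h : MemLp w 2 (volume.restrict (Ioo 0 L)) then h.toLp w else 0

theorem toL2_coeFn {w : ℝ → ℂ} (h : MemLp w 2 (volume.restrict (Ioo 0 L))) :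
    toL2 L w =ᵐ[volume.restrict (Ioo 0 L)] w := by
  rw [toL2, dif_pos h]; exact h.coeFn_toLp

theorem toL2_congr {w w' : ℝ → ℂ} (h : w =ᵐ[volume.restrict (Ioo 0 L)] w') :
    toL2 L w = toL2 L w' := by
  by_cases hw : MemLp w 2 (volume.restrict (Ioo 0 L))
  · have hw' := hw.ae_eq h
    rw [toL2, toL2, dif_pos hw, dif_pos hw', MemLp.toLp_eq_toLp_iff]
    exact h
  · have hw' : ¬ MemLp w' 2 (volume.restrict (Ioo 0 L)) := fun h' => hw (h'.ae_eq h.symm)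
    rw [toL2, toL2, dif_neg hw, dif_neg hw']

theorem intervalIntegral_eq_Ioo {E : Type} [NormedAddCommGroup E] [NormedSpace ℝ E] {a b : ℝ}
    (hab : a ≤ b) (f : ℝ → E) : ∫ x in a..b, f x = ∫ x in Ioo a b, f x := by
  rw [intervalIntegral.integral_of_le hab, integral_Ioc_eq_integral_Ioo]

theorem inner_toL2 (hL : 0 ≤ L) {w : ℝ → ℂ} (h : MemLp w 2 (volume.restrict (Ioo 0 L)))
    (k : L2 L) : inner ℂ (toL2 L w) k = ∫ y in (0 : ℝ)..L, k y * conj (w y) := by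
  rw [L2.inner_def, intervalIntegral_eq_Ioo hL]
  refine integral_congr_ae ?_
  filter_upwards [toL2_coeFn h] with y hy
  rw [hy, RCLike.inner_apply]

theorem norm_toL2_sq {w : ℝ → ℂ} (h : MemLp w 2 (volume.restrict (Ioo 0 L))) :
    ‖toL2 L w‖ ^ 2 = ∫ y in Ioo 0 L, ‖w y‖ ^ 2 := by
  have h1 := inner_self_eq_norm_sq_to_K (𝕜 := ℂ) (toL2 L w)
  rw [L2.inner_def] at h1
  have h2 : ∫ y in Ioo 0 L, inner ℂ (toL2 L w y) (toL2 L w y)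
      = ∫ y in Ioo 0 L, ((‖w y‖ ^ 2 : ℝ) : ℂ) := by
    refine integral_congr_ae ?_
    filter_upwards [toL2_coeFn h] with y hy
    rw [hy, inner_self_eq_norm_sq_to_K]; simp
  rw [h2, integral_complex_ofReal] at h1
  exact Complex.ofReal_injective ((Complex.ofReal_pow _ _).trans h1.symm)

theorem ContinuousOn.memLp_Ioo {w : ℝ → ℂ} (h : ContinuousOn w (Icc 0 L)) :
    MemLp w 2 (volume.restrict (Ioo 0 L)) := by
  obtain ⟨C, hC⟩ := isCompact_Icc.exists_bound_of_continuousOn h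
  exact MemLp.of_bound ((h.mono Ioo_subset_Icc_self).aestronglyMeasurable measurableSet_Ioo) C
    ((ae_restrict_iff' measurableSet_Ioo).2
      (Eventually.of_forall fun x hx => hC x (Ioo_subset_Icc_self hx)))

theorem Continuous.memLp_Ioo {w : ℝ → ℂ} (h : Continuous w) :
    MemLp w 2 (volume.restrict (Ioo 0 L)) := ContinuousOn.memLp_Ioo h.continuousOn

theorem MemLp.slice_ae {μ ν : Measure ℝ} [SFinite μ] [SFinite ν] {γ : ℝ × ℝ → ℂ}
    (h : MemLp γ 2 (μ.prod ν)) : ∀ᵐ x ∂μ, MemLp (fun y => γ (x, y)) 2 ν := by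
  have h1 := (memLp_two_iff_integrable_sq_norm h.1).1 h
  filter_upwards [h1.prod_right_ae, h.1.prodMk_left] with x hx hm
  exact (memLp_two_iff_integrable_sq_norm hm).2 hx

/-- By the Lindelöf property every open set is a countable union of balls. Preimages of balls are
what can be computed for maps into `L2 L`. -/
theorem measurable_of_measurableSet_preimage_ball {X : Type} [PseudoMetricSpace X]
    [SecondCountableTopology X] [MeasurableSpace X] [BorelSpace X] {F : ℝ → X}
    (h : ∀ c r, MeasurableSet (F ⁻¹' Metric.ball c r)) : Measurable F := by
  refine measurable_of_isOpen fun O hO => ?_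
  have h1 : ∀ c : O, ∃ r > 0, Metric.ball (c : X) r ⊆ O := fun c => Metric.isOpen_iff.1 hO c c.2
  choose r hr hsub using h1
  obtain ⟨T, hT, hTe⟩ := TopologicalSpace.isOpen_iUnion_countable
    (fun c : O => Metric.ball (c : X) (r c)) (fun c => Metric.isOpen_ball)
  have hO' : O = ⋃ c ∈ T, Metric.ball (c : X) (r c) := by
    rw [hTe]
    refine Subset.antisymm (fun x hx => ?_) (iUnion_subset hsub)
    exact mem_iUnion.2 ⟨⟨x, hx⟩, Metric.mem_ball_self (hr _)⟩
  rw [hO', preimage_iUnion₂]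
  exact MeasurableSet.biUnion hT fun c _ => h _ _

/-- The distance from a slice to a fixed class is an integral depending on a parameter, hence
measurable by Tonelli; separability of `L2 L` then gives measurability of the slice map. -/
theorem aestronglyMeasurable_toL2_slice {γ : ℝ × ℝ → ℂ}
    (hγ : MemLp γ 2 (volume.restrict (square L))) :
    AEStronglyMeasurable (fun x => toL2 L (fun y => γ (x, y))) (volume.restrict (Ioo 0 L)) := by
  rw [volume_restrict_square] at hγ
  set μ := volume.restrict (Ioo 0 L) with hμ
  let γ1 := hγ.1.mk γ
  have hγ1 : Measurable γ1 := hγ.1.stronglyMeasurable_mk.measurable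
  let I : ℝ → ENNReal := fun x => ∫⁻ y, ‖γ1 (x, y)‖ₑ ^ 2 ∂μ
  have hI : Measurable I := Measurable.lintegral_prod_right' (hγ1.enorm.pow_const 2)
  let A : Set ℝ := {x | I x < ⊤}
  have hA : MeasurableSet A := measurableSet_lt hI measurable_const
  -- Slices of infinite norm are replaced by zero. Every slice is then square integrable and `toL2`
  -- never takes its default value.
  let γ2 : ℝ × ℝ → ℂ := fun p => (A ×ˢ univ).indicator γ1 p
  have hγ2 : Measurable γ2 := hγ1.indicator (hA.prod MeasurableSet.univ)
  have hmem : ∀ x, MemLp (fun y => γ2 (x, y)) 2 μ := fun x => by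
    by_cases hx : x ∈ A
    · refine ⟨(hγ2.comp measurable_prodMk_left).aestronglyMeasurable, ?_⟩
      rw [eLpNorm_lt_top_iff_lintegral_rpow_enorm_lt_top (by norm_num) (by norm_num)]
      have : I x < ⊤ := hx
      simpa [γ2, indicator, hx] using this
    · have : (fun y => γ2 (x, y)) = fun _ => 0 := by ext y; simp [γ2, hx]
      rw [this]; exact MemLp.zero
  have : Fact ((2 : ENNReal) ≠ ⊤) := ⟨by norm_num⟩
  let : MeasurableSpace (L2 L) := borel _
  have : BorelSpace (L2 L) := ⟨rfl⟩
  have hmeas : Measurable fun x => toL2 L (fun y => γ2 (x, y)) := by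
    refine measurable_of_measurableSet_preimage_ball fun c r => ?_
    have hc : Measurable (c : ℝ → ℂ) := (Lp.stronglyMeasurable c).measurable
    have h1 : ∀ x, edist (toL2 L (fun y => γ2 (x, y))) c
        = (∫⁻ y, ‖γ2 (x, y) - c y‖ₑ ^ 2 ∂μ) ^ (1 / 2 : ℝ) := fun x => by
      rw [Lp.edist_def, eLpNorm_eq_lintegral_rpow_enorm_toReal (by norm_num) (by norm_num)]
      simp only [ENNReal.toReal_ofNat, ENNReal.rpow_ofNat, Pi.sub_apply]
      congr 1
      refine lintegral_congr_ae ?_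
      filter_upwards [toL2_coeFn (hmem x)] with y hy
      rw [hy]
    have h2 : (fun x => toL2 L (fun y => γ2 (x, y))) ⁻¹' Metric.ball c r
        = {x | (∫⁻ y, ‖γ2 (x, y) - c y‖ₑ ^ 2 ∂μ) ^ (1 / 2 : ℝ) < ENNReal.ofReal r} := by
      ext x
      rw [mem_preimage, Metric.mem_ball, mem_ofPred_eq, ← h1, edist_lt_ofReal]
    rw [h2]
    refine measurableSet_lt (Measurable.pow_const ?_ _) measurable_const
    exact Measurable.lintegral_prod_right'
      (f := fun p : ℝ × ℝ => ‖γ2 p - c p.2‖ₑ ^ 2)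
      ((hγ2.sub (hc.comp measurable_snd)).enorm.pow_const 2)
  refine ⟨_, hmeas.stronglyMeasurable, ?_⟩
  have hγ1' : MemLp γ1 2 (μ.prod μ) := hγ.ae_eq hγ.1.ae_eq_mk
  filter_upwards [MemLp.slice_ae hγ1', Measure.ae_ae_of_ae_prod hγ.1.ae_eq_mk] with x hx he
  have hxA : x ∈ A := by
    have := (eLpNorm_lt_top_iff_lintegral_rpow_enorm_lt_top (by norm_num) (by norm_num)).1 hx.2
    change I x < ⊤
    simpa [I] using this
  refine toL2_congr ?_
  filter_upwards [he] with y hy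
  simp [γ2, hxA, γ1, hy]

theorem memLp_toL2_slice {γ : ℝ × ℝ → ℂ} (hγ : MemLp γ 2 (volume.restrict (square L))) :
    MemLp (fun x => toL2 L (fun y => γ (x, y))) 2 (volume.restrict (Ioo 0 L)) := by
  have hm := aestronglyMeasurable_toL2_slice hγ
  rw [volume_restrict_square] at hγ
  rw [← memLp_norm_iff hm, memLp_two_iff_integrable_sq hm.norm]
  have h1 := ((memLp_two_iff_integrable_sq_norm hγ.1).1 hγ).integral_prod_left
  refine h1.congr ?_
  filter_upwards [MemLp.slice_ae hγ] with x hx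
  exact (norm_toL2_sq hx).symm

end IntegroDiff

/-! ### The kernel operator, and the weak form as an identity of inner products. -/

namespace IntegroDiff

open Filter Topology

variable {L : ℝ}

theorem toL2_sub {w w' : ℝ → ℂ} (h : MemLp w 2 (volume.restrict (Ioo 0 L)))
    (h' : MemLp w' 2 (volume.restrict (Ioo 0 L))) :
    toL2 L (fun y => w y - w' y) = toL2 L w - toL2 L w' := by
  rw [toL2, toL2, toL2, dif_pos h, dif_pos h', dif_pos (show MemLp (fun y => w y - w' y) 2 _ from h.sub h')]
  exact MemLp.toLp_sub h h'

theorem norm_toL2_le {w : ℝ → ℂ} (h : MemLp w 2 (volume.restrict (Ioo 0 L))) {C : ℝ} (hC : 0 ≤ C)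
    (hw : ∀ y ∈ Ioo 0 L, ‖w y‖ ≤ C) :
    ‖toL2 L w‖ ≤ (measureUnivNNReal (volume.restrict (Ioo 0 L)) : ℝ) ^ (2 : ENNReal).toReal⁻¹ * C := by
  refine Lp.norm_le_of_ae_bound hC ?_
  filter_upwards [toL2_coeFn h, ae_restrict_mem measurableSet_Ioo] with y hy hm
  rw [hy]; exact hw y hm

theorem continuous_toL2 {w : ℝ → ℝ → ℂ} (h : Continuous (Function.uncurry w)) :
    Continuous fun x => toL2 L (w x) := by
  have hs : ∀ x, Continuous (w x) := fun x => h.comp (Continuous.prodMk_right x)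
  rw [continuous_iff_continuousAt]
  intro x₀
  rw [ContinuousAt, tendsto_iff_norm_sub_tendsto_zero]
  set M := (measureUnivNNReal (volume.restrict (Ioo 0 L)) : ℝ) ^ (2 : ENNReal).toReal⁻¹ with hM
  have hM0 : 0 ≤ M := by positivity
  rw [Metric.tendsto_nhds]
  intro ε hε
  have h1 : ∀ᶠ x in 𝓝 x₀, ∀ y ∈ Icc 0 L, ‖w x y - w x₀ y‖ < ε / (M + 1) := by
    refine isCompact_Icc.eventually_forall_of_forall_eventually fun y _ => ?_
    have hc : Continuous fun z : ℝ × ℝ => ‖w z.1 z.2 - w x₀ z.2‖ := by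
      have h2 : Continuous fun z : ℝ × ℝ => w x₀ z.2 := (hs x₀).comp continuous_snd
      exact (Continuous.sub h h2).norm
    have : ∀ᶠ z in 𝓝 (x₀, y), ‖w z.1 z.2 - w x₀ z.2‖ < ε / (M + 1) := by
      refine hc.continuousAt.eventually (gt_mem_nhds ?_)
      simp; positivity
    exact this
  filter_upwards [h1] with x hx
  rw [← toL2_sub (Continuous.memLp_Ioo (hs x)) (Continuous.memLp_Ioo (hs x₀)), dist_zero_right,
    norm_norm]
  refine (norm_toL2_le (Continuous.memLp_Ioo ((hs x).sub (hs x₀))) (C := ε / (M + 1))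
    (by positivity) fun y hy => (hx y (Ioo_subset_Icc_self hy)).le).trans_lt ?_
  rw [← hM, mul_div_assoc', div_lt_iff₀ (by positivity)]
  nlinarith

/-- The source `conj g(·,x)` of the kernel equation as an element of `L²(0,L)`. -/
noncomputable def source (L : ℝ) (g : ℝ → ℝ → ℂ) (x : ℝ) : L2 L := toL2 L fun y => conj (g y x)

theorem memLp_conj_swap {g : ℝ → ℝ → ℂ}
    (hg : MemLp (Function.uncurry g) 2 (volume.restrict (square L))) :
    MemLp (fun p : ℝ × ℝ => conj (g p.2 p.1)) 2 (volume.restrict (square L)) := by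
  rw [volume_restrict_square] at hg ⊢
  have := (hg.comp_measurePreserving Measure.measurePreserving_swap).star
  exact this

variable {g : ℝ → ℝ → ℂ}

theorem source_ae_memLp (hg : MemLp (Function.uncurry g) 2 (volume.restrict (square L))) :
    ∀ᵐ x ∂volume.restrict (Ioo 0 L),
      MemLp (fun y => conj (g y x)) 2 (volume.restrict (Ioo 0 L)) := by
  have := memLp_conj_swap hg
  rw [volume_restrict_square] at this
  exact MemLp.slice_ae this

theorem source_memLp (hg : MemLp (Function.uncurry g) 2 (volume.restrict (square L))) :
    MemLp (source L g) 2 (volume.restrict (Ioo 0 L)) := memLp_toL2_slice (memLp_conj_swap hg)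

theorem integrable_smul_source (hg : MemLp (Function.uncurry g) 2 (volume.restrict (square L)))
    (k : L2 L) : Integrable (fun y => k y • source L g y) (volume.restrict (Ioo 0 L)) := by
  rw [← memLp_one_iff_integrable]
  exact (source_memLp hg).smul (Lp.memLp k)

theorem norm_integral_smul_source_le
    (hg : MemLp (Function.uncurry g) 2 (volume.restrict (square L))) (k : L2 L) :
    ‖∫ y in Ioo 0 L, k y • source L g y‖
      ≤ (eLpNorm (source L g) 2 (volume.restrict (Ioo 0 L))).toReal * ‖k‖ := by
  have h1 : ‖∫ y in Ioo 0 L, k y • source L g y‖ₑ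
      ≤ eLpNorm k 2 (volume.restrict (Ioo 0 L))
        * eLpNorm (source L g) 2 (volume.restrict (Ioo 0 L)) := by
    refine (enorm_integral_le_lintegral_enorm _).trans ?_
    rw [← eLpNorm_one_eq_lintegral_enorm]
    have h := eLpNorm_smul_le_mul_eLpNorm (p := 2) (q := 2) (r := 1)
      (source_memLp hg).1 (Lp.memLp k).1
    exact h
  have h2 := ENNReal.toReal_mono (ENNReal.mul_ne_top (Lp.memLp k).2.ne (source_memLp hg).2.ne) h1
  rw [ENNReal.toReal_mul, ← Lp.norm_def, mul_comm, toReal_enorm] at h2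
  exact h2

theorem integral_add_smul_source
    (hg : MemLp (Function.uncurry g) 2 (volume.restrict (square L))) (k k' : L2 L) :
    ∫ y in Ioo 0 L, (k + k') y • source L g y
      = (∫ y in Ioo 0 L, k y • source L g y) + ∫ y in Ioo 0 L, k' y • source L g y := by
  rw [← integral_add (integrable_smul_source hg k) (integrable_smul_source hg k')]
  refine integral_congr_ae ?_
  filter_upwards [Lp.coeFn_add k k'] with y hy
  rw [hy, Pi.add_apply, add_smul]

theorem integral_smul_smul_source (c : ℂ) (k : L2 L) :
    ∫ y in Ioo 0 L, (c • k) y • source L g y = c • ∫ y in Ioo 0 L, k y • source L g y := by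
  rw [← integral_smul]
  refine integral_congr_ae ?_
  filter_upwards [Lp.coeFn_smul c k] with y hy
  rw [hy, Pi.smul_apply, smul_assoc]

/-- The operator `k ↦ ∫₀ᴸ conj g(·,σ) k(σ) dσ` of `L²(0,L)`. -/
noncomputable def kernelOp (hg : MemLp (Function.uncurry g) 2 (volume.restrict (square L))) :
    L2 L →L[ℂ] L2 L :=
  LinearMap.mkContinuous
    { toFun := fun k => ∫ y in Ioo 0 L, k y • source L g y
      map_add' := integral_add_smul_source hg
      map_smul' := integral_smul_smul_source }
    (eLpNorm (source L g) 2 (volume.restrict (Ioo 0 L))).toReal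
    (norm_integral_smul_source_le hg)

theorem kernelOp_apply (hg : MemLp (Function.uncurry g) 2 (volume.restrict (square L)))
    (k : L2 L) : kernelOp hg k = ∫ y in Ioo 0 L, k y • source L g y := rfl

theorem inner_source (hL : 0 ≤ L) {w : ℝ → ℂ} (hw : MemLp w 2 (volume.restrict (Ioo 0 L))) {y : ℝ}
    (hy : MemLp (fun σ => conj (g σ y)) 2 (volume.restrict (Ioo 0 L))) :
    inner ℂ (toL2 L w) (source L g y) = ∫ σ in (0 : ℝ)..L, conj (g σ y) * conj (w σ) := by
  rw [inner_toL2 hL hw, intervalIntegral_eq_Ioo hL, intervalIntegral_eq_Ioo hL]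
  refine integral_congr_ae ?_
  filter_upwards [toL2_coeFn hy] with σ hσ
  rw [source, hσ]

theorem inner_kernelOp_aux (hL : 0 ≤ L)
    (hg : MemLp (Function.uncurry g) 2 (volume.restrict (square L)))
    {w : ℝ → ℂ} (hw : MemLp w 2 (volume.restrict (Ioo 0 L))) (k : L2 L) :
    (fun y => inner ℂ (toL2 L w) (k y • source L g y)) =ᵐ[volume.restrict (Ioo 0 L)]
      fun y => k y * conj (∫ σ in (0 : ℝ)..L, g σ y * w σ) := by
  filter_upwards [source_ae_memLp hg] with y hy
  rw [inner_smul_right, inner_source hL hw hy, intervalIntegral_eq_Ioo hL,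
    intervalIntegral_eq_Ioo hL, ← integral_conj]
  simp

/-- Since `kernelOp` is a Bochner integral of the classes `conj g(·,y)`, the inner product passes
inside and produces the adjoint integral that appears in the definition of a weak solution. -/
theorem inner_kernelOp (hL : 0 ≤ L)
    (hg : MemLp (Function.uncurry g) 2 (volume.restrict (square L)))
    {w : ℝ → ℂ} (hw : MemLp w 2 (volume.restrict (Ioo 0 L))) (k : L2 L) :
    inner ℂ (toL2 L w) (kernelOp hg k)
      = ∫ y in (0 : ℝ)..L, k y * conj (∫ σ in (0 : ℝ)..L, g σ y * w σ) := by
  rw [kernelOp_apply, ← integral_inner (integrable_smul_source hg k),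
    integral_congr_ae (inner_kernelOp_aux hL hg hw k), ← intervalIntegral_eq_Ioo hL]

/-- The transport part `-φ_x - φ_y` of the adjoint of the kernel equation. -/
noncomputable def transport (φ : ℝ → ℝ → ℂ) (x y : ℝ) : ℂ :=
  -deriv (fun s => φ s y) x - deriv (fun z => φ x z) y

theorem hasDerivAt_fst {φ : ℝ → ℝ → ℂ} (hφ : ContDiff ℝ 1 (Function.uncurry φ)) (x y : ℝ) :
    HasDerivAt (fun s => φ s y) (fderiv ℝ (Function.uncurry φ) (x, y) (1, 0)) x := by
  have h1 := (hφ.differentiable one_ne_zero (x, y)).hasFDerivAt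
  have h2 : HasDerivAt (fun s : ℝ => (s, y)) ((1 : ℝ), (0 : ℝ)) x :=
    (hasDerivAt_id x).prodMk (hasDerivAt_const x y)
  exact h1.comp_hasDerivAt x h2

theorem hasDerivAt_snd {φ : ℝ → ℝ → ℂ} (hφ : ContDiff ℝ 1 (Function.uncurry φ)) (x y : ℝ) :
    HasDerivAt (fun z => φ x z) (fderiv ℝ (Function.uncurry φ) (x, y) (0, 1)) y := by
  have h1 := (hφ.differentiable one_ne_zero (x, y)).hasFDerivAt
  have h2 : HasDerivAt (fun s : ℝ => (x, s)) ((0 : ℝ), (1 : ℝ)) y :=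
    (hasDerivAt_const y x).prodMk (hasDerivAt_id y)
  exact h1.comp_hasDerivAt y h2

theorem transport_eq {φ : ℝ → ℝ → ℂ} (hφ : ContDiff ℝ 1 (Function.uncurry φ)) (x y : ℝ) :
    transport φ x y = -fderiv ℝ (Function.uncurry φ) (x, y) (1, 1) := by
  rw [transport, (hasDerivAt_fst hφ x y).deriv, (hasDerivAt_snd hφ x y).deriv,
    show ((1 : ℝ), (1 : ℝ)) = (1, 0) + (0, 1) by simp, map_add]
  ring

theorem continuous_transport {φ : ℝ → ℝ → ℂ} (hφ : ContDiff ℝ 1 (Function.uncurry φ)) :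
    Continuous (Function.uncurry (transport φ)) := by
  have : Function.uncurry (transport φ) = fun p => -fderiv ℝ (Function.uncurry φ) p (1, 1) := by
    ext ⟨x, y⟩; exact transport_eq hφ x y
  rw [this]
  exact ((hφ.continuous_fderiv one_ne_zero).clm_apply continuous_const).neg

theorem ContDiff.continuous_slice {φ : ℝ → ℝ → ℂ} (hφ : Continuous (Function.uncurry φ)) (x : ℝ) :
    Continuous (φ x) := hφ.comp (Continuous.prodMk_right x)

theorem adjoint_pairing (hL : 0 ≤ L)
    (hg : MemLp (Function.uncurry g) 2 (volume.restrict (square L)))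
    {φ : ℝ → ℝ → ℂ} (hφ : ContDiff ℝ 1 (Function.uncurry φ)) (k : L2 L) (x : ℝ) :
    ∫ y in (0 : ℝ)..L, k y * conj (-deriv (fun s => φ s y) x - deriv (fun z => φ x z) y
        + ∫ σ in (0 : ℝ)..L, g σ y * φ x σ)
      = inner ℂ (toL2 L (transport φ x)) k + inner ℂ (toL2 L (φ x)) (kernelOp hg k) := by
  have hD := Continuous.memLp_Ioo (L := L) (ContDiff.continuous_slice (continuous_transport hφ) x)
  have hP := Continuous.memLp_Ioo (L := L) (ContDiff.continuous_slice hφ.continuous x)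
  rw [inner_toL2 hL hD, inner_kernelOp hL hg hP, intervalIntegral_eq_Ioo hL,
    intervalIntegral_eq_Ioo hL, intervalIntegral_eq_Ioo hL, ← integral_add]
  · congr 1; ext y; rw [map_add, mul_add]; rfl
  · exact (Lp.memLp k).integrable_mul hD.star
  · exact ((integrable_smul_source hg k).const_inner _).congr (inner_kernelOp_aux hL hg hP k)

/-- The weak form of the kernel equation, written with inner products of `L²(0,L)`. -/
theorem isKernelSolution_iff (hL : 0 ≤ L)
    (hg : MemLp (Function.uncurry g) 2 (volume.restrict (square L))) {U : L2 L} {k : ℝ → L2 L} :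
    IsKernelSolution L g U k ↔ ContinuousOn k (Icc 0 L) ∧ k L = 0 ∧
      ∀ ξ ∈ Icc 0 L, ∀ φ : ℝ → ℝ → ℂ, ContDiff ℝ 1 (Function.uncurry φ) →
        (∀ x ∈ Icc ξ L, φ x 0 = 0) →
        (∫ x in ξ..L, (inner ℂ (toL2 L (transport φ x)) (k x)
            + inner ℂ (toL2 L (φ x)) (kernelOp hg (k x))))
          - inner ℂ (toL2 L (φ ξ)) (k ξ)
          + (∫ x in ξ..L, U x * conj (φ x L))
          - (∫ x in ξ..L, inner ℂ (toL2 L (φ x)) (source L g x)) = 0 := by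
  have key : ∀ ξ ∈ Icc 0 L, ∀ φ : ℝ → ℝ → ℂ, ContDiff ℝ 1 (Function.uncurry φ) →
      (∫ x in ξ..L, ∫ y in (0 : ℝ)..L, conj (g y x) * conj (φ x y))
        = ∫ x in ξ..L, inner ℂ (toL2 L (φ x)) (source L g x) := by
    intro ξ hξ φ hφ
    rw [intervalIntegral_eq_Ioo hξ.2, intervalIntegral_eq_Ioo hξ.2]
    refine integral_congr_ae ?_
    have := ae_restrict_of_ae_restrict_of_subset (Ioo_subset_Ioo_left hξ.1) (source_ae_memLp hg)
    filter_upwards [this] with x hx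
    exact (inner_source hL (Continuous.memLp_Ioo (ContDiff.continuous_slice hφ.continuous x)) hx).symm
  unfold IsKernelSolution
  refine and_congr_right fun _ => and_congr_right fun _ => forall₂_congr fun ξ hξ =>
    forall₃_congr fun φ hφ hφ0 => ?_
  rw [key ξ hξ φ hφ, inner_toL2 hL
    (Continuous.memLp_Ioo (ContDiff.continuous_slice hφ.continuous ξ)) (k ξ)]
  simp_rw [adjoint_pairing hL hg hφ]

end IntegroDiff

/-! ### Uniqueness, by test functions that are constant along the characteristics. -/

namespace IntegroDiff

open Filter Topology

variable {L : ℝ} {g : ℝ → ℝ → ℂ}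

/-- `χ` is a smooth function with compact support in the open set `Ω`. -/
structure IsTest {E : Type} [NormedAddCommGroup E] [NormedSpace ℝ E] (Ω : Set E) (χ : E → ℂ) :
    Prop where
  contDiff : ContDiff ℝ ∞ χ
  compact : HasCompactSupport χ
  subset : tsupport χ ⊆ Ω

theorem IsTest.eq_zero {E : Type} [NormedAddCommGroup E] [NormedSpace ℝ E] {Ω : Set E}
    {χ : E → ℂ} (h : IsTest Ω χ) {x : E} (hx : x ∉ Ω) : χ x = 0 :=
  image_eq_zero_of_notMem_tsupport fun h' => hx (h.subset h')

/-- The classes of the test functions on `(0,L)`. -/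
noncomputable def testSpace (L : ℝ) : Submodule ℂ (L2 L) where
  carrier := {w | ∃ χ : ℝ → ℂ, IsTest (Ioo 0 L) χ ∧ w =ᵐ[volume.restrict (Ioo 0 L)] χ}
  zero_mem' := ⟨fun _ => 0, ⟨contDiff_const, HasCompactSupport.zero, by simp [tsupport]⟩,
    Lp.coeFn_zero _ _ _⟩
  add_mem' := by
    rintro w w' ⟨χ, h, e⟩ ⟨χ', h', e'⟩
    refine ⟨χ + χ', ⟨h.1.add h'.1, h.2.add h'.2, (tsupport_add χ χ').trans
      (union_subset h.3 h'.3)⟩, ?_⟩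
    filter_upwards [Lp.coeFn_add w w', e, e'] with x h1 h2 h3
    rw [h1, Pi.add_apply, h2, h3, Pi.add_apply]
  smul_mem' := by
    rintro c w ⟨χ, h, e⟩
    refine ⟨fun x => c * χ x, ⟨contDiff_const.mul h.1, h.2.mul_left,
      (tsupport_mul_subset_right (f := fun _ => c)).trans h.3⟩, ?_⟩
    filter_upwards [Lp.coeFn_smul c w, e] with x h1 h2
    rw [h1, Pi.smul_apply, h2, smul_eq_mul]

theorem IsTest.memLp {χ : ℝ → ℂ} (h : IsTest (Ioo 0 L) χ) :
    MemLp χ 2 (volume.restrict (Ioo 0 L)) := Continuous.memLp_Ioo h.contDiff.continuous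

theorem IsTest.ofReal {E : Type} [NormedAddCommGroup E] [NormedSpace ℝ E] {Ω : Set E}
    {η : E → ℝ} (h1 : ContDiff ℝ ∞ η) (h2 : HasCompactSupport η)
    (h3 : tsupport η ⊆ Ω) : IsTest Ω fun x => (η x : ℂ) := by
  have hs : tsupport (fun x => (η x : ℂ)) ⊆ tsupport η := by
    refine closure_mono fun x hx hx' => hx ?_
    simp [hx']
  exact ⟨Complex.ofRealCLM.contDiff.comp h1, h2.mono' ((subset_tsupport _).trans hs), hs.trans h3⟩

/-- A class orthogonal to all test functions vanishes, by the fundamental lemma of the calculus of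
variations. -/
theorem dense_testSpace (hL : 0 ≤ L) : Dense (testSpace L : Set (L2 L)) := by
  rw [Submodule.dense_iff_topologicalClosure_eq_top, Submodule.topologicalClosure_eq_top_iff,
    Submodule.eq_bot_iff]
  intro v hv
  have hint : ∀ η : ℝ → ℝ, ContDiff ℝ ∞ η → HasCompactSupport η → tsupport η ⊆ Ioo 0 L →
      ∫ x in Ioo 0 L, η x • v x = 0 := by
    intro η h1 h2 h3
    have ht := IsTest.ofReal h1 h2 h3
    have := (Submodule.mem_orthogonal _ v).1 hv (toL2 L fun x => (η x : ℂ)) ⟨_, ht, toL2_coeFn ht.memLp⟩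
    rw [inner_toL2 hL ht.memLp, intervalIntegral_eq_Ioo hL] at this
    rw [← this]
    congr 1; ext x
    simp [mul_comm]
  have hloc : LocallyIntegrableOn (v : ℝ → ℂ) (Ioo 0 L) := by
    have : IntegrableOn (v : ℝ → ℂ) (Ioo 0 L) := (Lp.memLp v).integrable one_le_two
    exact this.locallyIntegrableOn
  have h0 := isOpen_Ioo.ae_eq_zero_of_integral_contDiff_smul_eq_zero hloc fun η h1 h2 h3 => by
    rw [← hint η h1 h2 h3]
    refine (setIntegral_eq_integral_of_forall_compl_eq_zero fun x hx => ?_).symm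
    rw [image_eq_zero_of_notMem_tsupport fun h => hx (h3 h), zero_smul]
  rw [Lp.eq_zero_iff_ae_eq_zero, EventuallyEq, ae_restrict_iff' measurableSet_Ioo]
  exact h0

theorem norm_le_of_forall_test (hL : 0 ≤ L) {v : L2 L} {M : ℝ} (hM : 0 ≤ M)
    (h : ∀ χ : ℝ → ℂ, IsTest (Ioo 0 L) χ → ‖inner ℂ (toL2 L χ) v‖ ≤ M * ‖toL2 L χ‖) :
    ‖v‖ ≤ M := by
  have hcl : IsClosed {w : L2 L | ‖inner ℂ w v‖ ≤ M * ‖w‖} :=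
    isClosed_le (by fun_prop) (by fun_prop)
  have hall : ∀ w : L2 L, ‖inner ℂ w v‖ ≤ M * ‖w‖ := fun w => by
    refine hcl.closure_subset_iff.2 ?_ (dense_testSpace hL w)
    rintro w ⟨χ, hχ, e⟩
    have : w = toL2 L χ := Lp.ext (e.trans (toL2_coeFn hχ.memLp).symm)
    rw [this]; exact h χ hχ
  have h1 := hall v
  rw [inner_self_eq_norm_sq_to_K, norm_pow, RCLike.norm_ofReal, abs_norm, sq] at h1
  rcases (norm_nonneg v).eq_or_lt with hv | hv
  · rw [← hv]; exact hM
  · exact le_of_mul_le_mul_right h1 hv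

theorem norm_toL2_translate_le {χ : ℝ → ℂ} (h : IsTest (Ioo 0 L) χ) (s : ℝ) :
    ‖toL2 L (fun y => χ (y - s))‖ ≤ ‖toL2 L χ‖ := by
  have hc : Continuous fun y => χ (y - s) := h.contDiff.continuous.comp (by fun_prop)
  rw [← sq_le_sq₀ (norm_nonneg _) (norm_nonneg _)]
  rw [norm_toL2_sq (Continuous.memLp_Ioo hc), norm_toL2_sq h.memLp]
  have hi : Integrable fun y => ‖χ y‖ ^ 2 :=
    (h.contDiff.continuous.norm.pow 2).integrable_of_hasCompactSupport
      (HasCompactSupport.intro h.compact fun x hx => by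
        simp [image_eq_zero_of_notMem_tsupport hx])
  have h1 : ∫ y in Ioo 0 L, ‖χ (y - s)‖ ^ 2 ≤ ∫ y, ‖χ (y - s)‖ ^ 2 :=
    setIntegral_le_integral (hi.comp_sub_right s) (Eventually.of_forall fun y => by positivity)
  refine h1.trans ?_
  rw [integral_sub_right_eq_self (fun y => ‖χ y‖ ^ 2) s]
  refine (setIntegral_eq_integral_of_forall_compl_eq_zero fun x hx => ?_).ge
  rw [h.eq_zero hx]; simp

theorem transport_translate {χ : ℝ → ℂ} (h : ContDiff ℝ ∞ χ) (ξ : ℝ) :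
    transport (fun x y => χ (y - (x - ξ))) = 0 := by
  ext x y
  have hd : ∀ z, HasDerivAt χ (deriv χ z) z := fun z =>
    (h.differentiable (by simp) z).hasDerivAt
  have h1 : HasDerivAt (fun s => χ (y - (s - ξ))) (-deriv χ (y - (x - ξ))) x := by
    have h2 : HasDerivAt (fun s : ℝ => y - (s - ξ)) (-1) x :=
      ((hasDerivAt_id x).sub_const ξ).const_sub y
    have h3 := (hd (y - (x - ξ))).scomp x h2
    rw [neg_one_smul] at h3
    exact h3
  have h3 : HasDerivAt (fun z => χ (z - (x - ξ))) (deriv χ (y - (x - ξ))) y :=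
    (hd (y - (x - ξ))).comp_sub_const y (x - ξ)
  rw [transport, h1.deriv, h3.deriv]
  simp

/-- The test function `χ (y - (x - ξ))` equals `χ` at `x = ξ`, is constant along the
characteristics, and vanishes at `y = 0` for `x ≥ ξ` because `χ` lives in `(0,L)`. The weak form
then becomes an explicit expression for `k ξ` tested against `χ`. -/
theorem IsKernelSolution.inner_eq (hL : 0 ≤ L)
    (hg : MemLp (Function.uncurry g) 2 (volume.restrict (square L))) {U : L2 L} {k : ℝ → L2 L}
    (hk : IsKernelSolution L g U k) {ξ : ℝ} (hξ : ξ ∈ Icc 0 L) {χ : ℝ → ℂ}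
    (h : IsTest (Ioo 0 L) χ) :
    inner ℂ (toL2 L χ) (k ξ)
      = (∫ x in ξ..L, inner ℂ (toL2 L fun y => χ (y - (x - ξ))) (kernelOp hg (k x)))
        + (∫ x in ξ..L, U x * conj (χ (L - (x - ξ))))
        - ∫ x in ξ..L, inner ℂ (toL2 L fun y => χ (y - (x - ξ))) (source L g x) := by
  have hφ : ContDiff ℝ 1 (Function.uncurry fun x y : ℝ => χ (y - (x - ξ))) :=
    (h.contDiff.of_le (by simp)).comp (by fun_prop)
  have := ((isKernelSolution_iff hL hg).1 hk).2.2 ξ hξ _ hφ fun x hx =>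
    h.eq_zero fun h' => by linarith [h'.1, hx.1]
  rw [transport_translate h.contDiff] at this
  have h0 : toL2 L 0 = 0 := by
    rw [Lp.eq_zero_iff_ae_eq_zero]; exact toL2_coeFn MemLp.zero
  simp only [Pi.zero_apply, h0, inner_zero_left, zero_add, sub_self, sub_zero] at this
  linear_combination -this

/-- A nonnegative continuous function which is bounded by a multiple of its integral over `(ξ,L)`
vanishes. -/
theorem eq_zero_of_le_integral {u : ℝ → ℝ} (hu : Continuous u) (h0 : ∀ x, 0 ≤ u x) {C : ℝ}
    (h : ∀ ξ ∈ Icc 0 L, u ξ ≤ C * ∫ x in ξ..L, u x) : ∀ ξ ∈ Ioc 0 L, u ξ = 0 := by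
  -- The reflection `x = L - t` turns the integral over `(ξ,L)` into one that starts at `0`, so that
  -- Gronwall's inequality runs forwards from `f 0 = 0`.
  let f : ℝ → ℝ := fun t => ∫ s in (0 : ℝ)..t, u (L - s)
  have hc : Continuous fun s => u (L - s) := by fun_prop
  have hf : ∀ t, HasDerivAt f (u (L - t)) t := fun t =>
    intervalIntegral.integral_hasDerivAt_right (hc.intervalIntegrable _ _)
      (hc.stronglyMeasurableAtFilter _ _) hc.continuousAt
  have hfu : ∀ t ∈ Icc 0 L, u (L - t) ≤ C * f t := fun t ht => by
    refine (h (L - t) ⟨by linarith [ht.2], by linarith [ht.1]⟩).trans_eq ?_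
    simp only [f]
    rw [intervalIntegral.integral_comp_sub_left (fun x => u x) L, sub_zero]
  have hz := eq_zero_of_abs_deriv_le_mul_abs_self_of_eq_zero_right (f := f) (a := 0) (b := L)
    (K := C) (fun t _ => (hf t).continuousAt.continuousWithinAt)
    (fun t _ => (hf t).hasDerivWithinAt) (by simp [f]) (fun t ht => by
      have hft : 0 ≤ f t := intervalIntegral.integral_nonneg ht.1 fun x _ => h0 _
      rw [Real.norm_of_nonneg (h0 _), Real.norm_of_nonneg hft]
      exact hfu t ⟨ht.1, ht.2.le⟩)
  intro ξ hξ
  have h1 := hfu (L - ξ) ⟨by linarith [hξ.2], by linarith [hξ.1]⟩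
  rw [hz (L - ξ) ⟨by linarith [hξ.2], by linarith [hξ.1]⟩, mul_zero, sub_sub_cancel] at h1
  exact le_antisymm h1 (h0 ξ)

/-- Uniqueness of the solution of the kernel equation. -/
theorem IsKernelSolution.eqOn (hL : 0 < L)
    (hg : MemLp (Function.uncurry g) 2 (volume.restrict (square L))) {U : L2 L} {k k' : ℝ → L2 L}
    (hk : IsKernelSolution L g U k) (hk' : IsKernelSolution L g U k') : EqOn k' k (Icc 0 L) := by
  have hcd : ContinuousOn (fun x => k' x - k x) (Icc 0 L) := hk'.1.sub hk.1
  let u : ℝ → ℝ := IccExtend hL.le fun x : Icc (0 : ℝ) L => ‖k' x - k x‖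
  have huc : Continuous u := Continuous.Icc_extend' hcd.norm.domRestrict
  have hux : ∀ x ∈ Icc 0 L, u x = ‖k' x - k x‖ := fun x hx => IccExtend_of_mem hL.le _ hx
  have hu0 : ∀ x, 0 ≤ u x := fun x => norm_nonneg _
  have hest : ∀ ξ ∈ Icc 0 L, u ξ ≤ ‖kernelOp hg‖ * ∫ x in ξ..L, u x := by
    intro ξ hξ
    rw [hux ξ hξ]
    have hI0 : 0 ≤ ∫ x in ξ..L, u x := intervalIntegral.integral_nonneg hξ.2 fun x _ => hu0 x
    refine norm_le_of_forall_test hL.le (by positivity) fun χ hχ => ?_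
    have hcφ : Continuous fun x => toL2 L fun y => χ (y - (x - ξ)) :=
      continuous_toL2 (w := fun x y => χ (y - (x - ξ))) (hχ.contDiff.continuous.comp (by fun_prop))
    have hsub : Icc ξ L ⊆ Icc 0 L := Icc_subset_Icc_left hξ.1
    have hint : ∀ k : ℝ → L2 L, ContinuousOn k (Icc 0 L) → IntervalIntegrable
        (fun x => inner ℂ (toL2 L fun y => χ (y - (x - ξ))) (kernelOp hg (k x))) volume ξ L :=
      fun k hk => ContinuousOn.intervalIntegrable_of_Icc hξ.2
        (hcφ.continuousOn.inner ((kernelOp hg).continuous.comp_continuousOn (hk.mono hsub)))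
    -- The boundary and source terms are the same for both solutions and cancel. Only the bounded
    -- operator `kernelOp hg` remains.
    have heq : inner ℂ (toL2 L χ) (k' ξ - k ξ)
        = ∫ x in ξ..L, inner ℂ (toL2 L fun y => χ (y - (x - ξ))) (kernelOp hg (k' x - k x)) := by
      rw [inner_sub_right, hk.inner_eq hL.le hg hξ hχ, hk'.inner_eq hL.le hg hξ hχ]
      simp_rw [map_sub, inner_sub_right]
      rw [intervalIntegral.integral_sub (hint k' hk'.1) (hint k hk.1)]
      ring
    rw [heq]
    have hb : ∀ x ∈ Ioc ξ L,
        ‖inner ℂ (toL2 L fun y => χ (y - (x - ξ))) (kernelOp hg (k' x - k x))‖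
          ≤ ‖toL2 L χ‖ * ‖kernelOp hg‖ * u x := by
      intro x hx
      rw [hux x (hsub (Ioc_subset_Icc_self hx))]
      calc _ ≤ _ := norm_inner_le_norm _ _
        _ ≤ ‖toL2 L χ‖ * (‖kernelOp hg‖ * ‖k' x - k x‖) := by
          gcongr
          · exact norm_toL2_translate_le hχ _
          · exact (kernelOp hg).le_opNorm _
        _ = _ := by ring
    refine (intervalIntegral.norm_integral_le_of_norm_le hξ.2
      (Eventually.of_forall hb) ((huc.intervalIntegrable ξ L).const_mul _)).trans_eq ?_
    rw [intervalIntegral.integral_const_mul]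
    ring
  have hz := eq_zero_of_le_integral huc hu0 hest
  -- The endpoint `0`, not covered by `hz`, is reached by continuity.
  have hz' : ∀ ξ ∈ Icc 0 L, u ξ = 0 := fun ξ hξ => by
    have hcl : closure (Ioc 0 L) = Icc 0 L := closure_Ioc hL.ne
    have : closure (Ioc 0 L) ⊆ {x | u x = 0} :=
      closure_minimal hz (isClosed_eq huc continuous_const)
    exact this (hcl ▸ hξ)
  intro ξ hξ
  have := hz' ξ hξ
  rw [hux ξ hξ, norm_eq_zero, sub_eq_zero] at this
  exact this

end IntegroDiff

/-! ### Volterra equations and the translation semigroup. -/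

namespace IntegroDiff

open Filter Topology

/-- Solvability of a linear Volterra equation with a strongly continuous kernel. -/
theorem exists_volterra_solution {H : Type} [NormedAddCommGroup H] [NormedSpace ℝ H]
    [CompleteSpace H] {T : ℝ} (hT : 0 ≤ T) {P : ℝ → H → H} (hP : Continuous (Function.uncurry P))
    {C : ℝ} (hC : 0 ≤ C) (hPC : ∀ t u v, ‖P t u - P t v‖ ≤ C * ‖u - v‖)
    {a : ℝ → H} (ha : Continuous a) :
    ∃ K : ℝ → H, Continuous K ∧ ∀ t ∈ Icc 0 T, K t = a t + ∫ r in (0 : ℝ)..t, P (t - r) (K r) := by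
  -- The unknown of the fixed point problem is `w t = exp (-μ t) • K t`. With this weight the
  -- integral operator is a contraction of constant `C / μ < 1` on all of `[0,T]`, so no subdivision
  -- of the interval is needed.
  set μ := C + 1 with hμ
  have hμ0 : 0 < μ := by positivity
  let e : C(Icc (0 : ℝ) T, H) → ℝ → H := fun w r => Real.exp (μ * r) • w (projIcc 0 T hT r)
  have he : ∀ w, Continuous (e w) := fun w =>
    (by fun_prop : Continuous fun r => Real.exp (μ * r)).smul (w.continuous.comp continuous_projIcc)
  let V : (ℝ → H) → ℝ → H := fun K t => a t + ∫ r in (0 : ℝ)..t, P (t - r) (K r)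
  have hint : ∀ w t, Continuous fun r => P (t - r) (e w r) := fun w t =>
    hP.comp ((by fun_prop : Continuous fun r => t - r).prodMk (he w))
  have hV : ∀ w, Continuous (V (e w)) := fun w => by
    refine ha.add ?_
    refine intervalIntegral.continuous_parametric_intervalIntegral_of_continuous
      (f := fun t r => P (t - r) (e w r)) ?_ continuous_id
    exact hP.comp ((by fun_prop : Continuous fun p : ℝ × ℝ => p.1 - p.2).prodMk
      ((he w).comp continuous_snd))
  let Φ : C(Icc (0 : ℝ) T, H) → C(Icc (0 : ℝ) T, H) := fun w =>
    ⟨fun t => Real.exp (-(μ * t)) • V (e w) t, by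
      have := hV w
      fun_prop⟩
  have hlip : ∀ w w', dist (Φ w) (Φ w') ≤ C / μ * dist w w' := by
    intro w w'
    refine (ContinuousMap.dist_le (by positivity)).2 fun t => ?_
    have ht0 : (0 : ℝ) ≤ t := t.2.1
    rw [dist_eq_norm]
    have h1 : Φ w t - Φ w' t = Real.exp (-(μ * t)) •
        ∫ r in (0 : ℝ)..t, (P (t - r) (e w r) - P (t - r) (e w' r)) := by
      rw [intervalIntegral.integral_sub ((hint w t).intervalIntegrable _ _)
        ((hint w' t).intervalIntegrable _ _)]
      change Real.exp (-(μ * t)) • V (e w) t - Real.exp (-(μ * t)) • V (e w') t = _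
      rw [← smul_sub, add_sub_add_left_eq_sub]
    have h2 : ‖∫ r in (0 : ℝ)..t, (P (t - r) (e w r) - P (t - r) (e w' r))‖
        ≤ ∫ r in (0 : ℝ)..t, C * dist w w' * Real.exp (μ * r) := by
      refine intervalIntegral.norm_integral_le_of_norm_le ht0 (Eventually.of_forall fun r _ => ?_)
        ((by fun_prop : Continuous fun r => C * dist w w' * Real.exp (μ * r)).intervalIntegrable _ _)
      refine (hPC _ _ _).trans ?_
      rw [mul_assoc]
      gcongr
      rw [← smul_sub, norm_smul, Real.norm_of_nonneg (Real.exp_pos _).le, mul_comm, ← dist_eq_norm]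
      gcongr
      exact ContinuousMap.dist_apply_le_dist _
    have h3 : ∫ r in (0 : ℝ)..t, C * dist w w' * Real.exp (μ * r)
        = C * dist w w' * ((Real.exp (μ * t) - 1) / μ) := by
      rw [intervalIntegral.integral_const_mul]
      congr 1
      rw [intervalIntegral.integral_comp_mul_left (fun x => Real.exp x) hμ0.ne', integral_exp]
      simp [div_eq_inv_mul]
    rw [h1, norm_smul, Real.norm_of_nonneg (Real.exp_pos _).le]
    calc _ ≤ Real.exp (-(μ * t)) * (C * dist w w' * ((Real.exp (μ * t) - 1) / μ)) := by
          gcongr; exact h2.trans_eq h3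
      _ = C / μ * dist w w' * (Real.exp (-(μ * t)) * Real.exp (μ * t) - Real.exp (-(μ * t))) := by
          ring
      _ ≤ C / μ * dist w w' * 1 := by
          gcongr
          rw [← Real.exp_add, neg_add_cancel, Real.exp_zero]
          linarith [Real.exp_pos (-(μ * t))]
      _ = _ := mul_one _
  have hK : C / μ < 1 := by rw [div_lt_one hμ0]; linarith
  have hcontr : ContractingWith ⟨C / μ, by positivity⟩ Φ :=
    ⟨by exact_mod_cast hK, LipschitzWith.of_dist_le_mul hlip⟩
  let w := hcontr.fixedPoint
  have hw : Φ w = w := hcontr.fixedPoint_isFixedPt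
  refine ⟨e w, he w, fun t ht => ?_⟩
  have h1 : Real.exp (-(μ * t)) • V (e w) t = w ⟨t, ht⟩ := by
    conv_rhs => rw [← hw]
    rfl
  change Real.exp (μ * t) • w (projIcc 0 T hT t) = V (e w) t
  rw [projIcc_of_mem hT ht, ← h1, smul_smul, ← Real.exp_add, add_neg_cancel, Real.exp_zero, one_smul]

variable {L : ℝ} {g : ℝ → ℝ → ℂ}

/-- The restriction of `L²(ℝ)` to `L²(0,L)`. -/
noncomputable def restrictL2 (L : ℝ) : Lp ℂ 2 (volume : Measure ℝ) →L[ℂ] L2 L :=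
  LpToLpRestrictCLM ℝ ℂ ℂ volume 2 (Ioo 0 L)

/-- The extension by zero from `L²(0,L)` to `L²(ℝ)`. -/
noncomputable def extendL2 (L : ℝ) : L2 L →L[ℂ] Lp ℂ 2 (volume : Measure ℝ) :=
  ContinuousLinearMap.adjoint (restrictL2 L)

/-- Defining the extension as the adjoint of the restriction gives linearity and the norm bound at
once; testing against an arbitrary `u` identifies it with the extension by zero. -/
theorem extendL2_coeFn (v : L2 L) : extendL2 L v =ᵐ[volume] (Ioo 0 L).indicator v := by
  have hm : MemLp ((Ioo 0 L).indicator v) 2 volume :=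
    (memLp_indicator_iff_restrict measurableSet_Ioo).2 (Lp.memLp v)
  have : extendL2 L v = hm.toLp _ := by
    refine ext_inner_right ℂ fun u => ?_
    rw [extendL2, ContinuousLinearMap.adjoint_inner_left, L2.inner_def, L2.inner_def]
    have h1 : ∫ y, inner ℂ (hm.toLp _ y) (u y) = ∫ y in Ioo 0 L, inner ℂ (v y) (u y) := by
      rw [← integral_indicator measurableSet_Ioo]
      refine integral_congr_ae ?_
      filter_upwards [hm.coeFn_toLp] with y hy
      rw [hy]
      by_cases h : y ∈ Ioo 0 L
      · rw [indicator_of_mem h, indicator_of_mem h]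
      · rw [indicator_of_notMem h, indicator_of_notMem h, inner_zero_left]
    rw [h1]
    refine integral_congr_ae ?_
    filter_upwards [LpToLpRestrictCLM_coeFn (p := 2) (μ := volume) ℂ (Ioo 0 L) u] with y hy
    rw [restrictL2, hy]
  rw [this]
  exact hm.coeFn_toLp

/-- The translation semigroup of `L²(0,L)`, `(shift t v)(y) = v(y+t)`, with zero inflow. -/
noncomputable def shift (L t : ℝ) (v : L2 L) : L2 L :=
  restrictL2 L (DomAddAct.mk t +ᵥ extendL2 L v)

/-- Translations act jointly continuously on `L²(ℝ)`; extension and restriction are bounded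
operators. -/
theorem continuous_shift : Continuous (Function.uncurry (shift L)) := by
  have : Fact ((2 : ENNReal) ≠ ⊤) := ⟨by norm_num⟩
  refine (restrictL2 L).continuous.comp ?_
  have h1 : Continuous fun p : ℝ × L2 L => (DomAddAct.mk p.1 : ℝᵈᵃᵃ) :=
    DomAddAct.continuous_mk.comp continuous_fst
  exact h1.vadd ((extendL2 L).continuous.comp continuous_snd)

theorem shift_sub (t : ℝ) (u v : L2 L) : shift L t (u - v) = shift L t u - shift L t v := by
  rw [shift, shift, shift, (extendL2 L).map_sub, ← (restrictL2 L).map_sub]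
  congr 1
  exact DomAddAct.vadd_Lp_sub (DomAddAct.mk t) (extendL2 L u) (extendL2 L v)

theorem norm_restrictL2_le (u : Lp ℂ 2 (volume : Measure ℝ)) : ‖restrictL2 L u‖ ≤ ‖u‖ := by
  rw [Lp.norm_def, Lp.norm_def]
  refine ENNReal.toReal_mono (Lp.memLp u).2.ne ?_
  rw [restrictL2, eLpNorm_congr_ae (LpToLpRestrictCLM_coeFn (p := 2) (μ := volume) ℂ (Ioo 0 L) u)]
  exact eLpNorm_restrict_le _ _ _ _

theorem norm_shift_le (t : ℝ) (v : L2 L) : ‖shift L t v‖ ≤ ‖v‖ := by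
  refine (norm_restrictL2_le _).trans ?_
  rw [DomAddAct.norm_vadd_Lp]
  refine ((extendL2 L).le_opNorm v).trans ?_
  rw [extendL2, LinearIsometryEquiv.norm_map]
  refine mul_le_of_le_one_left (norm_nonneg _) ?_
  exact ContinuousLinearMap.opNorm_le_bound _ zero_le_one fun u => by
    rw [one_mul]; exact norm_restrictL2_le u

/-- The substitution `z = y + t` moves the translation to the test function. The indicator records
that nothing flows in. -/
theorem inner_shift (hL : 0 ≤ L) {w : ℝ → ℂ} (hw : MemLp w 2 (volume.restrict (Ioo 0 L)))
    {t : ℝ} (ht : 0 ≤ t) (v : L2 L) :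
    inner ℂ (toL2 L w) (shift L t v)
      = ∫ z in Ioo 0 L, v z * conj ((Ioi t).indicator (fun z => w (z - t)) z) := by
  rw [inner_toL2 hL hw, intervalIntegral_eq_Ioo hL]
  have h1 : (DomAddAct.mk t +ᵥ extendL2 L v : Lp ℂ 2 (volume : Measure ℝ))
      =ᵐ[volume] fun y => (Ioo 0 L).indicator v (t + y) := by
    refine (DomAddAct.vadd_Lp_ae_eq (DomAddAct.mk t) (extendL2 L v)).trans ?_
    exact (quasiMeasurePreserving_add_left volume t).ae_eq (extendL2_coeFn v)
  have h2 : ∀ᵐ y ∂volume.restrict (Ioo 0 L),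
      shift L t v y * conj (w y) = (Ioo 0 L).indicator v (t + y) * conj (w y) := by
    filter_upwards [LpToLpRestrictCLM_coeFn (p := 2) (μ := volume) ℂ (Ioo 0 L)
      (DomAddAct.mk t +ᵥ extendL2 L v), ae_restrict_of_ae h1] with y hy hy1
    rw [shift, restrictL2, hy, hy1]
  rw [integral_congr_ae h2, ← integral_indicator measurableSet_Ioo,
    ← integral_indicator measurableSet_Ioo]
  rw [← integral_sub_right_eq_self _ t]
  congr 1
  ext z
  simp only [indicator, mem_Ioo, mem_Ioi]
  grind

end IntegroDiff

/-! ### Duhamel's formula along the characteristics. -/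

namespace IntegroDiff

open Filter Topology TopologicalSpace

variable {L : ℝ} {g : ℝ → ℝ → ℂ}

theorem hasDerivAt_characteristic {φ : ℝ → ℝ → ℂ} (hφ : ContDiff ℝ 1 (Function.uncurry φ))
    (c x : ℝ) : HasDerivAt (fun x => φ x (x - c)) (-transport φ x (x - c)) x := by
  have h1 := (hφ.differentiable one_ne_zero (x, x - c)).hasFDerivAt
  have h2 : HasDerivAt (fun s : ℝ => (s, s - c)) ((1 : ℝ), (1 : ℝ)) x :=
    (hasDerivAt_id x).prodMk ((hasDerivAt_id x).sub_const c)
  rw [transport_eq hφ, neg_neg]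
  exact h1.comp_hasDerivAt x h2

/-- Apart from the sign, `transport φ` is the derivative of `φ` along the characteristic through
`(s,z)`. Followed backwards, this characteristic stops at `x = max ξ (s - z)`: either on `x = ξ`, or
on `y = 0` where `φ` vanishes. The indicator on the right distinguishes the two cases. -/
theorem integral_transport_characteristic {φ : ℝ → ℝ → ℂ} (hφ : ContDiff ℝ 1 (Function.uncurry φ))
    {ξ s : ℝ} (hs : ξ ≤ s) (h0 : ∀ x ∈ Icc ξ s, φ x 0 = 0) {z : ℝ} (hz : 0 < z) :
    ∫ x in Ioo ξ s, (Ioi (s - x)).indicator (fun z => transport φ x (z - (s - x))) z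
      = (Ioi (s - ξ)).indicator (fun z => φ ξ (z - (s - ξ))) z - φ s z := by
  set β := max ξ (s - z) with hβ
  have hβs : β ≤ s := max_le hs (by linarith)
  have h1 : ∀ x, (Ioi (s - x)).indicator (fun z => transport φ x (z - (s - x))) z
      = (Ioi (s - z)).indicator (fun x => transport φ x (x - (s - z))) x := fun x => by
    have : z - (s - x) = x - (s - z) := by ring
    simp only [indicator, mem_Ioi, this]
    congr 1
    exact propext ⟨fun h => by linarith, fun h => by linarith⟩
  have h2 : Ioo ξ s ∩ Ioi (s - z) = Ioo β s := by
    ext x; simp only [mem_inter_iff, mem_Ioo, mem_Ioi, hβ, max_lt_iff]; tauto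
  simp_rw [h1]
  rw [setIntegral_indicator measurableSet_Ioi, h2, ← intervalIntegral_eq_Ioo hβs]
  have hc : Continuous fun x => transport φ x (x - (s - z)) :=
    (continuous_transport hφ).comp (by fun_prop : Continuous fun x : ℝ => (x, x - (s - z)))
  have h3 := intervalIntegral.integral_eq_sub_of_hasDerivAt (a := β) (b := s)
    (fun x _ => (hasDerivAt_characteristic hφ (s - z) x).neg) (by simpa using hc.intervalIntegrable _ _)
  simp only [neg_neg] at h3
  rw [h3]
  have h4 : φ β (β - (s - z)) = (Ioi (s - ξ)).indicator (fun z => φ ξ (z - (s - ξ))) z := by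
    by_cases h : s - ξ < z
    · have : β = ξ := max_eq_left (by linarith)
      rw [this, indicator_of_mem (mem_Ioi.2 h)]
      congr 1; ring
    · have hb : β = s - z := max_eq_right (by linarith)
      rw [indicator_of_notMem (by simpa using h), hb, sub_self]
      exact h0 _ ⟨by linarith, by linarith⟩
  simp only [Pi.neg_apply]
  rw [← h4]
  have : s - (s - z) = z := by ring
  rw [this]
  ring

/-- In weak form, `x ↦ shift L (s - x) v` solves the homogeneous transport equation backwards from
the value `v` at `x = s`. After Fubini this is the computation along each single characteristic. -/
theorem integral_inner_shift (hL : 0 ≤ L) {φ : ℝ → ℝ → ℂ}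
    (hφ : ContDiff ℝ 1 (Function.uncurry φ)) {ξ s : ℝ} (hs : ξ ≤ s)
    (h0 : ∀ x ∈ Icc ξ s, φ x 0 = 0) (v : L2 L) :
    ∫ x in Ioo ξ s, inner ℂ (toL2 L (transport φ x)) (shift L (s - x) v)
      = inner ℂ (toL2 L (φ ξ)) (shift L (s - ξ) v) - inner ℂ (toL2 L (φ s)) v := by
  have hm : ∀ x, MemLp (transport φ x) 2 (volume.restrict (Ioo 0 L)) := fun x =>
    Continuous.memLp_Ioo (ContDiff.continuous_slice (continuous_transport hφ) x)
  have hm' : ∀ x, MemLp (φ x) 2 (volume.restrict (Ioo 0 L)) := fun x =>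
    Continuous.memLp_Ioo (ContDiff.continuous_slice hφ.continuous x)
  let F : ℝ → ℝ → ℂ := fun x z => (Ioi (s - x)).indicator (fun z => transport φ x (z - (s - x))) z
  have h1 : ∫ x in Ioo ξ s, inner ℂ (toL2 L (transport φ x)) (shift L (s - x) v)
      = ∫ x in Ioo ξ s, ∫ z in Ioo 0 L, v z * conj (F x z) :=
    setIntegral_congr_fun measurableSet_Ioo fun x hx =>
      inner_shift hL (hm x) (by linarith [hx.2]) v
  have hG : Continuous fun p : ℝ × ℝ => transport φ p.1 (p.2 - (s - p.1)) :=
    (continuous_transport hφ).comp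
      (by fun_prop : Continuous fun p : ℝ × ℝ => (p.1, p.2 - (s - p.1)))
  have hFeq : Function.uncurry F = {p : ℝ × ℝ | s - p.1 < p.2}.indicator
      fun p : ℝ × ℝ => transport φ p.1 (p.2 - (s - p.1)) := by
    ext ⟨x, z⟩; simp [F, indicator]
  have hFm : Measurable (Function.uncurry F) := by
    rw [hFeq]
    exact hG.measurable.indicator (measurableSet_lt (by fun_prop) (by fun_prop))
  obtain ⟨B, hB⟩ := (isCompact_Icc.prod isCompact_Icc :
    IsCompact (Icc ξ s ×ˢ Icc 0 L)).exists_bound_of_continuousOn hG.continuousOn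
  have hvi : Integrable (v : ℝ → ℂ) (volume.restrict (Ioo 0 L)) := (Lp.memLp v).integrable one_le_two
  have hint : Integrable (Function.uncurry fun x z => v z * conj (F x z))
      ((volume.restrict (Ioo ξ s)).prod (volume.restrict (Ioo 0 L))) := by
    have hFc : AEStronglyMeasurable (fun p : ℝ × ℝ => conj (F p.1 p.2))
        ((volume.restrict (Ioo ξ s)).prod (volume.restrict (Ioo 0 L))) :=
      (RCLike.continuous_conj.measurable.comp hFm).aestronglyMeasurable
    refine (hvi.comp_snd _).mul_bdd (c := max B 0) hFc ?_
    rw [Measure.prod_restrict, ae_restrict_iff' (measurableSet_Ioo.prod measurableSet_Ioo)]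
    refine Eventually.of_forall fun p hp => ?_
    rw [RCLike.norm_conj]
    change ‖Function.uncurry F p‖ ≤ _
    rw [hFeq]
    refine (norm_indicator_le_norm_self _ _).trans ((hB p ?_).trans (le_max_left _ _))
    exact ⟨Ioo_subset_Icc_self hp.1, Ioo_subset_Icc_self hp.2⟩
  rw [h1, integral_integral_swap hint, inner_shift hL (hm' ξ) (by linarith) v,
    inner_toL2 hL (hm' s), intervalIntegral_eq_Ioo hL, ← integral_sub]
  · refine setIntegral_congr_fun measurableSet_Ioo fun z hz => ?_
    simp only [F]
    rw [integral_const_mul, integral_conj, integral_transport_characteristic hφ hs h0 hz.1,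
      map_sub, mul_sub]
  · have hφc : Continuous fun z => φ ξ (z - (s - ξ)) :=
      (ContDiff.continuous_slice hφ.continuous ξ).comp (by fun_prop)
    have : MemLp ((Ioi (s - ξ)).indicator fun z => φ ξ (z - (s - ξ))) 2
        (volume.restrict (Ioo 0 L)) := (Continuous.memLp_Ioo hφc).indicator measurableSet_Ioi
    exact (Lp.memLp v).integrable_mul this.star
  · exact (Lp.memLp v).integrable_mul (hm' s).star

/-- The solution `-∫_x^L f(s, · + s - x) ds` of `k_x + k_y = f` with zero data. -/
noncomputable def duhamel (L : ℝ) (f : ℝ → L2 L) (x : ℝ) : L2 L :=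
  -∫ s in Ioo x L, shift L (s - x) (f s)

theorem aestronglyMeasurable_shift {X : Type} [TopologicalSpace X] [MeasurableSpace X]
    [OpensMeasurableSpace X] [PseudoMetrizableSpace X] [SecondCountableTopology X] {μ : Measure X}
    {f : X → L2 L} {t : X → ℝ} (ht : Continuous t) (hf : AEStronglyMeasurable f μ) :
    AEStronglyMeasurable (fun p => shift L (t p) (f p)) μ := by
  have h1 : AEStronglyMeasurable (fun p => (t p, f p)) μ := ht.aestronglyMeasurable.prodMk hf
  have h2 := (continuous_shift (L := L)).comp_aestronglyMeasurable h1
  exact h2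

/-- Dominated convergence: with the domain of integration made fixed by an indicator, the integrand
at `s` is continuous in `x` except at `x = s`, and `‖f s‖` dominates it. -/
theorem continuous_duhamel {f : ℝ → L2 L} (hf : IntegrableOn f (Ioo 0 L)) :
    ContinuousOn (duhamel L f) (Icc 0 L) := by
  have heq : EqOn (duhamel L f)
      (fun x => -∫ s in Ioo 0 L, (Ioi x).indicator (fun s => shift L (s - x) (f s)) s) (Icc 0 L) := by
    intro x hx
    have : Ioo 0 L ∩ Ioi x = Ioo x L := by
      ext s; simp only [mem_inter_iff, mem_Ioo, mem_Ioi]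
      exact ⟨fun h => ⟨h.2, h.1.2⟩, fun h => ⟨⟨hx.1.trans_lt h.1, h.2⟩, h.1⟩⟩
    simp only [duhamel]
    rw [setIntegral_indicator measurableSet_Ioi, this]
  refine ContinuousOn.congr ?_ heq
  refine (continuous_iff_continuousAt.2 fun x₀ => ?_).neg.continuousOn
  refine continuousAt_of_dominated (bound := fun s => ‖f s‖) (Eventually.of_forall fun x => ?_)
    (Eventually.of_forall fun x => Eventually.of_forall fun s => ?_) hf.norm ?_
  · exact (aestronglyMeasurable_shift (by fun_prop : Continuous fun s : ℝ => s - x)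
      hf.aestronglyMeasurable).indicator measurableSet_Ioi
  · exact (norm_indicator_le_norm_self _ _).trans (norm_shift_le _ _)
  · have hne : ∀ᵐ s ∂volume.restrict (Ioo 0 L), s ≠ x₀ :=
      ae_restrict_of_ae (Measure.ae_ne volume x₀)
    filter_upwards [hne] with s hs
    rcases lt_or_gt_of_ne hs with h | h
    · refine continuousAt_const.congr (f := fun _ => 0) ?_
      filter_upwards [lt_mem_nhds h] with x hx
      rw [indicator_of_notMem (by simpa using hx.le)]
    · have hc : Continuous fun x => shift L (s - x) (f s) := by
        have h1 : Continuous fun x : ℝ => (s - x, f s) := by fun_prop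
        have h2 := (continuous_shift (L := L)).comp h1
        exact h2
      refine hc.continuousAt.congr ?_
      filter_upwards [gt_mem_nhds h] with x hx
      rw [indicator_of_mem (mem_Ioi.2 hx)]

end IntegroDiff

/-! ### Existence for the boundary value zero. -/

namespace IntegroDiff

open Filter Topology TopologicalSpace

variable {L : ℝ} {g : ℝ → ℝ → ℂ}

theorem integrable_shift {f : ℝ → L2 L} {ξ : ℝ} (hf : IntegrableOn f (Ioo ξ L)) (x : ℝ) :
    IntegrableOn (fun s => shift L (s - x) (f s)) (Ioo ξ L) :=
  hf.norm.mono' (aestronglyMeasurable_shift (by fun_prop : Continuous fun s : ℝ => s - x)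
    hf.aestronglyMeasurable) (Eventually.of_forall fun _ => norm_shift_le _ _)

theorem Continuous.integrableOn_inner {w f : ℝ → L2 L} {a b : ℝ} (hw : Continuous w)
    (hf : IntegrableOn f (Ioo a b)) : IntegrableOn (fun x => inner ℂ (w x) (f x)) (Ioo a b) := by
  obtain ⟨B, hB⟩ := isCompact_Icc.exists_bound_of_continuousOn (s := Icc a b) hw.continuousOn
  refine (hf.norm.const_mul B).mono' (hw.aestronglyMeasurable.inner hf.aestronglyMeasurable) ?_
  refine (ae_restrict_iff' measurableSet_Ioo).2 (Eventually.of_forall fun x hx => ?_)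
  exact (norm_inner_le_norm _ _).trans
    (mul_le_mul_of_nonneg_right (hB x (Ioo_subset_Icc_self hx)) (norm_nonneg _))

/-- Fubini over `ξ < x < s < L` superposes the homogeneous solutions issued from `f s` at `x = s`;
each of them obeys `integral_inner_shift`. -/
theorem integral_inner_duhamel (hL : 0 ≤ L) {f : ℝ → L2 L} (hf : IntegrableOn f (Ioo 0 L))
    {ξ : ℝ} (hξ : ξ ∈ Icc 0 L) {φ : ℝ → ℝ → ℂ} (hφ : ContDiff ℝ 1 (Function.uncurry φ))
    (h0 : ∀ x ∈ Icc ξ L, φ x 0 = 0) :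
    ∫ x in Ioo ξ L, inner ℂ (toL2 L (transport φ x)) (duhamel L f x)
      = inner ℂ (toL2 L (φ ξ)) (duhamel L f ξ) + ∫ s in Ioo ξ L, inner ℂ (toL2 L (φ s)) (f s) := by
  have hsub : ∀ x, ξ ≤ x → Ioo x L ⊆ Ioo 0 L := fun x hx => Ioo_subset_Ioo_left (hξ.1.trans hx)
  have hfξ : IntegrableOn f (Ioo ξ L) := hf.mono_set (hsub ξ le_rfl)
  have hwc : Continuous fun x => toL2 L (transport φ x) := continuous_toL2 (continuous_transport hφ)
  have hφc : Continuous fun x => toL2 L (φ x) := continuous_toL2 hφ.continuous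
  let A : ℝ → ℝ → ℂ := fun x s => inner ℂ (toL2 L (transport φ x)) (shift L (s - x) (f s))
  let H : ℝ → ℝ → ℂ := fun x s => (Ioi x).indicator (A x) s
  have h1 : ∀ x ∈ Ioo ξ L, inner ℂ (toL2 L (transport φ x)) (duhamel L f x)
      = -∫ s in Ioo ξ L, H x s := by
    intro x hx
    have : Ioo ξ L ∩ Ioi x = Ioo x L := by
      ext s; simp only [mem_inter_iff, mem_Ioo, mem_Ioi]
      exact ⟨fun h => ⟨h.2, h.1.2⟩, fun h => ⟨⟨hx.1.trans h.1, h.2⟩, h.1⟩⟩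
    rw [duhamel, inner_neg_right, setIntegral_indicator measurableSet_Ioi, this,
      ← integral_inner (integrable_shift (hf.mono_set (hsub x hx.1.le)) x)]
  have h2 : ∀ s ∈ Ioo ξ L, ∫ x in Ioo ξ L, H x s
      = inner ℂ (toL2 L (φ ξ)) (shift L (s - ξ) (f s)) - inner ℂ (toL2 L (φ s)) (f s) := by
    intro s hs
    rw [← integral_inner_shift hL hφ hs.1.le (fun x hx => h0 x ⟨hx.1, hx.2.trans hs.2.le⟩) (f s)]
    have h3 : ∀ x, H x s = (Iio s).indicator (fun x => A x s) x := fun x => by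
      simp only [H, indicator, mem_Ioi, mem_Iio]
    have : Ioo ξ L ∩ Iio s = Ioo ξ s := by
      ext x; simp only [mem_inter_iff, mem_Ioo, mem_Iio]
      exact ⟨fun h => ⟨h.1.1, h.2⟩, fun h => ⟨⟨h.1, h.2.trans hs.2⟩, h.2⟩⟩
    simp_rw [h3]
    rw [setIntegral_indicator measurableSet_Iio, this]
  obtain ⟨B, hB⟩ := isCompact_Icc.exists_bound_of_continuousOn (s := Icc ξ L) hwc.continuousOn
  have hint : Integrable (Function.uncurry H)
      ((volume.restrict (Ioo ξ L)).prod (volume.restrict (Ioo ξ L))) := by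
    have hfs : Integrable (fun p : ℝ × ℝ => f p.2)
      ((volume.restrict (Ioo ξ L)).prod (volume.restrict (Ioo ξ L))) := Integrable.comp_snd hfξ _
    have hAm : AEStronglyMeasurable (fun p : ℝ × ℝ => A p.1 p.2)
        ((volume.restrict (Ioo ξ L)).prod (volume.restrict (Ioo ξ L))) :=
      (hwc.comp continuous_fst).aestronglyMeasurable.inner
        (aestronglyMeasurable_shift (by fun_prop : Continuous fun p : ℝ × ℝ => p.2 - p.1) hfs.1)
    have hHe : Function.uncurry H = {p : ℝ × ℝ | p.1 < p.2}.indicator fun p => A p.1 p.2 := by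
      ext ⟨x, s⟩; simp [H, indicator]
    have hms : MeasurableSet {p : ℝ × ℝ | p.1 < p.2} := measurableSet_lt measurable_fst measurable_snd
    rw [hHe]
    refine (hfs.norm.const_mul (max B 0)).mono' (hAm.indicator hms) ?_
    rw [Measure.prod_restrict, ae_restrict_iff' (measurableSet_Ioo.prod measurableSet_Ioo)]
    refine Eventually.of_forall fun p hp => ?_
    refine (norm_indicator_le_norm_self _ _).trans ((norm_inner_le_norm _ _).trans ?_)
    gcongr
    · exact (hB _ (Ioo_subset_Icc_self hp.1)).trans (le_max_left _ _)
    · exact norm_shift_le _ _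
  rw [setIntegral_congr_fun measurableSet_Ioo h1, integral_neg, integral_integral_swap hint,
    setIntegral_congr_fun measurableSet_Ioo h2, integral_sub, duhamel, inner_neg_right,
    ← integral_inner (integrable_shift hfξ ξ)]
  · ring
  · exact (integrable_shift hfξ ξ).const_inner _
  · exact Continuous.integrableOn_inner hφc hfξ

theorem isKernelSolution_zero_of_duhamel (hL : 0 ≤ L)
    (hg : MemLp (Function.uncurry g) 2 (volume.restrict (square L))) {k : ℝ → L2 L}
    (hk : ContinuousOn k (Icc 0 L))
    (h : ∀ x ∈ Icc 0 L, k x = duhamel L (fun s => source L g s - kernelOp hg (k s)) x) :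
    IsKernelSolution L g 0 k := by
  have hm : IntegrableOn (source L g) (Ioo 0 L) := (source_memLp hg).integrable one_le_two
  have hG : IntegrableOn (fun s => kernelOp hg (k s)) (Ioo 0 L) :=
    (((kernelOp hg).continuous.comp_continuousOn hk).integrableOn_Icc).mono_set Ioo_subset_Icc_self
  refine (isKernelSolution_iff hL hg).2 ⟨hk, ?_, fun ξ hξ φ hφ h0 => ?_⟩
  · rw [h L ⟨hL, le_rfl⟩]; simp [duhamel]
  have hsub : Ioo ξ L ⊆ Ioo 0 L := Ioo_subset_Ioo_left hξ.1
  have hsub' : Icc ξ L ⊆ Icc 0 L := Icc_subset_Icc_left hξ.1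
  have hwc : Continuous fun x => toL2 L (transport φ x) := continuous_toL2 (continuous_transport hφ)
  have hφc : Continuous fun x => toL2 L (φ x) := continuous_toL2 hφ.continuous
  have hU : ∫ x in ξ..L, (0 : L2 L) x * conj (φ x L) = 0 := by
    rw [intervalIntegral_eq_Ioo hξ.2]
    refine (integral_congr_ae ?_).trans (integral_zero _ _)
    filter_upwards [ae_restrict_of_ae_restrict_of_subset hsub
      (Lp.coeFn_zero ℂ 2 (volume.restrict (Ioo 0 L)))] with x hx
    rw [hx]; simp
  have hk' : IntegrableOn k (Ioo ξ L) :=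
    ((hk.mono hsub').integrableOn_Icc).mono_set Ioo_subset_Icc_self
  have h2 : ∫ x in Ioo ξ L, inner ℂ (toL2 L (transport φ x)) (k x)
      = ∫ x in Ioo ξ L, inner ℂ (toL2 L (transport φ x))
          (duhamel L (fun s => source L g s - kernelOp hg (k s)) x) :=
    setIntegral_congr_fun measurableSet_Ioo fun x hx => by
      rw [← h x (hsub' (Ioo_subset_Icc_self hx))]
  rw [hU, intervalIntegral_eq_Ioo hξ.2, intervalIntegral_eq_Ioo hξ.2,
    integral_add (Continuous.integrableOn_inner hwc hk')
      (Continuous.integrableOn_inner hφc (hG.mono_set hsub)), h2,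
    integral_inner_duhamel hL (f := fun s => source L g s - kernelOp hg (k s)) (hm.sub hG) hξ hφ h0, ← h ξ hξ]
  simp_rw [inner_sub_right]
  rw [integral_sub (Continuous.integrableOn_inner hφc (hm.mono_set hsub))
    (Continuous.integrableOn_inner hφc (hG.mono_set hsub))]
  ring

/-- The kernel equation with boundary value zero has a solution. -/
theorem exists_isKernelSolution_zero (hL : 0 < L)
    (hg : MemLp (Function.uncurry g) 2 (volume.restrict (square L))) :
    ∃ k : ℝ → L2 L, IsKernelSolution L g 0 k := by
  have hm : IntegrableOn (source L g) (Ioo 0 L) := (source_memLp hg).integrable one_le_two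
  have hac : ContinuousOn (fun t => duhamel L (source L g) (L - t)) (Icc 0 L) :=
    (continuous_duhamel hm).comp (by fun_prop) fun t ht =>
      ⟨by linarith [ht.2], by linarith [ht.1]⟩
  -- With `x = L - t` the backward equation becomes a forward Volterra equation whose free term is
  -- the contribution of the source. It is extended by constants because the Volterra lemma asks for
  -- continuity on the whole line.
  let a : ℝ → L2 L := IccExtend hL.le fun t : Icc (0 : ℝ) L => duhamel L (source L g) (L - t)
  have ha : Continuous a := Continuous.Icc_extend' hac.domRestrict
  have hax : ∀ t ∈ Icc 0 L, a t = duhamel L (source L g) (L - t) := fun t ht =>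
    IccExtend_of_mem hL.le _ ht
  have hP : Continuous (Function.uncurry fun t u => shift L t (kernelOp hg u)) := by
    have h1 : Continuous fun p : ℝ × L2 L => (p.1, kernelOp hg p.2) := by fun_prop
    have h2 := (continuous_shift (L := L)).comp h1
    exact h2
  obtain ⟨K, hK, hKe⟩ := exists_volterra_solution hL.le hP (norm_nonneg (kernelOp hg))
    (fun t u v => by
      rw [← shift_sub, ← map_sub]
      exact (norm_shift_le _ _).trans ((kernelOp hg).le_opNorm _)) ha
  have hkc : Continuous fun x => K (L - x) := by fun_prop
  refine ⟨fun x => K (L - x), isKernelSolution_zero_of_duhamel hL.le hg hkc.continuousOn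
    fun x hx => ?_⟩
  have hx' : L - x ∈ Icc 0 L := ⟨by linarith [hx.2], by linarith [hx.1]⟩
  have hsub : Ioo x L ⊆ Ioo 0 L := Ioo_subset_Ioo_left hx.1
  have hG : IntegrableOn (fun s => kernelOp hg (K (L - s))) (Ioo x L) := by
    have : Continuous fun s => kernelOp hg (K (L - s)) := by fun_prop
    exact this.integrableOn_Icc.mono_set Ioo_subset_Icc_self
  rw [hKe _ hx', hax _ hx', sub_sub_cancel, duhamel, duhamel]
  simp_rw [shift_sub]
  rw [integral_sub (integrable_shift (hm.mono_set hsub) x) (integrable_shift hG x), neg_sub]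
  have h1 := intervalIntegral.integral_comp_sub_left (a := x) (b := L)
    (fun r => shift L (L - x - r) (kernelOp hg (K r))) L
  have h2 : ∫ s in x..L, shift L (L - x - (L - s)) (kernelOp hg (K (L - s)))
      = ∫ s in Ioo x L, shift L (s - x) (kernelOp hg (K (L - s))) := by
    rw [intervalIntegral_eq_Ioo hx.2]
    refine setIntegral_congr_fun measurableSet_Ioo fun s _ => ?_
    congr 1
    ring
  rw [sub_self, h2] at h1
  rw [← h1]
  abel

end IntegroDiff

/-! ### From controllability to a kernel that vanishes at `x = 0`. -/

namespace IntegroDiff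

open Filter Topology TopologicalSpace

variable {L : ℝ} {g : ℝ → ℝ → ℂ}

theorem integral_comp_reflect {E : Type} [NormedAddCommGroup E] [NormedSpace ℝ E] (ξ : ℝ)
    (f : ℝ → E) : ∫ t in (0 : ℝ)..L - ξ, f (L - t) = ∫ x in ξ..L, f x := by
  rw [intervalIntegral.integral_comp_sub_left, sub_sub_cancel, sub_zero]

theorem measurePreserving_reflect (L : ℝ) :
    MeasurePreserving (fun x : ℝ => L - x) (volume.restrict (Ioo 0 L)) (volume.restrict (Ioo 0 L)) := by
  have h := (Measure.measurePreserving_sub_left volume L).restrict_preimage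
    (measurableSet_Ioo (a := (0 : ℝ)) (b := L))
  have : (fun x : ℝ => L - x) ⁻¹' Ioo 0 L = Ioo 0 L := by
    ext x; simp only [mem_preimage, mem_Ioo]
    exact ⟨fun h => ⟨by linarith, by linarith⟩, fun h => ⟨by linarith, by linarith⟩⟩
  rwa [this] at h

theorem memLp_reflect_conj (U : L2 L) :
    MemLp (fun x => conj (U (L - x))) 2 (volume.restrict (Ioo 0 L)) :=
  ((Lp.memLp U).comp_measurePreserving (measurePreserving_reflect L)).star

/-- A trajectory of the control system starting from zero gives, after time reversal and
conjugation, a solution of the kernel equation without source. -/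
theorem IsWeakSolution.kernel_eq (hL : 0 ≤ L)
    (hg : MemLp (Function.uncurry g) 2 (volume.restrict (square L))) {U : L2 L} {u : ℝ → L2 L}
    (h : IsWeakSolution L L g 0 U u) {ξ : ℝ} (hξ : ξ ∈ Icc 0 L) {φ : ℝ → ℝ → ℂ}
    (hφ : ContDiff ℝ 1 (Function.uncurry φ)) (h0 : ∀ x ∈ Icc ξ L, φ x 0 = 0) :
    (∫ x in ξ..L, (inner ℂ (toL2 L (transport φ x)) (star (u (L - x)))
        + inner ℂ (toL2 L (φ x)) (kernelOp hg (star (u (L - x))))))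
      - inner ℂ (toL2 L (φ ξ)) (star (u (L - ξ)))
      + (∫ x in ξ..L, toL2 L (fun x => conj (U (L - x))) x * conj (φ x L)) = 0 := by
  -- Time reversal sends the final time `L - ξ` to `ξ`; conjugation turns the coefficient `conj (g z
  -- y)` of the control system's adjoint into the coefficient `g σ y` of the kernel equation.
  let ψ : ℝ → ℝ → ℂ := fun t y => conj (φ (L - t) y)
  have hψ : ContDiff ℝ 1 (Function.uncurry ψ) := by
    have h1 : ContDiff ℝ 1 fun p : ℝ × ℝ => Function.uncurry φ (L - p.1, p.2) :=
      hφ.comp (by fun_prop)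
    exact Complex.conjCLE.contDiff.comp h1
  have hmφ : ∀ x, MemLp (φ x) 2 (volume.restrict (Ioo 0 L)) := fun x =>
    Continuous.memLp_Ioo (ContDiff.continuous_slice hφ.continuous x)
  have hw := h.2 (L - ξ) ⟨by linarith [hξ.2], by linarith [hξ.1]⟩ ψ hψ fun t ht => by
    simp only [ψ]
    rw [h0 _ ⟨by linarith [ht.2], by linarith [ht.1]⟩, map_zero]
  have hdx : ∀ t y, deriv (fun s => ψ s y) t = -conj (deriv (fun s => φ s y) (L - t)) := by
    intro t y
    have h1 : HasDerivAt (fun s => φ (L - s) y) (-deriv (fun s => φ s y) (L - t)) t := by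
      have := (hasDerivAt_fst hφ (L - t) y).differentiableAt.hasDerivAt.comp_const_sub L t
      exact this
    have h2 := (Complex.conjCLE.toContinuousLinearMap.hasFDerivAt.comp_hasDerivAt t h1).deriv
    refine Eq.trans ?_ (h2.trans ?_)
    · rfl
    · simp
  have hdy : ∀ t y, deriv (fun z => ψ t z) y = conj (deriv (fun z => φ (L - t) z) y) := by
    intro t y
    have h1 := (hasDerivAt_snd hφ (L - t) y).differentiableAt.hasDerivAt
    exact (Complex.conjCLE.toContinuousLinearMap.hasFDerivAt.comp_hasDerivAt y h1).deriv
  have hin : ∀ t, ∫ y in (0 : ℝ)..L, u t y * conj (-deriv (fun s => ψ s y) t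
        + deriv (fun z => ψ t z) y - ∫ z in (0 : ℝ)..L, conj (g z y) * ψ t z)
      = -conj (inner ℂ (toL2 L (transport φ (L - t))) (star (u t))
        + inner ℂ (toL2 L (φ (L - t))) (kernelOp hg (star (u t)))) := by
    intro t
    rw [← adjoint_pairing hL hg hφ (star (u t)) (L - t), intervalIntegral_eq_Ioo hL,
      intervalIntegral_eq_Ioo hL, ← integral_conj, ← integral_neg]
    refine integral_congr_ae ?_
    filter_upwards [Lp.coeFn_star (u t)] with y hy
    have h1 : ∫ z in (0 : ℝ)..L, conj (g z y) * ψ t z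
        = conj (∫ σ in (0 : ℝ)..L, g σ y * φ (L - t) σ) := by
      rw [intervalIntegral_eq_Ioo hL, intervalIntegral_eq_Ioo hL, ← integral_conj]
      simp [ψ]
    rw [hy, hdx, hdy, h1]
    simp only [Pi.star_apply, map_mul, map_add, map_sub, map_neg, Complex.conj_conj, neg_neg,
      RCLike.star_def]
    ring
  simp_rw [hin] at hw
  have hz : ∫ x in (0 : ℝ)..L, (0 : L2 L) x * conj (ψ 0 x) = 0 := by
    rw [intervalIntegral_eq_Ioo hL]
    refine (integral_congr_ae ?_).trans (integral_zero _ _)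
    filter_upwards [Lp.coeFn_zero ℂ 2 (volume.restrict (Ioo 0 L))] with x hx
    rw [hx]; simp
  have hτ : ∫ x in (0 : ℝ)..L, u (L - ξ) x * conj (ψ (L - ξ) x)
      = conj (inner ℂ (toL2 L (φ ξ)) (star (u (L - ξ)))) := by
    rw [inner_toL2 hL (hmφ ξ), intervalIntegral_eq_Ioo hL, intervalIntegral_eq_Ioo hL,
      ← integral_conj]
    refine integral_congr_ae ?_
    filter_upwards [Lp.coeFn_star (u (L - ξ))] with y hy
    rw [hy]; simp [ψ]
  have hτL : (0 : ℝ) ≤ L - ξ := by linarith [hξ.2]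
  have hUU : ∫ t in (0 : ℝ)..L - ξ, U t * conj (ψ t L)
      = conj (∫ x in ξ..L, toL2 L (fun x => conj (U (L - x))) x * conj (φ x L)) := by
    have h1 : ∫ x in ξ..L, toL2 L (fun x => conj (U (L - x))) x * conj (φ x L)
        = ∫ x in ξ..L, conj (U (L - x)) * conj (φ x L) := by
      rw [intervalIntegral_eq_Ioo hξ.2, intervalIntegral_eq_Ioo hξ.2]
      refine integral_congr_ae ?_
      filter_upwards [ae_restrict_of_ae_restrict_of_subset (Ioo_subset_Ioo_left hξ.1)
        (toL2_coeFn (memLp_reflect_conj U))] with x hx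
      rw [hx]
    rw [h1, ← integral_comp_reflect (L := L) ξ, intervalIntegral_eq_Ioo hτL, intervalIntegral_eq_Ioo hτL,
      ← integral_conj]
    simp [ψ]
  have hQ : ∫ t in (0 : ℝ)..L - ξ, -conj (inner ℂ (toL2 L (transport φ (L - t))) (star (u t))
        + inner ℂ (toL2 L (φ (L - t))) (kernelOp hg (star (u t))))
      = -conj (∫ x in ξ..L, (inner ℂ (toL2 L (transport φ x)) (star (u (L - x)))
        + inner ℂ (toL2 L (φ x)) (kernelOp hg (star (u (L - x)))))) := by
    rw [← integral_comp_reflect (L := L) ξ, intervalIntegral_eq_Ioo hτL, intervalIntegral_eq_Ioo hτL,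
      ← integral_conj, ← integral_neg]
    simp only [sub_sub_cancel]
  rw [hQ, hτ, hz, hUU] at hw
  have := congrArg (starRingEnd ℂ) hw
  simp only [map_add, map_sub, map_neg, Complex.conj_conj, map_zero] at this
  linear_combination -this

theorem isometry_star_L2 : Isometry (star : L2 L → L2 L) := by
  intro u v
  rw [Lp.edist_def, Lp.edist_def, ← eLpNorm_star (f := ⇑u - ⇑v)]
  refine eLpNorm_congr_ae ?_
  filter_upwards [Lp.coeFn_star u, Lp.coeFn_star v] with x h1 h2
  simp [h1, h2]

theorem star_neg_star (v : L2 L) : star (-star v) = -v := by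
  refine Lp.ext ?_
  filter_upwards [Lp.coeFn_star (-star v), Lp.coeFn_neg (star v), Lp.coeFn_star v,
    Lp.coeFn_neg v] with x h1 h2 h3 h4
  rw [h1, Pi.star_apply, h2, Pi.neg_apply, h3, h4]
  simp

/-- Exact controllability at time `L` provides a solution of the kernel equation that vanishes at
`x = 0`. -/
theorem ExactlyControllable.exists_isKernelSolution (hL : 0 < L)
    (hg : MemLp (Function.uncurry g) 2 (volume.restrict (square L)))
    (h : ExactlyControllable L L g) :
    ∃ U : L2 L, ∃ k : ℝ → L2 L, IsKernelSolution L g U k ∧ k 0 = 0 := by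
  obtain ⟨k₀, hk₀⟩ := exists_isKernelSolution_zero hL hg
  -- The target is chosen so that the reversed, conjugated trajectory takes the value `-k₀ 0` at `x
  -- = 0`.
  obtain ⟨U, u, hu, huL⟩ := h 0 (-star (k₀ 0))
  have hcu : ContinuousOn (fun x => star (u (L - x))) (Icc 0 L) :=
    isometry_star_L2.continuous.comp_continuousOn
      (hu.1.comp (by fun_prop) fun t ht => ⟨by linarith [ht.2], by linarith [ht.1]⟩)
  have hk₀' := (isKernelSolution_iff hL.le hg).1 hk₀
  refine ⟨toL2 L fun x => conj (U (L - x)), fun x => k₀ x + star (u (L - x)),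
    (isKernelSolution_iff hL.le hg).2 ⟨hk₀.1.add hcu, ?_, fun ξ hξ φ hφ h0 => ?_⟩, ?_⟩
  -- At `ξ = L` all the integrals are over an empty interval, so the weak form says that the initial
  -- state `u 0` is orthogonal, after conjugation, to every test function.
  · have : ‖star (u (L - L))‖ ≤ 0 := norm_le_of_forall_test hL.le le_rfl fun χ hχ => by
      have hφ : ContDiff ℝ 1 (Function.uncurry fun _ y : ℝ => χ y) :=
        (hχ.contDiff.of_le (by simp)).comp contDiff_snd
      have := hu.kernel_eq hL.le hg (ξ := L) ⟨hL.le, le_rfl⟩ hφ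
        fun x _ => hχ.eq_zero fun h => lt_irrefl _ h.1
      simp only [intervalIntegral.integral_same, zero_sub, add_zero, neg_eq_zero] at this
      rw [this]; simp
    rw [norm_le_zero_iff.1 this, hk₀'.2.1, add_zero]
  · have e1 := hk₀'.2.2 ξ hξ φ hφ h0
    have e2 := hu.kernel_eq hL.le hg hξ hφ h0
    have hU : ∫ x in ξ..L, (0 : L2 L) x * conj (φ x L) = 0 := by
      rw [intervalIntegral_eq_Ioo hξ.2]
      refine (integral_congr_ae ?_).trans (integral_zero _ _)
      filter_upwards [ae_restrict_of_ae_restrict_of_subset (Ioo_subset_Ioo_left hξ.1)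
        (Lp.coeFn_zero ℂ 2 (volume.restrict (Ioo 0 L)))] with x hx
      rw [hx]; simp
    have hint : ∀ k : ℝ → L2 L, ContinuousOn k (Icc 0 L) → IntervalIntegrable
        (fun x => inner ℂ (toL2 L (transport φ x)) (k x) + inner ℂ (toL2 L (φ x)) (kernelOp hg (k x)))
        volume ξ L := fun k hk => by
      have hk' := hk.mono (Icc_subset_Icc_left hξ.1)
      exact ContinuousOn.intervalIntegrable_of_Icc hξ.2
        (((continuous_toL2 (continuous_transport hφ)).continuousOn.inner hk').add
          ((continuous_toL2 hφ.continuous).continuousOn.inner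
            ((kernelOp hg).continuous.comp_continuousOn hk')))
    have hsum := intervalIntegral.integral_add (hint k₀ hk₀.1) (hint _ hcu)
    rw [hU] at e1
    have hadd : ∀ x, inner ℂ (toL2 L (transport φ x)) (k₀ x + star (u (L - x)))
          + inner ℂ (toL2 L (φ x)) (kernelOp hg (k₀ x + star (u (L - x))))
        = (inner ℂ (toL2 L (transport φ x)) (k₀ x) + inner ℂ (toL2 L (φ x)) (kernelOp hg (k₀ x)))
          + (inner ℂ (toL2 L (transport φ x)) (star (u (L - x)))
            + inner ℂ (toL2 L (φ x)) (kernelOp hg (star (u (L - x))))) := fun x => by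
      rw [map_add, inner_add_right, inner_add_right]; ring
    simp_rw [hadd]
    rw [hsum, inner_add_right]
    linear_combination e1 + e2
  · simp only [sub_zero, huL, star_neg_star, add_neg_cancel]

end IntegroDiff

/-! ### Integrals along lines: square integrability and weak derivatives. -/

namespace IntegroDiff

open Filter Topology TopologicalSpace

variable {L : ℝ} {g : ℝ → ℝ → ℂ}

/-- The Cauchy–Schwarz inequality against the constant function one. -/
theorem sq_enorm_integral_le {X : Type} [MeasurableSpace X] {μ : Measure X} {F : X → ℂ}
    (hF : AEStronglyMeasurable F μ) : ‖∫ x, F x ∂μ‖ₑ ^ 2 ≤ μ univ * ∫⁻ x, ‖F x‖ₑ ^ 2 ∂μ := by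
  have h1 : ‖∫ x, F x ∂μ‖ₑ ≤ eLpNorm F 1 μ := by
    rw [eLpNorm_one_eq_lintegral_enorm]; exact enorm_integral_le_lintegral_enorm _
  have h2 := h1.trans (eLpNorm_le_eLpNorm_mul_rpow_measure_univ (p := 1) (q := 2) one_le_two hF)
  have h3 : eLpNorm F 2 μ ^ 2 = ∫⁻ x, ‖F x‖ₑ ^ 2 ∂μ := by
    rw [eLpNorm_eq_lintegral_rpow_enorm_toReal (by norm_num) (by norm_num), ← ENNReal.rpow_natCast,
      ← ENNReal.rpow_mul]
    simp
  have h4 : (μ univ ^ (1 / (1 : ENNReal).toReal - 1 / (2 : ENNReal).toReal)) ^ 2 = μ univ := by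
    rw [← ENNReal.rpow_natCast, ← ENNReal.rpow_mul]
    norm_num
  calc _ ≤ (eLpNorm F 2 μ * μ univ ^ (1 / (1 : ENNReal).toReal - 1 / (2 : ENNReal).toReal)) ^ 2 := by
        gcongr
    _ = _ := by rw [mul_pow, h3, h4, mul_comm]

theorem memLp_two_iff_lintegral {X : Type} [MeasurableSpace X] {μ : Measure X} {F : X → ℂ}
    (hF : AEStronglyMeasurable F μ) : MemLp F 2 μ ↔ ∫⁻ x, ‖F x‖ₑ ^ 2 ∂μ < ⊤ := by
  rw [MemLp, and_iff_right hF,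
    eLpNorm_lt_top_iff_lintegral_rpow_enorm_lt_top (by norm_num) (by norm_num)]
  simp

/-- The integral of `q` along the segments of direction `e`. -/
noncomputable def lineIntegral (L : ℝ) (e : ℝ × ℝ) (q : ℝ × ℝ → ℂ) (p : ℝ × ℝ) : ℂ :=
  ∫ s in Ioo 0 L, q (p + s • e)

section LineIntegral

variable {q : ℝ × ℝ → ℂ} {e : ℝ × ℝ}

theorem measurable_lineIntegral (hq : Measurable q) : Measurable (lineIntegral L e q) := by
  have : StronglyMeasurable (Function.uncurry fun (p : ℝ × ℝ) (s : ℝ) => q (p + s • e)) :=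
    (hq.comp (by fun_prop : Measurable fun z : (ℝ × ℝ) × ℝ => z.1 + z.2 • e)).stronglyMeasurable
  exact (StronglyMeasurable.integral_prod_right (ν := volume.restrict (Ioo 0 L)) this).measurable

theorem sq_lineIntegral_le (hq : Measurable q) (p : ℝ × ℝ) :
    ‖lineIntegral L e q p‖ₑ ^ 2
      ≤ ENNReal.ofReal L * ∫⁻ s in Ioo 0 L, ‖q (p + s • e)‖ₑ ^ 2 := by
  have := sq_enorm_integral_le (μ := volume.restrict (Ioo 0 L)) (F := fun s => q (p + s • e))
    (hq.comp (by fun_prop)).aestronglyMeasurable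
  simpa [lineIntegral] using this

/-- The `L²` norm of a line integral along a horizontal line. -/
theorem lintegral_sq_lineIntegral_le (hq : Measurable q) (he : |e.2| = 1) (y : ℝ) :
    ∫⁻ x, ‖lineIntegral L e q (x, y)‖ₑ ^ 2 ≤ ENNReal.ofReal L * ∫⁻ p, ‖q p‖ₑ ^ 2 := by
  have hm : Measurable fun p : ℝ × ℝ => ‖q p‖ₑ ^ 2 := hq.enorm.pow_const 2
  have hinner : ∀ s : ℝ, ∫⁻ x, ‖q ((x, y) + s • e)‖ₑ ^ 2 = ∫⁻ x, ‖q (x, y + s * e.2)‖ₑ ^ 2 :=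
    fun s => lintegral_add_right_eq_self (fun x => ‖q (x, y + s * e.2)‖ₑ ^ 2) (s * e.1)
  have hmM : Measurable fun z => ∫⁻ x, ‖q (x, z)‖ₑ ^ 2 := hm.lintegral_prod_left'
  calc _ ≤ ∫⁻ x, ENNReal.ofReal L * ∫⁻ s in Ioo 0 L, ‖q ((x, y) + s • e)‖ₑ ^ 2 :=
        lintegral_mono fun x => sq_lineIntegral_le hq (x, y)
    _ = ENNReal.ofReal L * ∫⁻ s in Ioo 0 L, ∫⁻ x, ‖q ((x, y) + s • e)‖ₑ ^ 2 := by
        rw [lintegral_const_mul _ (Measurable.lintegral_prod_right'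
          (f := fun z : ℝ × ℝ => ‖q ((z.1, y) + z.2 • e)‖ₑ ^ 2) (hm.comp (by fun_prop))),
          lintegral_lintegral_swap]
        exact (hm.comp (by fun_prop : Measurable fun z : ℝ × ℝ => (z.1, y) + z.2 • e)).aemeasurable
    _ ≤ ENNReal.ofReal L * ∫⁻ p, ‖q p‖ₑ ^ 2 := by
        gcongr
        simp_rw [hinner]
        refine (lintegral_mono' Measure.restrict_le_self le_rfl).trans ?_
        rw [show (volume : Measure (ℝ × ℝ)) = volume.prod volume from rfl,
          lintegral_prod_symm' _ hm]
        -- Since `e.2 = ±1`, the map `s ↦ y + s * e.2` preserves Lebesgue measure. The union of the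
        -- translated horizontal lines thus sweeps the plane with Jacobian one, whatever `y` is.
        rcases (abs_eq zero_le_one).1 he with h | h
        · rw [h]
          simp_rw [mul_one]
          exact (lintegral_add_left_eq_self (fun z => ∫⁻ x, ‖q (x, z)‖ₑ ^ 2) y).le
        · rw [h]
          simp_rw [mul_neg, mul_one, ← sub_eq_add_neg]
          exact (lintegral_sub_left_eq_self (fun z => ∫⁻ x, ‖q (x, z)‖ₑ ^ 2) y).le

/-- The bound on horizontal lines is uniform in `y`, so any weight that is merely integrable in `y`
is allowed. The weight `‖J y‖²`, with `J` the jump of `g` across the diagonal, is the one that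
matters. -/
theorem lintegral_weight_lineIntegral_lt_top (hq : Measurable q) (hq2 : MemLp q 2 volume)
    (he : |e.2| = 1) {w : ℝ → ENNReal} (hw : AEMeasurable w (volume.restrict (Ioo 0 L)))
    (hwi : ∫⁻ y in Ioo 0 L, w y < ⊤) :
    ∫⁻ p in square L, w p.2 * ‖lineIntegral L e q p‖ₑ ^ 2 < ⊤ := by
  have hm := measurable_lineIntegral (L := L) (e := e) hq
  rw [volume_restrict_square, lintegral_prod_symm (fun p : ℝ × ℝ => w p.2 * ‖lineIntegral L e q p‖ₑ ^ 2)
    ((hw.comp_snd).mul (hm.enorm.pow_const 2).aemeasurable)]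
  have hm2 : Measurable fun p => ‖lineIntegral L e q p‖ₑ ^ 2 := hm.enorm.pow_const 2
  calc _ ≤ ∫⁻ y in Ioo 0 L, w y * (ENNReal.ofReal L * ∫⁻ p, ‖q p‖ₑ ^ 2) := by
        refine lintegral_mono fun y => ?_
        simp only
        rw [lintegral_const_mul _ (f := fun x => ‖lineIntegral L e q (x, y)‖ₑ ^ 2)
          (hm2.comp measurable_prodMk_right)]
        gcongr
        exact (lintegral_mono' Measure.restrict_le_self le_rfl).trans
          (lintegral_sq_lineIntegral_le hq he y)
    _ < ⊤ := by
        rw [lintegral_mul_const'']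
        · exact ENNReal.mul_lt_top hwi (ENNReal.mul_lt_top ENNReal.ofReal_lt_top
            ((memLp_two_iff_lintegral hq2.1).1 hq2))
        · exact hw

theorem memLp_lineIntegral (hq : Measurable q) (hq2 : MemLp q 2 volume) (he : |e.2| = 1) :
    MemLp (lineIntegral L e q) 2 (volume.restrict (square L)) := by
  rw [memLp_two_iff_lintegral (measurable_lineIntegral hq).aestronglyMeasurable]
  have := lintegral_weight_lineIntegral_lt_top (L := L) (w := fun _ => 1) hq hq2 he
    aemeasurable_const (by simp)
  simpa using this

theorem measurePreserving_shear (e : ℝ × ℝ) :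
    MeasurePreserving (fun z : ℝ × (ℝ × ℝ) => (z.1, z.2 + z.1 • e))
      ((volume.restrict (Ioo 0 L)).prod volume) ((volume.restrict (Ioo 0 L)).prod volume) :=
  (MeasurePreserving.id _).skew_product (g := fun (s : ℝ) (p : ℝ × ℝ) => p + s • e)
    (by fun_prop) (Eventually.of_forall fun s => map_add_right_eq_self _ _)

/-- Fubini and translation invariance move the translation from `q` to the test function, where it
can be differentiated. -/
theorem integral_lineIntegral_mul (hqi : Integrable q) {ψ : ℝ × ℝ → ℂ} (hψ : Continuous ψ) {C : ℝ}
    (hC : ∀ p, ‖ψ p‖ ≤ C) :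
    ∫ p, lineIntegral L e q p * ψ p = ∫ s in Ioo 0 L, ∫ p, q p * ψ (p - s • e) := by
  have h1 : Integrable (fun z : ℝ × (ℝ × ℝ) => q (z.2 + z.1 • e))
      ((volume.restrict (Ioo 0 L)).prod volume) :=
    (measurePreserving_shear e).integrable_comp_of_integrable (hqi.comp_snd _)
  have h2 : Integrable (fun z : ℝ × (ℝ × ℝ) => q (z.2 + z.1 • e) * ψ z.2)
      ((volume.restrict (Ioo 0 L)).prod volume) :=
    h1.mul_bdd (c := C) (hψ.comp continuous_snd).aestronglyMeasurable
      (Eventually.of_forall fun z => hC _)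
  have h3 : ∀ p, lineIntegral L e q p * ψ p = ∫ s in Ioo 0 L, q (p + s • e) * ψ p := fun p => by
    rw [lineIntegral, integral_mul_const]
  simp_rw [h3]
  rw [← integral_integral_swap (f := fun (s : ℝ) (p : ℝ × ℝ) => q (p + s • e) * ψ p) h2]
  congr 1
  ext s
  rw [← integral_add_right_eq_self (fun p => q p * ψ (p - s • e)) (s • e)]
  simp

theorem IsTest.bounded {Ω : Set (ℝ × ℝ)} {ψ : ℝ × ℝ → ℂ} (h : IsTest Ω ψ) : ∃ C, ∀ p, ‖ψ p‖ ≤ C :=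
  h.contDiff.continuous.bounded_above_of_compact_support h.compact

theorem IsTest.fderiv_apply {Ω : Set (ℝ × ℝ)} {ψ : ℝ × ℝ → ℂ} (h : IsTest Ω ψ) (v : ℝ × ℝ) :
    IsTest Ω fun p => fderiv ℝ ψ p v := by
  have hs : tsupport (fun p => fderiv ℝ ψ p v) ⊆ tsupport ψ :=
    closure_minimal (fun p hp => support_fderiv_subset ℝ (fun h0 => hp (by
      simp only; rw [h0]; rfl))) (isClosed_tsupport ψ)
  refine ⟨?_, h.compact.mono' ((subset_tsupport _).trans hs), hs.trans h.subset⟩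
  exact (h.contDiff.fderiv_right (m := ∞) (by simp)).clm_apply contDiff_const

/-- Differentiation of a line integral, provided that the integrand can be differentiated when
tested against the translates of the test functions. -/
theorem HasWeakDeriv.lineIntegral {Ω : Set (ℝ × ℝ)} {F : ℝ × ℝ → ℂ} {v : ℝ × ℝ}
    (hqi : Integrable q) (hFi : Integrable F)
    (h : ∀ ψ, IsTest Ω ψ → ∀ s ∈ Ioo 0 L, ∫ p, q p * fderiv ℝ ψ (p - s • e) v
      = -∫ p, F p * ψ (p - s • e)) :
    HasWeakDeriv Ω v (lineIntegral L e q) (lineIntegral L e F) := by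
  intro ψ h1 h2 h3
  have hψ : IsTest Ω ψ := ⟨h1, h2, h3⟩
  have hψ' := hψ.fderiv_apply v
  obtain ⟨C, hC⟩ := hψ.bounded
  obtain ⟨C', hC'⟩ := hψ'.bounded
  rw [setIntegral_eq_integral_of_forall_compl_eq_zero fun p hp => by rw [hψ'.eq_zero hp, mul_zero],
    setIntegral_eq_integral_of_forall_compl_eq_zero fun p hp => by rw [hψ.eq_zero hp, mul_zero],
    integral_lineIntegral_mul hqi hψ'.contDiff.continuous hC',
    integral_lineIntegral_mul hFi hψ.contDiff.continuous hC, ← integral_neg]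
  exact setIntegral_congr_fun measurableSet_Ioo fun s hs => h ψ hψ s hs

end LineIntegral

end IntegroDiff

/-! ### The right-hand side of the kernel equation as a function on the square. -/

namespace IntegroDiff

open Filter Topology TopologicalSpace

variable {L : ℝ} {g : ℝ → ℝ → ℂ}

/-- The integral term `∫₀ᴸ conj g(y,σ) k(x,σ) dσ` of the kernel equation. -/
noncomputable def nonlocal (L : ℝ) (g : ℝ → ℝ → ℂ) (k : ℝ → L2 L) (p : ℝ × ℝ) : ℂ :=
  inner ℂ (toL2 L (g p.2)) (k p.1)

/-- The right-hand side `conj g(y,x) - ∫₀ᴸ conj g(y,σ) k(x,σ) dσ` of the kernel equation. -/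
noncomputable def kernelRhs (L : ℝ) (g : ℝ → ℝ → ℂ) (k : ℝ → L2 L) (p : ℝ × ℝ) : ℂ :=
  conj (g p.2 p.1) - nonlocal L g k p

theorem memLp_row (hg : MemLp (Function.uncurry g) 2 (volume.restrict (square L))) :
    MemLp (fun y => toL2 L (g y)) 2 (volume.restrict (Ioo 0 L)) := memLp_toL2_slice hg

theorem row_ae_memLp (hg : MemLp (Function.uncurry g) 2 (volume.restrict (square L))) :
    ∀ᵐ y ∂volume.restrict (Ioo 0 L), MemLp (g y) 2 (volume.restrict (Ioo 0 L)) := by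
  rw [volume_restrict_square] at hg
  exact MemLp.slice_ae hg

theorem memLp_inner_row (hg : MemLp (Function.uncurry g) 2 (volume.restrict (square L))) (v : L2 L) :
    MemLp (fun y => inner ℂ (toL2 L (g y)) v) 2 (volume.restrict (Ioo 0 L)) :=
  (memLp_row hg).inner_const v

theorem memLp_nonlocal (hg : MemLp (Function.uncurry g) 2 (volume.restrict (square L)))
    {k : ℝ → L2 L} (hk : ContinuousOn k (Icc 0 L)) :
    MemLp (nonlocal L g k) 2 (volume.restrict (square L)) := by
  obtain ⟨B, hB⟩ := isCompact_Icc.exists_bound_of_continuousOn hk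
  have hN := (memLp_row hg).comp_snd (volume.restrict (Ioo 0 L))
  have hkm : AEStronglyMeasurable k (volume.restrict (Ioo 0 L)) :=
    (hk.mono Ioo_subset_Icc_self).aestronglyMeasurable measurableSet_Ioo
  have hm : AEStronglyMeasurable (nonlocal L g k)
      ((volume.restrict (Ioo 0 L)).prod (volume.restrict (Ioo 0 L))) := hN.1.inner hkm.comp_fst
  rw [volume_restrict_square]
  refine (hN.norm.const_mul B).mono' hm ?_
  rw [Measure.prod_restrict, ae_restrict_iff' (measurableSet_Ioo.prod measurableSet_Ioo)]
  refine Eventually.of_forall fun p hp => (norm_inner_le_norm _ _).trans ?_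
  rw [mul_comm]
  exact mul_le_mul_of_nonneg_right (hB _ (Ioo_subset_Icc_self hp.1)) (norm_nonneg _)

theorem memLp_kernelRhs (hg : MemLp (Function.uncurry g) 2 (volume.restrict (square L)))
    {k : ℝ → L2 L} (hk : ContinuousOn k (Icc 0 L)) :
    MemLp (kernelRhs L g k) 2 (volume.restrict (square L)) :=
  (memLp_conj_swap hg).sub (memLp_nonlocal hg hk)

/-- Fubini: the operator built from the classes `conj g(·,y)` is also given pointwise by inner
products with the rows `g σ`. Comparing both forms lets a derivative of `w` be transferred to the
first variable of `g`. -/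
theorem inner_kernelOp_eq (hL : 0 ≤ L)
    (hg : MemLp (Function.uncurry g) 2 (volume.restrict (square L)))
    {w : ℝ → ℂ} (hw : MemLp w 2 (volume.restrict (Ioo 0 L))) (v : L2 L) :
    inner ℂ (toL2 L w) (kernelOp hg v)
      = ∫ σ in Ioo 0 L, inner ℂ (toL2 L (g σ)) v * conj (w σ) := by
  set μ := volume.restrict (Ioo 0 L) with hμ
  have hint : Integrable (Function.uncurry fun y σ => v y * conj (g σ y) * conj (w σ)) (μ.prod μ) := by
    have h1 : MemLp (fun p : ℝ × ℝ => v p.1 * conj (w p.2)) 2 (μ.prod μ) := by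
      have hvm := (Lp.memLp v).1.comp_fst (ν := μ)
      have hwm := (hw.1.star).comp_snd (μ := μ)
      refine (memLp_two_iff_integrable_sq_norm (hvm.mul hwm)).2 ?_
      have := ((memLp_two_iff_integrable_sq_norm (Lp.memLp v).1).1 (Lp.memLp v)).mul_prod
        ((memLp_two_iff_integrable_sq_norm hw.1).1 hw)
      refine this.congr (Eventually.of_forall fun p => ?_)
      simp [mul_pow]
    have h2 : MemLp (fun p : ℝ × ℝ => conj (g p.2 p.1)) 2 (μ.prod μ) := by
      have := memLp_conj_swap hg
      rwa [volume_restrict_square] at this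
    refine (h1.integrable_mul h2).congr (Eventually.of_forall fun p => ?_)
    simp only [Pi.mul_apply, Function.uncurry]
    ring
  rw [inner_kernelOp hL hg hw, intervalIntegral_eq_Ioo hL]
  have h1 : ∀ y, v y * conj (∫ σ in (0 : ℝ)..L, g σ y * w σ)
      = ∫ σ in Ioo 0 L, v y * conj (g σ y) * conj (w σ) := fun y => by
    rw [intervalIntegral_eq_Ioo hL, ← integral_conj, ← integral_const_mul]
    simp [mul_assoc]
  simp_rw [h1]
  rw [integral_integral_swap hint]
  refine integral_congr_ae ?_
  filter_upwards [row_ae_memLp hg] with σ hσ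
  rw [inner_toL2 hL hσ, intervalIntegral_eq_Ioo hL, integral_mul_const]

theorem integral_kernelRhs (hL : 0 ≤ L)
    (hg : MemLp (Function.uncurry g) 2 (volume.restrict (square L))) {k : ℝ → L2 L}
    {w : ℝ → ℂ} (hw : MemLp w 2 (volume.restrict (Ioo 0 L))) {x : ℝ}
    (hx : MemLp (fun y => conj (g y x)) 2 (volume.restrict (Ioo 0 L))) :
    ∫ y in Ioo 0 L, kernelRhs L g k (x, y) * conj (w y)
      = inner ℂ (toL2 L w) (source L g x) - inner ℂ (toL2 L w) (kernelOp hg (k x)) := by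
  rw [inner_source hL hw hx, inner_kernelOp_eq hL hg hw, intervalIntegral_eq_Ioo hL, ← integral_sub]
  · simp only [kernelRhs, nonlocal, sub_mul]
  · exact hx.integrable_mul hw.star
  · exact (memLp_inner_row hg (k x)).integrable_mul hw.star

/-- The weak form of the kernel equation with the integral term moved to the right-hand side. -/
theorem IsKernelSolution.weak_form (hL : 0 ≤ L)
    (hg : MemLp (Function.uncurry g) 2 (volume.restrict (square L))) {U : L2 L} {k : ℝ → L2 L}
    (hk : IsKernelSolution L g U k) {q : ℝ × ℝ → ℂ}
    (hq : q =ᵐ[volume.restrict (square L)] kernelRhs L g k) {ξ : ℝ} (hξ : ξ ∈ Icc 0 L)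
    {φ : ℝ → ℝ → ℂ} (hφ : ContDiff ℝ 1 (Function.uncurry φ)) (h0 : ∀ x ∈ Icc ξ L, φ x 0 = 0) :
    (∫ x in ξ..L, inner ℂ (toL2 L (transport φ x)) (k x)) - inner ℂ (toL2 L (φ ξ)) (k ξ)
      + (∫ x in ξ..L, U x * conj (φ x L))
      = ∫ x in Ioo ξ L, ∫ y in Ioo 0 L, q (x, y) * conj (φ x y) := by
  have hsub : Ioo ξ L ⊆ Ioo 0 L := Ioo_subset_Ioo_left hξ.1
  have hk' := hk.1.mono (Icc_subset_Icc_left hξ.1)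
  have hwc : Continuous fun x => toL2 L (transport φ x) := continuous_toL2 (continuous_transport hφ)
  have hφc : Continuous fun x => toL2 L (φ x) := continuous_toL2 hφ.continuous
  have i1 : IntegrableOn (fun x => inner ℂ (toL2 L (transport φ x)) (k x)) (Ioo ξ L) :=
    Continuous.integrableOn_inner hwc (hk'.integrableOn_Icc.mono_set Ioo_subset_Icc_self)
  have i2 : IntegrableOn (fun x => inner ℂ (toL2 L (φ x)) (kernelOp hg (k x))) (Ioo ξ L) :=
    Continuous.integrableOn_inner hφc (((kernelOp hg).continuous.comp_continuousOn
      hk').integrableOn_Icc.mono_set Ioo_subset_Icc_self)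
  have i3 : IntegrableOn (fun x => inner ℂ (toL2 L (φ x)) (source L g x)) (Ioo ξ L) :=
    Continuous.integrableOn_inner hφc
      (IntegrableOn.mono_set ((source_memLp hg).integrable one_le_two) hsub)
  have hw := ((isKernelSolution_iff hL hg).1 hk).2.2 ξ hξ φ hφ h0
  have hr : ∫ x in Ioo ξ L, ∫ y in Ioo 0 L, q (x, y) * conj (φ x y)
      = ∫ x in Ioo ξ L, (inner ℂ (toL2 L (φ x)) (source L g x)
          - inner ℂ (toL2 L (φ x)) (kernelOp hg (k x))) := by
    refine integral_congr_ae ?_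
    rw [volume_restrict_square] at hq
    filter_upwards [ae_restrict_of_ae_restrict_of_subset hsub (source_ae_memLp hg),
      ae_restrict_of_ae_restrict_of_subset hsub (Measure.ae_ae_of_ae_prod hq)] with x hx hqx
    rw [← integral_kernelRhs hL hg
      (Continuous.memLp_Ioo (ContDiff.continuous_slice hφ.continuous x)) hx]
    refine integral_congr_ae ?_
    filter_upwards [hqx] with y hy
    rw [hy]
  rw [hr, integral_sub i3 i2]
  rw [intervalIntegral_eq_Ioo hξ.2, integral_add i1 i2, intervalIntegral_eq_Ioo hξ.2 (fun x =>
    inner ℂ (toL2 L (φ x)) (source L g x))] at hw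
  rw [intervalIntegral_eq_Ioo hξ.2]
  linear_combination hw

end IntegroDiff

/-! ### Representation of the solution by integrals along the characteristics. -/

namespace IntegroDiff

open Filter Topology TopologicalSpace

variable {L : ℝ} {g : ℝ → ℝ → ℂ}

/-- `q` is a measurable version of the extension by zero of `f ∈ L²(Ω)`. -/
structure IsExtension (Ω : Set (ℝ × ℝ)) (f q : ℝ × ℝ → ℂ) : Prop where
  measurable : Measurable q
  memLp : MemLp q 2 volume
  integrable : Integrable q
  eq_zero : ∀ p, p ∉ Ω → q p = 0
  ae_eq : q =ᵐ[volume.restrict Ω] f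

theorem exists_isExtension {Ω : Set (ℝ × ℝ)} (hΩ : MeasurableSet Ω)
    [IsFiniteMeasure (volume.restrict Ω)] {f : ℝ × ℝ → ℂ} (hf : MemLp f 2 (volume.restrict Ω)) :
    ∃ q, IsExtension Ω f q := by
  have h1 : MemLp (hf.1.mk f) 2 (volume.restrict Ω) := hf.ae_eq hf.1.ae_eq_mk
  refine ⟨Ω.indicator (hf.1.mk f), hf.1.stronglyMeasurable_mk.measurable.indicator hΩ,
    (memLp_indicator_iff_restrict hΩ).2 h1, (integrable_indicator_iff hΩ).2
      (h1.integrable one_le_two), fun p hp => indicator_of_notMem hp _, ?_⟩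
  exact (indicator_ae_eq_restrict hΩ).trans hf.1.ae_eq_mk.symm

variable {q : ℝ × ℝ → ℂ}

theorem integrable_shear (hq : Integrable q) (A : Set ℝ) (ξ : ℝ) :
    Integrable (fun z : ℝ × ℝ => q (z.1, z.2 + (z.1 - ξ))) ((volume.restrict A).prod volume) := by
  have h1 : MeasurePreserving (fun z : ℝ × ℝ => (z.1, z.2 + (z.1 - ξ)))
      ((volume.restrict A).prod volume) ((volume.restrict A).prod volume) :=
    (MeasurePreserving.id _).skew_product (g := fun (x y : ℝ) => y + (x - ξ))
      (by fun_prop) (Eventually.of_forall fun s => map_add_right_eq_self _ _)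
  refine h1.integrable_comp_of_integrable ?_
  have : (volume.restrict A).prod (volume : Measure ℝ)
      = (volume : Measure (ℝ × ℝ)).restrict (A ×ˢ univ) := by
    rw [show (volume : Measure (ℝ × ℝ)) = volume.prod volume from rfl, ← Measure.prod_restrict,
      Measure.restrict_univ]
  rw [this]
  exact hq.restrict

theorem integral_shear (hq : Integrable q) (h0 : ∀ p, p ∉ square L → q p = 0) {χ : ℝ → ℂ}
    (hχ : IsTest (Ioo 0 L) χ) (ξ : ℝ) (A : Set ℝ) :
    ∫ x in A, ∫ y in Ioo 0 L, q (x, y) * χ (y - (x - ξ))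
      = ∫ y in Ioo 0 L, (∫ x in A, q (x, y + (x - ξ))) * χ y := by
  obtain ⟨C, hC⟩ := hχ.contDiff.continuous.bounded_above_of_compact_support hχ.compact
  have h1 : ∀ x, ∫ y in Ioo 0 L, q (x, y) * χ (y - (x - ξ))
      = ∫ y, q (x, y + (x - ξ)) * χ y := fun x => by
    rw [setIntegral_eq_integral_of_forall_compl_eq_zero fun y hy => by
      rw [h0 _ fun h => hy h.2, zero_mul],
      ← integral_add_right_eq_self (fun y => q (x, y) * χ (y - (x - ξ))) (x - ξ)]
    simp only [add_sub_cancel_right]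
  have h2 : Integrable (Function.uncurry fun x y => q (x, y + (x - ξ)) * χ y)
      ((volume.restrict A).prod volume) :=
    (integrable_shear hq A ξ).mul_bdd (c := C)
      (hχ.contDiff.continuous.comp continuous_snd).aestronglyMeasurable
      (Eventually.of_forall fun z => hC _)
  simp_rw [h1]
  rw [integral_integral_swap h2]
  simp_rw [integral_mul_const]
  rw [setIntegral_eq_integral_of_forall_compl_eq_zero fun y hy => by
    rw [hχ.eq_zero hy, mul_zero]]

/-- The method of characteristics. The characteristic through `(ξ,y)` meets `y = L` at `x = L + ξ -
y`, which precedes `x = L` exactly when `y > ξ`; only then does `U` enter. The identity is obtained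
against test functions constant along the characteristics and then localized in `y`. -/
theorem IsKernelSolution.ae_eq (hL : 0 ≤ L)
    (hg : MemLp (Function.uncurry g) 2 (volume.restrict (square L))) {U : L2 L} {k : ℝ → L2 L}
    (hk : IsKernelSolution L g U k) (hq : IsExtension (square L) (kernelRhs L g k) q)
    {ξ : ℝ} (hξ : ξ ∈ Icc 0 L) :
    k ξ =ᵐ[volume.restrict (Ioo 0 L)] fun y =>
      (Ioi ξ).indicator (fun y => U (L + ξ - y)) y - ∫ x in Ioo ξ L, q (x, y + (x - ξ)) := by
  set K : ℝ → ℂ := fun y =>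
      (Ioi ξ).indicator (fun y => U (L + ξ - y)) y - ∫ x in Ioo ξ L, q (x, y + (x - ξ)) with hK
  have hinter : Ioo 0 L ∩ Ioi ξ = Ioo ξ L := by
    ext y; simp only [mem_inter_iff, mem_Ioo, mem_Ioi]
    exact ⟨fun h => ⟨h.2, h.1.2⟩, fun h => ⟨⟨hξ.1.trans_lt h.1, h.2⟩, h.1⟩⟩
  have hUi : IntegrableOn (U : ℝ → ℂ) (Ioo ξ L) :=
    IntegrableOn.mono_set ((Lp.memLp U).integrable one_le_two) (Ioo_subset_Ioo_left hξ.1)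
  have hUr : IntegrableOn (fun y => U (L + ξ - y)) (Ioo ξ L) := by
    have h1 : IntervalIntegrable (U : ℝ → ℂ) volume ξ L :=
      (intervalIntegrable_iff_integrableOn_Ioo_of_le hξ.2).2 hUi
    have h2 := (h1.comp_sub_left (L + ξ)).symm
    rw [add_sub_cancel_right, add_sub_cancel_left] at h2
    exact (intervalIntegrable_iff_integrableOn_Ioo_of_le hξ.2).1 h2
  have hUind : IntegrableOn ((Ioi ξ).indicator fun y => U (L + ξ - y)) (Ioo 0 L) := by
    rw [IntegrableOn, integrable_indicator_iff measurableSet_Ioi, IntegrableOn,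
      Measure.restrict_restrict measurableSet_Ioi, inter_comm, hinter]
    exact hUr
  have hI2 : IntegrableOn (fun y => ∫ x in Ioo ξ L, q (x, y + (x - ξ))) (Ioo 0 L) :=
    (integrable_shear hq.integrable (Ioo ξ L) ξ).integral_prod_right.restrict
  have hKi : IntegrableOn K (Ioo 0 L) := hUind.sub hI2
  have hki : IntegrableOn (k ξ : ℝ → ℂ) (Ioo 0 L) := (Lp.memLp (k ξ)).integrable one_le_two
  have key : ∀ η : ℝ → ℝ, ContDiff ℝ ∞ η → HasCompactSupport η → tsupport η ⊆ Ioo 0 L →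
      ∫ y, η y • (k ξ y - K y) = 0 := by
    intro η e1 e2 e3
    have hχ := IsTest.ofReal e1 e2 e3
    set χ : ℝ → ℂ := fun y => (η y : ℂ) with hχd
    obtain ⟨C, hC⟩ := hχ.contDiff.continuous.bounded_above_of_compact_support hχ.compact
    have hcj : ∀ y, conj (χ y) = χ y := fun y => Complex.conj_ofReal _
    have hφ : ContDiff ℝ 1 (Function.uncurry fun x y : ℝ => χ (y - (x - ξ))) :=
      (hχ.contDiff.of_le (by simp)).comp (by fun_prop)
    have hw := hk.weak_form hL hg hq.ae_eq hξ hφ fun x hx =>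
      hχ.eq_zero fun h' => by linarith [h'.1, hx.1]
    have t0 : toL2 L 0 = 0 := by
      rw [Lp.eq_zero_iff_ae_eq_zero]; exact toL2_coeFn MemLp.zero
    rw [transport_translate hχ.contDiff] at hw
    simp only [Pi.zero_apply, t0, inner_zero_left, intervalIntegral.integral_zero, sub_self,
      sub_zero, hcj] at hw
    rw [integral_shear hq.integrable hq.eq_zero hχ, inner_toL2 hL hχ.memLp,
      intervalIntegral_eq_Ioo hL] at hw
    simp only [hcj] at hw
    have hUe : ∫ x in ξ..L, U x * χ (L - (x - ξ))
        = ∫ y in Ioo 0 L, (Ioi ξ).indicator (fun y => U (L + ξ - y)) y * χ y := by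
      have h1 := intervalIntegral.integral_comp_sub_left (a := ξ) (b := L)
        (fun x => U x * χ (L - (x - ξ))) (L + ξ)
      rw [add_sub_cancel_right, add_sub_cancel_left] at h1
      rw [← h1, intervalIntegral_eq_Ioo hξ.2, ← hinter, ← setIntegral_indicator measurableSet_Ioi]
      refine integral_congr_ae (Eventually.of_forall fun y => ?_)
      have h2 : L - (L + ξ - y - ξ) = y := by ring
      simp only [indicator, h2]
      split_ifs <;> simp
    have b1 : IntegrableOn (fun y => (Ioi ξ).indicator (fun y => U (L + ξ - y)) y * χ y) (Ioo 0 L) :=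
      hUind.mul_bdd (c := C) hχ.contDiff.continuous.aestronglyMeasurable
        (Eventually.of_forall fun z => hC _)
    have b2 : IntegrableOn (fun y => (∫ x in Ioo ξ L, q (x, y + (x - ξ))) * χ y) (Ioo 0 L) :=
      hI2.mul_bdd (c := C) hχ.contDiff.continuous.aestronglyMeasurable
        (Eventually.of_forall fun z => hC _)
    have b3 : IntegrableOn (fun y => k ξ y * χ y) (Ioo 0 L) :=
      hki.mul_bdd (c := C) hχ.contDiff.continuous.aestronglyMeasurable
        (Eventually.of_forall fun z => hC _)
    have hs : ∫ y, η y • (k ξ y - K y) = ∫ y in Ioo 0 L, (k ξ y * χ y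
        - ((Ioi ξ).indicator (fun y => U (L + ξ - y)) y * χ y
          - (∫ x in Ioo ξ L, q (x, y + (x - ξ))) * χ y)) := by
      rw [← setIntegral_eq_integral_of_forall_compl_eq_zero (s := Ioo 0 L) fun y hy => by
        rw [image_eq_zero_of_notMem_tsupport fun h => hy (e3 h), zero_smul]]
      refine integral_congr_ae (Eventually.of_forall fun y => ?_)
      simp only [hK, hχd, Complex.real_smul]
      ring
    have b12 : IntegrableOn (fun y => (Ioi ξ).indicator (fun y => U (L + ξ - y)) y * χ y
        - (∫ x in Ioo ξ L, q (x, y + (x - ξ))) * χ y) (Ioo 0 L) := b1.sub b2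
    rw [hs, integral_sub b3 b12, integral_sub b1 b2, ← hUe]
    linear_combination -hw
  have h0 := isOpen_Ioo.ae_eq_zero_of_integral_contDiff_smul_eq_zero
    (hki.sub hKi).locallyIntegrableOn key
  rw [EventuallyEq, ae_restrict_iff' measurableSet_Ioo]
  filter_upwards [h0] with y hy hyI
  exact sub_eq_zero.1 (hy hyI)

/-- The boundary value is determined by the right-hand side if the solution vanishes at `x = 0`. -/
theorem IsKernelSolution.boundary_ae_eq (hL : 0 ≤ L)
    (hg : MemLp (Function.uncurry g) 2 (volume.restrict (square L))) {U : L2 L} {k : ℝ → L2 L}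
    (hk : IsKernelSolution L g U k) (hk0 : k 0 = 0)
    (hq : IsExtension (square L) (kernelRhs L g k) q) :
    ∀ᵐ t, t ∈ Ioo 0 L → U (L - t) = ∫ x in Ioo 0 L, q (x, t + x) := by
  have h1 := hk.ae_eq hL hg hq (ξ := 0) ⟨le_rfl, hL⟩
  rw [← ae_restrict_iff' measurableSet_Ioo]
  filter_upwards [h1, ae_restrict_mem measurableSet_Ioo,
    Lp.coeFn_zero ℂ 2 (volume.restrict (Ioo 0 L))] with t ht htm ht0
  rw [hk0, ht0, indicator_of_mem (mem_Ioi.2 htm.1)] at ht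
  simp only [add_zero, sub_zero, Pi.zero_apply] at ht
  exact (sub_eq_zero.1 ht.symm)

/-- The solution of the kernel equation that vanishes at `x = 0` and `x = L` in terms of the
right-hand side of the equation. -/
noncomputable def kernelFormula (L : ℝ) (q : ℝ × ℝ → ℂ) (p : ℝ × ℝ) : ℂ :=
  if p.2 < p.1 then -lineIntegral L (1, 1) q p else lineIntegral L (-1, -1) q p

/-- Above the diagonal, `U` at the exit point is the integral of `q` over the whole characteristic;
subtracting the part beyond `ξ` leaves the part before `ξ`. Below the diagonal there is no boundary
term. The extension of `q` by zero makes the length of the line integrals irrelevant. -/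
theorem IsKernelSolution.ae_eq_kernelFormula (hL : 0 ≤ L)
    (hg : MemLp (Function.uncurry g) 2 (volume.restrict (square L))) {U : L2 L} {k : ℝ → L2 L}
    (hk : IsKernelSolution L g U k) (hk0 : k 0 = 0)
    (hq : IsExtension (square L) (kernelRhs L g k) q) {ξ : ℝ} (hξ : ξ ∈ Icc 0 L) :
    k ξ =ᵐ[volume.restrict (Ioo 0 L)] fun y => kernelFormula L q (ξ, y) := by
  have hb : ∀ᵐ y, y - ξ ∈ Ioo 0 L → U (L - (y - ξ)) = ∫ x in Ioo 0 L, q (x, (y - ξ) + x) :=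
    (measurePreserving_sub_right volume ξ).quasiMeasurePreserving.ae (hk.boundary_ae_eq hL hg hk0 hq)
  have hint : ∀ᵐ y, IntegrableOn (fun x => q (x, y + (x - ξ))) (Ioo 0 L) :=
    (integrable_shear hq.integrable (Ioo 0 L) ξ).prod_left_ae
  filter_upwards [hk.ae_eq hL hg hq hξ, ae_restrict_of_ae hb, ae_restrict_of_ae hint,
    ae_restrict_mem measurableSet_Ioo, ae_restrict_of_ae (Measure.ae_ne volume ξ)]
    with y hy hbd hi hym hne
  rw [hy]
  have hz : ∀ x, x ∉ Ioo 0 L → q (x, y + (x - ξ)) = 0 := fun x hx =>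
    hq.eq_zero _ fun h => hx h.1
  have hs1 : lineIntegral L (1, 1) q (ξ, y) = ∫ x in Ioo ξ L, q (x, y + (x - ξ)) := by
    have h1 : lineIntegral L (1, 1) q (ξ, y) = ∫ s in (0 : ℝ)..L, q (ξ + s, y + (ξ + s - ξ)) := by
      rw [intervalIntegral_eq_Ioo hL, lineIntegral]
      simp
    rw [h1, intervalIntegral.integral_comp_add_left (fun x => q (x, y + (x - ξ))) ξ, add_zero,
      intervalIntegral_eq_Ioo (by linarith)]
    exact setIntegral_eq_of_subset_of_forall_sdiff_eq_zero measurableSet_Ioo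
      (Ioo_subset_Ioo_right (by linarith [hξ.1])) fun x hx => hz x fun h => hx.2 ⟨hx.1.1, h.2⟩
  have hs2 : lineIntegral L (-1, -1) q (ξ, y) = ∫ x in Ioo 0 ξ, q (x, y + (x - ξ)) := by
    have h1 : lineIntegral L (-1, -1) q (ξ, y) = ∫ s in (0 : ℝ)..L, q (ξ - s, y + (ξ - s - ξ)) := by
      rw [intervalIntegral_eq_Ioo hL, lineIntegral]
      refine integral_congr_ae (Eventually.of_forall fun s => ?_)
      simp only [Prod.smul_mk, smul_eq_mul, Prod.mk_add_mk]
      congr 2 <;> ring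
    rw [h1, intervalIntegral.integral_comp_sub_left (fun x => q (x, y + (x - ξ))) ξ, sub_zero,
      intervalIntegral_eq_Ioo (by linarith)]
    exact setIntegral_eq_of_subset_of_forall_sdiff_eq_zero measurableSet_Ioo
      (Ioo_subset_Ioo_left (by linarith [hξ.2])) fun x hx => hz x fun h => hx.2 ⟨h.1, hx.1.2⟩
  rw [kernelFormula]
  simp only
  rcases lt_or_gt_of_ne hne with h | h
  · rw [if_pos h, hs1, indicator_of_notMem (by simpa using h.le), zero_sub]
  · rw [if_neg h.not_gt, hs2, indicator_of_mem (mem_Ioi.2 h)]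
    have e1 : U (L + ξ - y) = ∫ x in Ioo 0 L, q (x, y + (x - ξ)) := by
      have := hbd ⟨by linarith, by linarith [hym.2, hξ.1]⟩
      rw [show L + ξ - y = L - (y - ξ) by ring, this]
      refine integral_congr_ae (Eventually.of_forall fun x => ?_)
      simp only
      congr 2; ring
    have hI : IntervalIntegrable (fun x => q (x, y + (x - ξ))) volume 0 L :=
      (intervalIntegrable_iff_integrableOn_Ioo_of_le hL).2 hi
    have hadd := intervalIntegral.integral_add_adjacent_intervals
      (hI.mono_set (c := 0) (d := ξ) (by rw [uIcc_of_le hξ.1, uIcc_of_le hL]; exact Icc_subset_Icc_right hξ.2))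
      (hI.mono_set (c := ξ) (d := L) (by rw [uIcc_of_le hξ.2, uIcc_of_le hL]; exact Icc_subset_Icc_left hξ.1))
    rw [intervalIntegral_eq_Ioo hξ.1, intervalIntegral_eq_Ioo hξ.2, intervalIntegral_eq_Ioo hL] at hadd
    rw [e1, ← hadd, add_sub_cancel_right]

end IntegroDiff

/-! ### Pairings with continuous functions, and functions glued along the diagonal. -/

namespace IntegroDiff

open Filter Topology TopologicalSpace

variable {L : ℝ} {g : ℝ → ℝ → ℂ}

section Pairing

variable {Ω : Set (ℝ × ℝ)} {f F φ : ℝ × ℝ → ℂ}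

theorem integrableOn_mul_continuous (hΩ : MeasurableSet Ω) (hs : Ω ⊆ square L)
    [IsFiniteMeasure (volume.restrict Ω)] (hf : MemLp f 2 (volume.restrict Ω))
    (hφ : Continuous φ) : IntegrableOn (fun p => f p * φ p) Ω := by
  obtain ⟨C, hC⟩ := (isBounded_square (L := L)).isCompact_closure.exists_bound_of_continuousOn
    hφ.continuousOn
  exact (hf.integrable one_le_two).mul_bdd (c := C) hφ.aestronglyMeasurable
    ((ae_restrict_iff' hΩ).2 (Eventually.of_forall fun p hp => hC p (subset_closure (hs hp))))

theorem memLp_mul_continuous (hΩ : MeasurableSet Ω) (hs : Ω ⊆ square L)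
    (hf : MemLp f 2 (volume.restrict Ω))
    (hφ : Continuous φ) : MemLp (fun p => f p * φ p) 2 (volume.restrict Ω) := by
  obtain ⟨C, hC⟩ := (isBounded_square (L := L)).isCompact_closure.exists_bound_of_continuousOn
    hφ.continuousOn
  refine (hf.norm.const_mul C).mono' (hf.1.mul hφ.aestronglyMeasurable)
    ((ae_restrict_iff' hΩ).2 (Eventually.of_forall fun p hp => ?_))
  rw [norm_mul, mul_comm]
  exact mul_le_mul_of_nonneg_right (hC p (subset_closure (hs hp))) (norm_nonneg _)

theorem continuous_fderiv_apply (hφ : ContDiff ℝ ∞ φ) (v : ℝ × ℝ) :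
    Continuous fun p => fderiv ℝ φ p v :=
  (hφ.continuous_fderiv (by simp)).clm_apply continuous_const

/-- Expansion of an integration by parts with the test function `l φ - b - c`. -/
theorem integral_mul_fderiv_of_sub (hΩ : MeasurableSet Ω) (hs : Ω ⊆ square L)
    [IsFiniteMeasure (volume.restrict Ω)] (hf : MemLp f 2 (volume.restrict Ω))
    (hF : MemLp F 2 (volume.restrict Ω)) {v : ℝ × ℝ} {b c : ℝ × ℝ → ℂ} (l : ℂ)
    (hφ : ContDiff ℝ ∞ φ) (hb : ContDiff ℝ ∞ b) (hc : ContDiff ℝ ∞ c)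
    (h : ∫ p in Ω, f p * fderiv ℝ (fun p => l * φ p - b p - c p) p v
      = -∫ p in Ω, F p * (l * φ p - b p - c p)) :
    l * ∫ p in Ω, f p * fderiv ℝ φ p v = -(l * ∫ p in Ω, F p * φ p)
      + (∫ p in Ω, f p * fderiv ℝ b p v) + (∫ p in Ω, F p * b p)
      + (∫ p in Ω, f p * fderiv ℝ c p v) + ∫ p in Ω, F p * c p := by
  have key : ∀ {f φ b c : ℝ × ℝ → ℂ}, MemLp f 2 (volume.restrict Ω) → Continuous φ →
      Continuous b → Continuous c → ∫ p in Ω, f p * (l * φ p - b p - c p)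
        = l * (∫ p in Ω, f p * φ p) - (∫ p in Ω, f p * b p) - ∫ p in Ω, f p * c p := by
    intro f φ b c hf hφ hb hc
    have i1 := (integrableOn_mul_continuous hΩ hs hf hφ).const_mul l
    have i2 := integrableOn_mul_continuous hΩ hs hf hb
    have i3 := integrableOn_mul_continuous hΩ hs hf hc
    have i12 : IntegrableOn (fun p => l * (f p * φ p) - f p * b p) Ω := i1.sub i2
    rw [← integral_const_mul, ← integral_sub i1 i2, ← integral_sub i12 i3]
    refine integral_congr_ae (Eventually.of_forall fun p => ?_)
    simp only
    ring
  have hd : ∀ p, fderiv ℝ (fun p => l * φ p - b p - c p) p v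
      = l * fderiv ℝ φ p v - fderiv ℝ b p v - fderiv ℝ c p v := fun p => by
    have d1 := (hφ.differentiable (by simp) p).hasFDerivAt.const_mul l
    have d2 := (hb.differentiable (by simp) p).hasFDerivAt
    have d3 := (hc.differentiable (by simp) p).hasFDerivAt
    have d : HasFDerivAt (fun p => l * φ p - b p - c p)
        (l • fderiv ℝ φ p - fderiv ℝ b p - fderiv ℝ c p) p := (d1.sub d2).sub d3
    rw [d.fderiv]
    simp
  simp_rw [hd] at h
  rw [key hf (continuous_fderiv_apply hφ v) (continuous_fderiv_apply hb v)
    (continuous_fderiv_apply hc v), key hF hφ.continuous hb.continuous hc.continuous] at h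
  linear_combination h

theorem fderiv_mul_fst_snd {a b : ℝ → ℂ} (ha : ContDiff ℝ ∞ a) (hb : ContDiff ℝ ∞ b) (p v : ℝ × ℝ) :
    fderiv ℝ (fun p : ℝ × ℝ => a p.1 * b p.2) p v
      = deriv a p.1 * v.1 * b p.2 + a p.1 * (deriv b p.2 * v.2) := by
  have h1 := ((ha.differentiable (by simp) p.1).hasDerivAt.hasFDerivAt).comp p
      (hasFDerivAt_fst (𝕜 := ℝ) (E := ℝ) (F := ℝ))
  have h2 := ((hb.differentiable (by simp) p.2).hasDerivAt.hasFDerivAt).comp p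
      (hasFDerivAt_snd (𝕜 := ℝ) (E := ℝ) (F := ℝ))
  rw [show (fun p : ℝ × ℝ => a p.1 * b p.2) = (a ∘ Prod.fst) * (b ∘ Prod.snd) from rfl,
    (h1.mul h2).fderiv]
  simp
  ring

theorem contDiff_mul_fst_snd {a b : ℝ → ℂ} (ha : ContDiff ℝ ∞ a) (hb : ContDiff ℝ ∞ b) :
    ContDiff ℝ ∞ fun p : ℝ × ℝ => a p.1 * b p.2 :=
  (ha.comp contDiff_fst).mul (hb.comp contDiff_snd)

end Pairing

section Glue

variable {A B φ : ℝ × ℝ → ℂ}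

/-- The function equal to `A` below the diagonal and to `B` above it. -/
noncomputable def glue (A B : ℝ × ℝ → ℂ) (p : ℝ × ℝ) : ℂ := if p.2 < p.1 then A p else B p

theorem glue_ae_eq_minus : glue A B =ᵐ[volume.restrict (triMinus L)] A := by
  filter_upwards [ae_restrict_mem isOpen_triMinus.measurableSet] with p hp
  exact if_pos hp.2

theorem glue_ae_eq_plus : glue A B =ᵐ[volume.restrict (triPlus L)] B := by
  filter_upwards [ae_restrict_mem isOpen_triPlus.measurableSet] with p hp
  exact if_neg hp.2.not_gt

theorem memLp_square {f : ℝ × ℝ → ℂ} (h1 : MemLp f 2 (volume.restrict (triMinus L)))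
    (h2 : MemLp f 2 (volume.restrict (triPlus L))) : MemLp f 2 (volume.restrict (square L)) := by
  have hm : AEStronglyMeasurable f (volume.restrict (square L)) := by
    rw [← Measure.restrict_congr_set triUnion_ae_eq]
    exact aestronglyMeasurable_union_iff.2 ⟨h1.1, h2.1⟩
  rw [memLp_two_iff_lintegral hm, ← Measure.restrict_congr_set triUnion_ae_eq]
  exact (lintegral_union_le _ _ _).trans_lt (ENNReal.add_lt_top.2
    ⟨(memLp_two_iff_lintegral h1.1).1 h1, (memLp_two_iff_lintegral h2.1).1 h2⟩)

theorem memLp_glue (hA : MemLp A 2 (volume.restrict (triMinus L)))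
    (hB : MemLp B 2 (volume.restrict (triPlus L))) :
    MemLp (glue A B) 2 (volume.restrict (square L)) :=
  memLp_square (hA.ae_eq glue_ae_eq_minus.symm) (hB.ae_eq glue_ae_eq_plus.symm)

theorem integral_glue_mul (hA : MemLp A 2 (volume.restrict (triMinus L)))
    (hB : MemLp B 2 (volume.restrict (triPlus L))) (hφ : Continuous φ) :
    ∫ p in square L, glue A B p * φ p
      = (∫ p in triMinus L, A p * φ p) + ∫ p in triPlus L, B p * φ p := by
  rw [integral_square_eq_add (integrableOn_mul_continuous isOpen_square.measurableSet
    Subset.rfl (memLp_glue hA hB) hφ)]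
  congr 1
  · refine integral_congr_ae ?_
    filter_upwards [glue_ae_eq_minus (A := A) (B := B)] with p hp
    rw [hp]
  · refine integral_congr_ae ?_
    filter_upwards [glue_ae_eq_plus (A := A) (B := B)] with p hp
    rw [hp]

end Glue

/-- The partial integral is the inner product of the slice with the constant one, and the slices
form an `L²` function with values in `L2 L`. -/
theorem memLp_integral_snd {R : ℝ × ℝ → ℂ} (hR : MemLp R 2 (volume.restrict (square L))) :
    MemLp (fun x => ∫ y in Ioo 0 L, R (x, y)) 2 (volume.restrict (Ioo 0 L)) := by
  have h1 := (memLp_toL2_slice hR).const_inner (𝕜 := ℂ) (toL2 L fun _ => 1)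
  refine h1.ae_eq ?_
  rw [volume_restrict_square] at hR
  filter_upwards [MemLp.slice_ae hR] with x hx
  have h2 : MemLp (fun _ : ℝ => (1 : ℂ)) 2 (volume.restrict (Ioo 0 L)) := memLp_const 1
  rw [L2.inner_def]
  refine integral_congr_ae ?_
  filter_upwards [toL2_coeFn hx, toL2_coeFn h2] with y h3 h4
  rw [h3, h4]
  simp

theorem memLp_swap {R : ℝ × ℝ → ℂ} (hR : MemLp R 2 (volume.restrict (square L))) :
    MemLp (fun p => R p.swap) 2 (volume.restrict (square L)) := by
  rw [volume_restrict_square] at hR ⊢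
  exact hR.comp_measurePreserving Measure.measurePreserving_swap

theorem memLp_integral_fst {R : ℝ × ℝ → ℂ} (hR : MemLp R 2 (volume.restrict (square L))) :
    MemLp (fun y => ∫ x in Ioo 0 L, R (x, y)) 2 (volume.restrict (Ioo 0 L)) :=
  memLp_integral_snd (memLp_swap hR)

theorem integral_mul_fst {R : ℝ × ℝ → ℂ} (hR : MemLp R 2 (volume.restrict (square L))) {c : ℝ → ℂ}
    (hc : Continuous c) : ∫ p in square L, R p * c p.1
      = ∫ x in Ioo 0 L, (∫ y in Ioo 0 L, R (x, y)) * c x := by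
  have h := integrableOn_mul_continuous isOpen_square.measurableSet Subset.rfl hR
    (hc.comp continuous_fst)
  rw [IntegrableOn, volume_restrict_square] at h
  rw [volume_restrict_square]
  refine (integral_prod _ h).trans ?_
  simp_rw [Function.comp, integral_mul_const]

theorem integral_mul_snd {R : ℝ × ℝ → ℂ} (hR : MemLp R 2 (volume.restrict (square L))) {c : ℝ → ℂ}
    (hc : Continuous c) : ∫ p in square L, R p * c p.2
      = ∫ y in Ioo 0 L, (∫ x in Ioo 0 L, R (x, y)) * c y := by
  have h := integrableOn_mul_continuous isOpen_square.measurableSet Subset.rfl hR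
    (hc.comp continuous_snd)
  rw [IntegrableOn, volume_restrict_square] at h
  rw [volume_restrict_square]
  refine (integral_prod_symm _ h).trans ?_
  simp_rw [Function.comp, integral_mul_const]

end IntegroDiff

/-! ### The jump of a piecewise `H¹` function across the diagonal. -/

namespace IntegroDiff

open Filter Topology TopologicalSpace

variable {L : ℝ} {g : ℝ → ℝ → ℂ}

section Trace

variable {f F D : ℝ × ℝ → ℂ} {ζ β : ℝ → ℂ}

theorem contDiff_coe : ContDiff ℝ ∞ fun x : ℝ => (x : ℂ) := Complex.ofRealCLM.contDiff

theorem deriv_coe (x : ℝ) : deriv (fun x : ℝ => (x : ℂ)) x = 1 :=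
  Complex.ofRealCLM.hasDerivAt.deriv

theorem contDiff_const_sub_coe (l : ℂ) : ContDiff ℝ ∞ fun x : ℝ => l - (x : ℂ) :=
  contDiff_const.sub contDiff_coe

theorem deriv_const_sub_coe (l : ℂ) (x : ℝ) : deriv (fun x : ℝ => l - (x : ℂ)) x = -1 := by
  rw [deriv_const_sub, deriv_coe]

/-- The jump of `f` across the diagonal: contribution of the upper triangle. -/
theorem trace_triPlus (hf : MemLp f 2 (volume.restrict (triPlus L)))
    (hF : MemLp F 2 (volume.restrict (triPlus L))) (hD : MemLp D 2 (volume.restrict (triPlus L)))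
    (h1 : HasWeakDeriv (triPlus L) (1, 0) f F) (h2 : HasWeakDeriv (triPlus L) (1, 1) f D)
    (hζ : IsTest (Ioo 0 L) ζ) (hβ : IsTest (Ioo 0 L) β) :
    L * ∫ p in triPlus L, f p * (deriv ζ p.1 * β p.2)
      = -(L * ∫ p in triPlus L, F p * (ζ p.1 * β p.2))
        + (∫ p in triPlus L, (F p * p.1 + f p) * (ζ p.2 * β p.2))
        + ∫ p in triPlus L, (F p * (L - p.2) - D p * (L - p.2) + f p) * (ζ p.1 * β p.1) := by
  have hm := (isOpen_triPlus (L := L)).measurableSet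
  have hi := fun {f φ : ℝ × ℝ → ℂ} => integrableOn_mul_continuous (f := f) (φ := φ) hm triPlus_subset
  set c : ℝ → ℂ := fun s => ζ s * β s with hcd
  have hc : ContDiff ℝ ∞ c := hζ.contDiff.mul hβ.contDiff
  have c0 : c 0 = 0 := by rw [hcd]; simp only; rw [hζ.eq_zero fun h => lt_irrefl _ h.1, zero_mul]
  have ζ0 : ζ 0 = 0 := hζ.eq_zero fun h => lt_irrefl _ h.1
  have hc1 : Continuous fun p : ℝ × ℝ => c p.1 := hc.continuous.comp continuous_fst
  have hc2 : Continuous fun p : ℝ × ℝ => c p.2 := hc.continuous.comp continuous_snd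
  have hl : Continuous fun p : ℝ × ℝ => (L : ℂ) - p.2 := by fun_prop
  have hx : Continuous fun p : ℝ × ℝ => (p.1 : ℂ) := by fun_prop
  have s1 := contDiff_mul_fst_snd hζ.contDiff hβ.contDiff
  have s2 := contDiff_mul_fst_snd contDiff_coe hc
  have s3 := contDiff_mul_fst_snd hc (contDiff_const_sub_coe L)
  -- The test function `L ζ(x) β(y) - x c(y) - (L - y) c(x)` vanishes on the diagonal, where `x + (L
  -- - y) = L`, and on `x = 0`. Two polynomial weights replace a division by the distance from a
  -- side to the diagonal, which would be singular at a corner.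
  have e1 := integral_mul_fderiv_of_sub hm triPlus_subset hf hF (L : ℂ) s1 s2 s3
    (h1.integral_triPlus hf hF (((contDiff_const.mul s1).sub s2).sub s3)
      (fun _ y => by simp [c0, ζ0]) (fun h => by simp at h)
      (fun _ x => by simp only [hcd]; ring))
  -- The derivative of `c` left in `e1` is removed by integrating by parts along `(1,1)`. This
  -- direction is parallel to the diagonal, so no new trace appears.
  have e2 := h2.integral_triPlus hf hD s3 (fun _ y => by simp [c0]) (fun _ x => by simp)
    (fun h => by simp at h)
  simp only [fderiv_mul_fst_snd hζ.contDiff hβ.contDiff, fderiv_mul_fst_snd contDiff_coe hc,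
    fderiv_mul_fst_snd hc (contDiff_const_sub_coe L), deriv_coe, deriv_const_sub_coe,
    Complex.ofReal_zero, Complex.ofReal_one, mul_zero, add_zero, mul_one, one_mul] at e1 e2
  have hc' : Continuous fun p : ℝ × ℝ => deriv c p.1 * ((L : ℂ) - p.2) :=
    ((hc.continuous_deriv (by simp)).comp continuous_fst).mul hl
  have i1 : ∫ p in triPlus L, f p * (deriv c p.1 * ((L : ℂ) - p.2) + c p.1 * (-1))
      = (∫ p in triPlus L, f p * (deriv c p.1 * ((L : ℂ) - p.2))) - ∫ p in triPlus L, f p * c p.1 := by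
    rw [← integral_sub (hi hf hc') (hi hf hc1)]
    congr 1; ext p; ring
  have i2 : ∫ p in triPlus L, (F p * p.1 + f p) * c p.2
      = (∫ p in triPlus L, F p * (p.1 * c p.2)) + ∫ p in triPlus L, f p * c p.2 := by
    have hxc : Continuous fun p : ℝ × ℝ => p.1 * c p.2 := hx.mul hc2
    rw [← integral_add (hi hF hxc) (hi hf hc2)]
    congr 1; ext p; ring
  have hcl : Continuous fun p : ℝ × ℝ => c p.1 * (L - p.2) := hc1.mul hl
  have j1 := hi hF hcl
  have j2 := hi hD hcl
  have j12 : IntegrableOn (fun p => F p * (c p.1 * (L - p.2)) - D p * (c p.1 * (L - p.2))) (triPlus L) :=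
    j1.sub j2
  have i3 : ∫ p in triPlus L, (F p * (L - p.2) - D p * (L - p.2) + f p) * c p.1
      = (∫ p in triPlus L, F p * (c p.1 * (L - p.2))) - (∫ p in triPlus L, D p * (c p.1 * (L - p.2)))
        + ∫ p in triPlus L, f p * c p.1 := by
    rw [← integral_sub j1 j2, ← integral_add j12 (hi hf hc1)]
    congr 1; ext p; ring
  rw [i1] at e2
  rw [i2, i3]
  linear_combination e1 + e2

/-- The jump of `f` across the diagonal: contribution of the lower triangle. -/
theorem trace_triMinus (hf : MemLp f 2 (volume.restrict (triMinus L)))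
    (hF : MemLp F 2 (volume.restrict (triMinus L))) (hD : MemLp D 2 (volume.restrict (triMinus L)))
    (h1 : HasWeakDeriv (triMinus L) (1, 0) f F) (h2 : HasWeakDeriv (triMinus L) (1, 1) f D)
    (hζ : IsTest (Ioo 0 L) ζ) (hβ : IsTest (Ioo 0 L) β) :
    L * ∫ p in triMinus L, f p * (deriv ζ p.1 * β p.2)
      = -(L * ∫ p in triMinus L, F p * (ζ p.1 * β p.2))
        + (∫ p in triMinus L, (F p * (L - p.1) - f p) * (ζ p.2 * β p.2))
        + ∫ p in triMinus L, (F p * p.2 - D p * p.2 - f p) * (ζ p.1 * β p.1) := by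
  have hm := (isOpen_triMinus (L := L)).measurableSet
  have hi := fun {f φ : ℝ × ℝ → ℂ} => integrableOn_mul_continuous (f := f) (φ := φ) hm triMinus_subset
  set c : ℝ → ℂ := fun s => ζ s * β s with hcd
  have hc : ContDiff ℝ ∞ c := hζ.contDiff.mul hβ.contDiff
  have ζL : ζ L = 0 := hζ.eq_zero fun h => lt_irrefl _ h.2
  have cL : c L = 0 := by rw [hcd]; simp only; rw [ζL, zero_mul]
  have hc1 : Continuous fun p : ℝ × ℝ => c p.1 := hc.continuous.comp continuous_fst
  have hc2 : Continuous fun p : ℝ × ℝ => c p.2 := hc.continuous.comp continuous_snd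
  have hl : Continuous fun p : ℝ × ℝ => (L : ℂ) - p.1 := by fun_prop
  have hx : Continuous fun p : ℝ × ℝ => (p.2 : ℂ) := by fun_prop
  have s1 := contDiff_mul_fst_snd hζ.contDiff hβ.contDiff
  have s2 := contDiff_mul_fst_snd (contDiff_const_sub_coe L) hc
  have s3 := contDiff_mul_fst_snd hc contDiff_coe
  -- Here the weights are `L - x` and `y`, which again add up to `L` on the diagonal.
  have e1 := integral_mul_fderiv_of_sub hm triMinus_subset hf hF (L : ℂ) s1 s2 s3
    (h1.integral_triMinus hf hF (((contDiff_const.mul s1).sub s2).sub s3)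
      (fun _ y => by simp [cL, ζL]) (fun h => by simp at h)
      (fun _ x => by simp only [hcd]; ring))
  have e2 := h2.integral_triMinus hf hD s3 (fun _ y => by simp [cL]) (fun _ x => by simp)
    (fun h => by simp at h)
  simp only [fderiv_mul_fst_snd hζ.contDiff hβ.contDiff,
    fderiv_mul_fst_snd (contDiff_const_sub_coe L) hc,
    fderiv_mul_fst_snd hc contDiff_coe, deriv_coe, deriv_const_sub_coe,
    Complex.ofReal_zero, Complex.ofReal_one, mul_zero, add_zero, mul_one] at e1 e2
  have hc' : Continuous fun p : ℝ × ℝ => deriv c p.1 * (p.2 : ℂ) :=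
    ((hc.continuous_deriv (by simp)).comp continuous_fst).mul hx
  have i1 : ∫ p in triMinus L, f p * (deriv c p.1 * (p.2 : ℂ) + c p.1)
      = (∫ p in triMinus L, f p * (deriv c p.1 * (p.2 : ℂ))) + ∫ p in triMinus L, f p * c p.1 := by
    rw [← integral_add (hi hf hc') (hi hf hc1)]
    congr 1; ext p; ring
  have i0 : ∫ p in triMinus L, f p * (-1 * c p.2) = -∫ p in triMinus L, f p * c p.2 := by
    rw [← integral_neg]
    congr 1; ext p; ring
  have i2 : ∫ p in triMinus L, (F p * (L - p.1) - f p) * c p.2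
      = (∫ p in triMinus L, F p * ((L - p.1) * c p.2)) - ∫ p in triMinus L, f p * c p.2 := by
    have hlc : Continuous fun p : ℝ × ℝ => ((L : ℂ) - p.1) * c p.2 := hl.mul hc2
    rw [← integral_sub (hi hF hlc) (hi hf hc2)]
    congr 1; ext p; ring
  have hcx : Continuous fun p : ℝ × ℝ => c p.1 * p.2 := hc1.mul hx
  have j1 := hi hF hcx
  have j2 := hi hD hcx
  have j12 : IntegrableOn (fun p => F p * (c p.1 * p.2) - D p * (c p.1 * p.2)) (triMinus L) :=
    j1.sub j2
  have i3 : ∫ p in triMinus L, (F p * p.2 - D p * p.2 - f p) * c p.1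
      = (∫ p in triMinus L, F p * (c p.1 * p.2)) - (∫ p in triMinus L, D p * (c p.1 * p.2))
        - ∫ p in triMinus L, f p * c p.1 := by
    rw [← integral_sub j1 j2, ← integral_sub j12 (hi hf hc1)]
    congr 1; ext p; ring
  rw [i1] at e2
  rw [i0] at e1
  rw [i2, i3]
  linear_combination e1 + e2

/-- The weak derivative across the diagonal of a function in `H¹(T₋) ∩ H¹(T₊)` is the sum of an
`L²` function and of a jump term carried by the diagonal. -/
theorem exists_jump (hL : 0 < L) (hfm : MemH1 (triMinus L) f) (hfp : MemH1 (triPlus L) f) :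
    ∃ F : ℝ × ℝ → ℂ, ∃ J : ℝ → ℂ, MemLp F 2 (volume.restrict (square L)) ∧
      MemLp J 2 (volume.restrict (Ioo 0 L)) ∧
      ∀ ζ β : ℝ → ℂ, IsTest (Ioo 0 L) ζ → IsTest (Ioo 0 L) β →
        ∫ p in square L, f p * (deriv ζ p.1 * β p.2)
          = -(∫ p in square L, F p * (ζ p.1 * β p.2)) + ∫ s in Ioo 0 L, J s * (ζ s * β s) := by
  obtain ⟨Fm, hFm, h1m⟩ := hfm.2 (1, 0)
  obtain ⟨Dm, hDm, h2m⟩ := hfm.2 (1, 1)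
  obtain ⟨Fp, hFp, h1p⟩ := hfp.2 (1, 0)
  obtain ⟨Dp, hDp, h2p⟩ := hfp.2 (1, 1)
  have mm := fun {f φ : ℝ × ℝ → ℂ} => memLp_mul_continuous (f := f) (φ := φ)
    (isOpen_triMinus (L := L)).measurableSet triMinus_subset
  have mp := fun {f φ : ℝ × ℝ → ℂ} => memLp_mul_continuous (f := f) (φ := φ)
    (isOpen_triPlus (L := L)).measurableSet triPlus_subset
  have cx : Continuous fun p : ℝ × ℝ => (p.1 : ℂ) := by fun_prop
  have cy : Continuous fun p : ℝ × ℝ => (p.2 : ℂ) := by fun_prop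
  have clx : Continuous fun p : ℝ × ℝ => (L : ℂ) - p.1 := by fun_prop
  have cly : Continuous fun p : ℝ × ℝ => (L : ℂ) - p.2 := by fun_prop
  have hA2 : MemLp (fun p => Fm p * (L - p.1) - f p) 2 (volume.restrict (triMinus L)) :=
    (mm hFm clx).sub hfm.1
  have hB2 : MemLp (fun p => Fp p * p.1 + f p) 2 (volume.restrict (triPlus L)) :=
    (mp hFp cx).add hfp.1
  have hA1 : MemLp (fun p => Fm p * p.2 - Dm p * p.2 - f p) 2 (volume.restrict (triMinus L)) :=
    ((mm hFm cy).sub (mm hDm cy)).sub hfm.1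
  have hB1 : MemLp (fun p => Fp p * (L - p.2) - Dp p * (L - p.2) + f p) 2
      (volume.restrict (triPlus L)) :=
    ((mp hFp cly).sub (mp hDp cly)).add hfp.1
  have hR1 := memLp_glue hA1 hB1
  have hR2 := memLp_glue hA2 hB2
  set R1 := glue (fun p => Fm p * p.2 - Dm p * p.2 - f p)
    fun p => Fp p * (L - p.2) - Dp p * (L - p.2) + f p with hR1d
  set R2 := glue (fun p => Fm p * (L - p.1) - f p) fun p => Fp p * p.1 + f p with hR2d
  -- `R2` collects the densities paired with `c(y)` and `R1` those paired with `c(x)`; integrating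
  -- out the other variable gives functions of one variable. The factor `L⁻¹` compensates the sum of
  -- the two weights.
  refine ⟨glue Fm Fp, fun s => (L : ℂ)⁻¹ * ((∫ x in Ioo 0 L, R2 (x, s)) + ∫ y in Ioo 0 L, R1 (s, y)),
    memLp_glue hFm hFp, ((memLp_integral_fst hR2).add (memLp_integral_snd hR1)).const_mul _, ?_⟩
  intro ζ β hζ hβ
  have hc : Continuous fun s => ζ s * β s := hζ.contDiff.continuous.mul hβ.contDiff.continuous
  have k1 : Continuous fun p : ℝ × ℝ => deriv ζ p.1 * β p.2 :=
    ((hζ.contDiff.continuous_deriv (by simp)).comp continuous_fst).mul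
      (hβ.contDiff.continuous.comp continuous_snd)
  have k2 : Continuous fun p : ℝ × ℝ => ζ p.1 * β p.2 :=
    (hζ.contDiff.continuous.comp continuous_fst).mul (hβ.contDiff.continuous.comp continuous_snd)
  have tm := trace_triMinus hfm.1 hFm hDm h1m h2m hζ hβ
  have tp := trace_triPlus hfp.1 hFp hDp h1p h2p hζ hβ
  have g1 := integral_glue_mul hA1 hB1 (hc.comp continuous_fst)
  have g2 := integral_glue_mul hA2 hB2 (hc.comp continuous_snd)
  simp only [Function.comp] at g1 g2
  rw [← hR1d, integral_mul_fst hR1 hc] at g1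
  rw [← hR2d, integral_mul_snd hR2 hc] at g2
  have i1 : IntegrableOn (fun y => (∫ x in Ioo 0 L, R2 (x, y)) * (ζ y * β y)) (Ioo 0 L) :=
    (memLp_integral_fst hR2).integrable_mul (Continuous.memLp_Ioo hc)
  have i2 : IntegrableOn (fun x => (∫ y in Ioo 0 L, R1 (x, y)) * (ζ x * β x)) (Ioo 0 L) :=
    (memLp_integral_snd hR1).integrable_mul (Continuous.memLp_Ioo hc)
  have hJ : ∫ s in Ioo 0 L, (L : ℂ)⁻¹ * ((∫ x in Ioo 0 L, R2 (x, s)) + ∫ y in Ioo 0 L, R1 (s, y))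
        * (ζ s * β s) = (L : ℂ)⁻¹ * ((∫ y in Ioo 0 L, (∫ x in Ioo 0 L, R2 (x, y)) * (ζ y * β y))
          + ∫ x in Ioo 0 L, (∫ y in Ioo 0 L, R1 (x, y)) * (ζ x * β x)) := by
    rw [← integral_add i1 i2, ← integral_const_mul]
    congr 1; ext s; ring
  have hne : (L : ℂ) ≠ 0 := Complex.ofReal_ne_zero.2 hL.ne'
  rw [hJ, g1, g2, integral_glue_mul hFm hFp k2, integral_square_eq_add
    (integrableOn_mul_continuous isOpen_square.measurableSet Subset.rfl
      (memLp_square hfm.1 hfp.1) k1)]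
  refine mul_left_cancel₀ hne ?_
  rw [mul_add (L : ℂ) (-_), mul_inv_cancel_left₀ hne]
  linear_combination tm + tp

end Trace

end IntegroDiff

/-! ### The derivative in `y` of the integral term. -/

namespace IntegroDiff

open Filter Topology TopologicalSpace

variable {L : ℝ} {g : ℝ → ℝ → ℂ}

section NonlocalDeriv

variable {f F q : ℝ × ℝ → ℂ} {J ζ : ℝ → ℂ}

theorem IsTest.star {E : Type} [NormedAddCommGroup E] [NormedSpace ℝ E] {Ω : Set E} {χ : E → ℂ}
    (h : IsTest Ω χ) : IsTest Ω fun x => conj (χ x) := by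
  have hs : tsupport (fun x => conj (χ x)) ⊆ tsupport χ := by
    refine closure_mono fun x hx hx' => hx ?_
    simp [hx']
  exact ⟨Complex.conjCLE.contDiff.comp h.contDiff, h.compact.mono' ((subset_tsupport _).trans hs),
    hs.trans h.subset⟩

theorem deriv_conj {χ : ℝ → ℂ} (h : Differentiable ℝ χ) (x : ℝ) :
    deriv (fun x => conj (χ x)) x = conj (deriv χ x) :=
  ((Complex.conjCLE : ℂ →L[ℝ] ℂ).hasFDerivAt.comp_hasDerivAt x (h x).hasDerivAt).deriv

theorem IsTest.slice {φ : ℝ × ℝ → ℂ} (h : IsTest (square L) φ) (x : ℝ) :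
    IsTest (Ioo 0 L) fun y => φ (x, y) := by
  have hs : tsupport (fun y => φ (x, y)) ⊆ (fun y => (x, y)) ⁻¹' tsupport φ :=
    closure_minimal (fun y hy => subset_tsupport _ hy)
      ((isClosed_tsupport φ).preimage (by fun_prop))
  exact ⟨h.contDiff.comp (by fun_prop), HasCompactSupport.intro (isCompact_Icc (a := 0) (b := L))
    fun y hy => h.eq_zero fun h' => hy (Ioo_subset_Icc_self h'.2), fun y hy => (h.subset (hs hy)).2⟩

/-- For a fixed `ζ`, letting `β` vary localizes the identity in the second variable. The exceptional
null set depends on `ζ`. -/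
theorem jump_ae (hf : MemLp f 2 (volume.restrict (square L)))
    (hF : MemLp F 2 (volume.restrict (square L))) (hJ : MemLp J 2 (volume.restrict (Ioo 0 L)))
    (h : ∀ ζ β : ℝ → ℂ, IsTest (Ioo 0 L) ζ → IsTest (Ioo 0 L) β →
      ∫ p in square L, f p * (deriv ζ p.1 * β p.2)
        = -(∫ p in square L, F p * (ζ p.1 * β p.2)) + ∫ s in Ioo 0 L, J s * (ζ s * β s))
    (hζ : IsTest (Ioo 0 L) ζ) :
    ∀ᵐ s ∂volume.restrict (Ioo 0 L), ∫ y in Ioo 0 L, f (y, s) * deriv ζ y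
      = -(∫ y in Ioo 0 L, F (y, s) * ζ y) + J s * ζ s := by
  have hζc := hζ.contDiff.continuous
  have hζc' : Continuous (deriv ζ) := hζ.contDiff.continuous_deriv (by simp)
  have mf := memLp_mul_continuous isOpen_square.measurableSet Subset.rfl hf
    (hζc'.comp continuous_fst)
  have mF := memLp_mul_continuous isOpen_square.measurableSet Subset.rfl hF
    (hζc.comp continuous_fst)
  simp only [Function.comp] at mf mF
  obtain ⟨C, hC⟩ := hζc.bounded_above_of_compact_support hζ.compact
  have a1 := (memLp_integral_fst mf).integrable one_le_two
  have a2 := (memLp_integral_fst mF).integrable one_le_two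
  have a3 : IntegrableOn (fun s => J s * ζ s) (Ioo 0 L) := (hJ.integrable one_le_two).mul_bdd
    hζc.aestronglyMeasurable (Eventually.of_forall hC)
  simp only at a1 a2
  have a12 : IntegrableOn (fun s => (∫ y in Ioo 0 L, f (y, s) * deriv ζ y)
    + ∫ y in Ioo 0 L, F (y, s) * ζ y) (Ioo 0 L) := a1.add a2
  have a : IntegrableOn (fun s => (∫ y in Ioo 0 L, f (y, s) * deriv ζ y)
    + (∫ y in Ioo 0 L, F (y, s) * ζ y) - J s * ζ s) (Ioo 0 L) := a12.sub a3
  have key := isOpen_Ioo.ae_eq_zero_of_integral_contDiff_smul_eq_zero a.locallyIntegrableOn ?_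
  · rw [← ae_restrict_iff' measurableSet_Ioo] at key
    filter_upwards [key] with s hs
    linear_combination hs
  intro η e1 e2 e3
  have hβ := IsTest.ofReal e1 e2 e3
  set β : ℝ → ℂ := fun y => (η y : ℂ) with hβd
  have hβc := hβ.contDiff.continuous
  obtain ⟨C', hC'⟩ := hβc.bounded_above_of_compact_support hβ.compact
  have bd : ∀ {u : ℝ → ℂ}, IntegrableOn u (Ioo 0 L) → IntegrableOn (fun s => u s * β s) (Ioo 0 L) :=
    fun hu => hu.mul_bdd hβc.aestronglyMeasurable (Eventually.of_forall hC')
  rw [← setIntegral_eq_integral_of_forall_compl_eq_zero (s := Ioo 0 L) fun y hy => by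
    rw [image_eq_zero_of_notMem_tsupport fun h => hy (e3 h), zero_smul]]
  have e := h ζ β hζ hβ
  have r1 : ∫ p in square L, f p * (deriv ζ p.1 * β p.2)
      = ∫ s in Ioo 0 L, (∫ y in Ioo 0 L, f (y, s) * deriv ζ y) * β s := by
    rw [← integral_mul_snd mf hβc]
    simp only [mul_assoc]
  have r2 : ∫ p in square L, F p * (ζ p.1 * β p.2)
      = ∫ s in Ioo 0 L, (∫ y in Ioo 0 L, F (y, s) * ζ y) * β s := by
    rw [← integral_mul_snd mF hβc]
    simp only [mul_assoc]
  rw [r1, r2] at e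
  have e' : ∫ s in Ioo 0 L, η s • ((∫ y in Ioo 0 L, f (y, s) * deriv ζ y)
      + (∫ y in Ioo 0 L, F (y, s) * ζ y) - J s * ζ s)
      = (∫ s in Ioo 0 L, (∫ y in Ioo 0 L, f (y, s) * deriv ζ y) * β s)
        + (∫ s in Ioo 0 L, (∫ y in Ioo 0 L, F (y, s) * ζ y) * β s)
        - ∫ s in Ioo 0 L, J s * (ζ s * β s) := by
    have b3 : IntegrableOn (fun s => J s * (ζ s * β s)) (Ioo 0 L) := by
      simpa only [mul_assoc] using bd a3
    have b12 : IntegrableOn (fun s => (∫ y in Ioo 0 L, f (y, s) * deriv ζ y) * β s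
        + (∫ y in Ioo 0 L, F (y, s) * ζ y) * β s) (Ioo 0 L) := (bd a1).add (bd a2)
    rw [← integral_add (bd a1) (bd a2), ← integral_sub b12 b3]
    refine integral_congr_ae (Eventually.of_forall fun s => ?_)
    simp only [Complex.real_smul, hβd]
    ring
  rw [e']
  linear_combination e

/-- Fubini puts the derivative of `ζ` against the columns of `g`, where the jump identity applies; a
second use of Fubini returns to rows. The diagonal term evaluates `v` at `y` itself. -/
theorem integral_inner_row_deriv (hL : 0 ≤ L)
    (hg : MemLp (Function.uncurry g) 2 (volume.restrict (square L)))
    {G : ℝ → ℝ → ℂ} (hG : MemLp (Function.uncurry G) 2 (volume.restrict (square L)))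
    (hJ : MemLp J 2 (volume.restrict (Ioo 0 L)))
    (h : ∀ ζ β : ℝ → ℂ, IsTest (Ioo 0 L) ζ → IsTest (Ioo 0 L) β →
      ∫ p in square L, Function.uncurry g p * (deriv ζ p.1 * β p.2)
        = -(∫ p in square L, Function.uncurry G p * (ζ p.1 * β p.2))
          + ∫ s in Ioo 0 L, J s * (ζ s * β s))
    (hζ : IsTest (Ioo 0 L) ζ) (v : L2 L) :
    ∫ y in Ioo 0 L, inner ℂ (toL2 L (g y)) v * deriv ζ y
      = -∫ y in Ioo 0 L, (inner ℂ (toL2 L (G y)) v - conj (J y) * v y) * ζ y := by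
  have hζs := hζ.star
  have hw1 : MemLp (fun y => conj (deriv ζ y)) 2 (volume.restrict (Ioo 0 L)) :=
    Continuous.memLp_Ioo (Complex.continuous_conj.comp (hζ.contDiff.continuous_deriv (by simp)))
  have hw2 := hζs.memLp
  have e1 := (inner_kernelOp_eq hL hg hw1 v).symm.trans (inner_kernelOp hL hg hw1 v)
  have e2 := (inner_kernelOp_eq hL hG hw2 v).symm.trans (inner_kernelOp hL hG hw2 v)
  simp only [Complex.conj_conj] at e1 e2
  obtain ⟨C, hC⟩ := hζ.contDiff.continuous.bounded_above_of_compact_support hζ.compact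
  have i2 : IntegrableOn (fun y => inner ℂ (toL2 L (G y)) v * ζ y) (Ioo 0 L) :=
    ((memLp_inner_row hG v).integrable one_le_two).mul_bdd
      hζ.contDiff.continuous.aestronglyMeasurable (Eventually.of_forall hC)
  have i3 : IntegrableOn (fun y => conj (J y) * v y * ζ y) (Ioo 0 L) :=
    (hJ.star.integrable_mul (Lp.memLp v)).mul_bdd
      hζ.contDiff.continuous.aestronglyMeasurable (Eventually.of_forall hC)
  have i4 : IntegrableOn (fun y => v y * conj (∫ σ in (0 : ℝ)..L, G σ y * conj (ζ σ))) (Ioo 0 L) := by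
    have := memLp_integral_fst (memLp_mul_continuous isOpen_square.measurableSet Subset.rfl hG
      (hζs.contDiff.continuous.comp continuous_fst))
    simp only [intervalIntegral_eq_Ioo hL]
    exact (Lp.memLp v).integrable_mul this.star
  have hs : ∫ y in Ioo 0 L, (inner ℂ (toL2 L (G y)) v - conj (J y) * v y) * ζ y
      = (∫ y in Ioo 0 L, inner ℂ (toL2 L (G y)) v * ζ y)
        - ∫ y in Ioo 0 L, conj (J y) * v y * ζ y := by
    rw [← integral_sub i2 i3]
    congr 1; ext y; ring
  rw [hs, e1, e2, intervalIntegral_eq_Ioo hL, intervalIntegral_eq_Ioo hL, neg_sub,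
    ← integral_sub i3 i4]
  refine integral_congr_ae ?_
  filter_upwards [jump_ae hg hG hJ h hζs] with y hy
  simp only [deriv_conj (hζ.contDiff.differentiable (by simp)), Function.uncurry] at hy
  rw [intervalIntegral_eq_Ioo hL, intervalIntegral_eq_Ioo hL, hy]
  simp only [map_add, map_neg, map_mul, Complex.conj_conj]
  ring

theorem memLp_mul_lineIntegral {e : ℝ × ℝ} (hq : Measurable q) (hq2 : MemLp q 2 volume)
    (he : |e.2| = 1) (hJ : MemLp J 2 (volume.restrict (Ioo 0 L))) :
    MemLp (fun p => conj (J p.2) * lineIntegral L e q p) 2 (volume.restrict (square L)) := by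
  have hm := measurable_lineIntegral (L := L) (e := e) hq
  have hJm : AEStronglyMeasurable (fun p : ℝ × ℝ => conj (J p.2)) (volume.restrict (square L)) := by
    rw [volume_restrict_square]
    exact hJ.1.star.comp_snd
  have hmul : AEStronglyMeasurable (fun p => conj (J p.2) * lineIntegral L e q p)
      (volume.restrict (square L)) := hJm.mul hm.aestronglyMeasurable
  rw [memLp_two_iff_lintegral hmul]
  have := lintegral_weight_lineIntegral_lt_top (L := L) (w := fun y => ‖J y‖ₑ ^ 2) hq hq2 he
    (hJ.1.enorm.pow_const 2) ((memLp_two_iff_lintegral hJ.1).1 hJ)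
  refine lt_of_eq_of_lt (lintegral_congr fun p => ?_) this
  rw [enorm_mul, mul_pow]
  congr 2
  exact RCLike.enorm_conj _

theorem kernelFormula_eq_glue : kernelFormula L q
    = glue (fun p => -lineIntegral L (1, 1) q p) (lineIntegral L (-1, -1) q) := rfl

theorem memLp_kernelFormula (hq : Measurable q) (hq2 : MemLp q 2 volume) :
    MemLp (kernelFormula L q) 2 (volume.restrict (square L)) :=
  memLp_glue (((memLp_lineIntegral hq hq2 (by simp)).mono_measure
    (Measure.restrict_mono triMinus_subset le_rfl)).neg)
    ((memLp_lineIntegral hq hq2 (by simp)).mono_measure (Measure.restrict_mono triPlus_subset le_rfl))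

/-- For a general `L²` function in place of `kernelFormula L q` this product would only be
integrable. On each side of the diagonal the formula is a line integral, square integrable in `x`
uniformly in `y`, so the weight `J ∈ L²` in `y` is harmless. -/
theorem memLp_mul_kernelFormula (hq : Measurable q) (hq2 : MemLp q 2 volume)
    (hJ : MemLp J 2 (volume.restrict (Ioo 0 L))) :
    MemLp (fun p => conj (J p.2) * kernelFormula L q p) 2 (volume.restrict (square L)) := by
  have h1 := memLp_glue (((memLp_mul_lineIntegral (e := (1, 1)) hq hq2 (by simp) hJ).mono_measure
    (Measure.restrict_mono triMinus_subset le_rfl)).neg)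
    ((memLp_mul_lineIntegral (e := (-1, -1)) hq hq2 (by simp) hJ).mono_measure
      (Measure.restrict_mono triPlus_subset le_rfl))
  refine h1.ae_eq (Eventually.of_forall fun p => ?_)
  simp only [kernelFormula, glue]
  split_ifs <;> simp

/-- The integral term of the kernel equation has a square integrable derivative in `y`. -/
theorem IsKernelSolution.exists_nonlocal_deriv (hL : 0 < L)
    (hg : MemLp (Function.uncurry g) 2 (volume.restrict (square L)))
    (hm : MemH1 (triMinus L) (Function.uncurry g)) (hp : MemH1 (triPlus L) (Function.uncurry g))
    {U : L2 L} {k : ℝ → L2 L} (hk : IsKernelSolution L g U k) (hk0 : k 0 = 0)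
    (hq : IsExtension (square L) (kernelRhs L g k) q) :
    ∃ H, MemLp H 2 (volume.restrict (square L)) ∧
      HasWeakDeriv (square L) (0, 1) (nonlocal L g k) H := by
  obtain ⟨F, J, hF, hJ, hFJ⟩ := exists_jump hL hm hp
  obtain ⟨G, rfl⟩ : ∃ G, F = Function.uncurry G := ⟨Function.curry F, by simp⟩
  -- The candidate derivative uses the formula instead of `k` itself: this gives both a jointly
  -- measurable representative and the square integrability of the jump term.
  have hH : MemLp (fun p => nonlocal L G k p - conj (J p.2) * kernelFormula L q p) 2
      (volume.restrict (square L)) :=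
    (memLp_nonlocal hF hk.1).sub (memLp_mul_kernelFormula hq.measurable hq.memLp hJ)
  refine ⟨_, hH, fun φ h1 h2 h3 => ?_⟩
  have hφ : IsTest (square L) φ := ⟨h1, h2, h3⟩
  have i1 := integrableOn_mul_continuous isOpen_square.measurableSet Subset.rfl
    (memLp_nonlocal hg hk.1) (continuous_fderiv_apply h1 (0, 1))
  have i2 := integrableOn_mul_continuous isOpen_square.measurableSet Subset.rfl hH h1.continuous
  rw [IntegrableOn, volume_restrict_square] at i1 i2
  rw [volume_restrict_square, integral_prod _ i1, integral_prod _ i2, ← integral_neg]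
  refine setIntegral_congr_fun measurableSet_Ioo fun x hx => ?_
  have hd : ∀ y, fderiv ℝ φ (x, y) (0, 1) = deriv (fun y => φ (x, y)) y := fun y =>
    (hasDerivAt_snd (φ := Function.curry φ) (h1.of_le (by simp)) x y).deriv.symm
  simp only [hd]
  have e := integral_inner_row_deriv hL.le hg hF hJ hFJ (hφ.slice x) (k x)
  simp only [nonlocal]
  rw [e]
  congr 1
  refine integral_congr_ae ?_
  filter_upwards [hk.ae_eq_kernelFormula hL.le hg hk0 hq (Ioo_subset_Icc_self hx)] with y hy
  rw [hy]

end NonlocalDeriv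

end IntegroDiff

/-! ### Piecewise `H¹` regularity of the kernel. -/

namespace IntegroDiff

open Filter Topology TopologicalSpace

variable {L : ℝ} {g : ℝ → ℝ → ℂ}

section Swap

variable {Ω : Set (ℝ × ℝ)} {f F : ℝ × ℝ → ℂ} {v : ℝ × ℝ}

theorem IsTest.comp_swap {φ : ℝ × ℝ → ℂ} (h : IsTest (Prod.swap ⁻¹' Ω) φ) :
    IsTest Ω fun p => φ p.swap := by
  have hs : tsupport (fun p => φ p.swap) ⊆ Prod.swap ⁻¹' tsupport φ :=
    closure_minimal (fun y hy => subset_tsupport _ hy)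
      ((isClosed_tsupport φ).preimage continuous_swap)
  refine ⟨h.contDiff.comp (contDiff_snd.prodMk contDiff_fst),
    h.compact.comp_homeomorph (Homeomorph.prodComm ℝ ℝ), fun p hp => ?_⟩
  simpa using h.subset (hs hp)

theorem setIntegral_swap (f : ℝ × ℝ → ℂ) (Ω : Set (ℝ × ℝ)) :
    ∫ p in Prod.swap ⁻¹' Ω, f p.swap = ∫ p in Ω, f p :=
  (Measure.measurePreserving_swap (μ := volume) (ν := volume)).setIntegral_preimage_emb
    MeasurableEquiv.prodComm.measurableEmbedding f Ω

theorem HasWeakDeriv.conj_swap (h : HasWeakDeriv Ω v f F) :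
    HasWeakDeriv (Prod.swap ⁻¹' Ω) v.swap (fun p => conj (f p.swap)) fun p => conj (F p.swap) := by
  intro φ h1 h2 h3
  have hφ : IsTest (Prod.swap ⁻¹' Ω) φ := ⟨h1, h2, h3⟩
  have hψ := hφ.comp_swap.star
  have e := congrArg conj (h _ hψ.contDiff hψ.compact hψ.subset)
  have hd : ∀ p, fderiv ℝ (fun p => conj (φ p.swap)) p v = conj (fderiv ℝ φ p.swap v.swap) := by
    intro p
    have d1 := (h1.differentiable (by simp) p.swap).hasFDerivAt.comp p
      ((ContinuousLinearEquiv.prodComm ℝ ℝ ℝ).hasFDerivAt (x := p))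
    have d2 := ((Complex.conjCLE : ℂ →L[ℝ] ℂ).hasFDerivAt).comp p d1
    have d3 : HasFDerivAt (fun p => conj (φ p.swap)) _ p := d2
    rw [d3.fderiv]
    rfl
  simp only [hd] at e
  rw [← integral_conj, map_neg, ← integral_conj] at e
  simp only [map_mul, Complex.conj_conj] at e
  rw [← setIntegral_swap _ Ω, ← setIntegral_swap _ Ω] at e
  simpa using e

theorem MemH1.conj_swap (h : MemH1 Ω f) : MemH1 (Prod.swap ⁻¹' Ω) fun p => conj (f p.swap) := by
  have hm : ∀ {F : ℝ × ℝ → ℂ}, MemLp F 2 (volume.restrict Ω) →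
      MemLp (fun p => conj (F p.swap)) 2 (volume.restrict (Prod.swap ⁻¹' Ω)) := fun hF =>
    (hF.comp_measurePreserving ((Measure.measurePreserving_swap (μ := volume)
      (ν := volume)).restrict_preimage_emb MeasurableEquiv.prodComm.measurableEmbedding Ω)).star
  refine ⟨hm h.1, fun v => ?_⟩
  obtain ⟨F, hF, hd⟩ := h.2 v.swap
  exact ⟨_, hm hF, by simpa using hd.conj_swap⟩

theorem swap_preimage_triMinus : Prod.swap ⁻¹' triMinus L = triPlus L := by
  ext p
  simp only [triMinus, triPlus, square, mem_preimage, mem_ofPred_eq, mem_prod, Prod.fst_swap,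
    Prod.snd_swap]
  tauto

theorem swap_preimage_triPlus : Prod.swap ⁻¹' triPlus L = triMinus L := by
  rw [← swap_preimage_triMinus, ← preimage_comp]
  simp

end Swap

section Linear

variable {Ω : Set (ℝ × ℝ)} {f f' F F' : ℝ × ℝ → ℂ} {v w : ℝ × ℝ}

theorem HasWeakDeriv.congr (h : HasWeakDeriv Ω v f F) (hf : f' =ᵐ[volume.restrict Ω] f)
    (hF : F' =ᵐ[volume.restrict Ω] F) : HasWeakDeriv Ω v f' F' := by
  intro φ h1 h2 h3
  have e1 : (fun p => f' p * fderiv ℝ φ p v) =ᵐ[volume.restrict Ω] fun p => f p * fderiv ℝ φ p v := by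
    filter_upwards [hf] with p hp
    rw [hp]
  have e2 : (fun p => F' p * φ p) =ᵐ[volume.restrict Ω] fun p => F p * φ p := by
    filter_upwards [hF] with p hp
    rw [hp]
  rw [integral_congr_ae e1, integral_congr_ae e2, h φ h1 h2 h3]

theorem HasWeakDeriv.neg (h : HasWeakDeriv Ω v f F) :
    HasWeakDeriv Ω v (fun p => -f p) fun p => -F p := by
  intro φ h1 h2 h3
  simp only [neg_mul, integral_neg, h φ h1 h2 h3]

theorem HasWeakDeriv.sub (hΩ : MeasurableSet Ω) (hs : Ω ⊆ square L)
    [IsFiniteMeasure (volume.restrict Ω)]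
    (hf : MemLp f 2 (volume.restrict Ω)) (hf' : MemLp f' 2 (volume.restrict Ω))
    (hF : MemLp F 2 (volume.restrict Ω)) (hF' : MemLp F' 2 (volume.restrict Ω))
    (h : HasWeakDeriv Ω v f F) (h' : HasWeakDeriv Ω v f' F') :
    HasWeakDeriv Ω v (fun p => f p - f' p) fun p => F p - F' p := by
  intro φ h1 h2 h3
  have hi := fun {f φ : ℝ × ℝ → ℂ} => integrableOn_mul_continuous (f := f) (φ := φ) hΩ hs
  have hc := continuous_fderiv_apply h1 v
  simp only [sub_mul]
  rw [integral_sub (hi hf hc) (hi hf' hc), integral_sub (hi hF h1.continuous) (hi hF' h1.continuous),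
    h φ h1 h2 h3, h' φ h1 h2 h3]
  ring

theorem HasWeakDeriv.comb (hΩ : MeasurableSet Ω) (hs : Ω ⊆ square L)
    [IsFiniteMeasure (volume.restrict Ω)] (hf : MemLp f 2 (volume.restrict Ω))
    (hF : MemLp F 2 (volume.restrict Ω)) (hF' : MemLp F' 2 (volume.restrict Ω))
    (h : HasWeakDeriv Ω v f F) (h' : HasWeakDeriv Ω w f F') (a b : ℝ) :
    HasWeakDeriv Ω (a • v + b • w) f fun p => a * F p + b * F' p := by
  intro φ h1 h2 h3
  have hi := fun {f φ : ℝ × ℝ → ℂ} => integrableOn_mul_continuous (f := f) (φ := φ) hΩ hs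
  have e1 : ∀ p, f p * fderiv ℝ φ p (a • v + b • w)
      = a * (f p * fderiv ℝ φ p v) + b * (f p * fderiv ℝ φ p w) := fun p => by
    simp only [map_add, map_smul, Complex.real_smul]
    ring
  have e2 : ∀ p, (a * F p + b * F' p) * φ p = a * (F p * φ p) + b * (F' p * φ p) := fun p => by ring
  simp only [e1, e2]
  rw [integral_add ((hi hf (continuous_fderiv_apply h1 v)).const_mul _)
    ((hi hf (continuous_fderiv_apply h1 w)).const_mul _),
    integral_add ((hi hF h1.continuous).const_mul _) ((hi hF' h1.continuous).const_mul _),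
    integral_const_mul, integral_const_mul, integral_const_mul, integral_const_mul,
    h φ h1 h2 h3, h' φ h1 h2 h3]
  ring

/-- A function is in `H¹(Ω)` if it has weak derivatives along the characteristics and in `y`. -/
theorem memH1_of_characteristic (hΩ : MeasurableSet Ω) (hs : Ω ⊆ square L)
    [IsFiniteMeasure (volume.restrict Ω)] (hf : MemLp f 2 (volume.restrict Ω))
    (hF : MemLp F 2 (volume.restrict Ω)) (hF' : MemLp F' 2 (volume.restrict Ω))
    (h : HasWeakDeriv Ω (1, 1) f F) (h' : HasWeakDeriv Ω (0, 1) f F') : MemH1 Ω f := by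
  refine ⟨hf, fun v => ⟨_, (hF.const_mul (v.1 : ℂ)).add (hF'.const_mul ((v.2 - v.1 : ℝ) : ℂ)), ?_⟩⟩
  have e : v.1 • ((1 : ℝ), (1 : ℝ)) + (v.2 - v.1) • ((0 : ℝ), (1 : ℝ)) = v := by ext <;> simp
  have := HasWeakDeriv.comb hΩ hs hf hF hF' h h' v.1 (v.2 - v.1)
  rw [e] at this
  exact this

end Linear

section KernelDeriv

variable {q E : ℝ × ℝ → ℂ}

/-- The source `conj g(y,x)` is differentiated separately on each triangle, which the swap of
variables exchanges; the integral term has its derivative on the whole square. `E` is their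
difference, extended by zero. -/
theorem IsKernelSolution.exists_kernelRhs_deriv (hL : 0 < L)
    (hg : MemLp (Function.uncurry g) 2 (volume.restrict (square L)))
    (hm : MemH1 (triMinus L) (Function.uncurry g)) (hp : MemH1 (triPlus L) (Function.uncurry g))
    {U : L2 L} {k : ℝ → L2 L} (hk : IsKernelSolution L g U k) (hk0 : k 0 = 0)
    (hq : IsExtension (square L) (kernelRhs L g k) q) :
    ∃ E, IsExtension (square L) E E ∧ HasWeakDeriv (triMinus L) (0, 1) q E ∧
      HasWeakDeriv (triPlus L) (0, 1) q E := by
  obtain ⟨H, hH, hHd⟩ := hk.exists_nonlocal_deriv hL hg hm hp hk0 hq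
  have hγp := hm.conj_swap
  have hγm := hp.conj_swap
  rw [swap_preimage_triMinus] at hγp
  rw [swap_preimage_triPlus] at hγm
  obtain ⟨Fp, hFp, hdp⟩ := hγp.2 (0, 1)
  obtain ⟨Fm, hFm, hdm⟩ := hγm.2 (0, 1)
  obtain ⟨E, hE⟩ := exists_isExtension isOpen_square.measurableSet ((memLp_glue hFm hFp).sub hH)
  have rm := Measure.restrict_mono (μ := volume) (triMinus_subset (L := L)) le_rfl
  have rp := Measure.restrict_mono (μ := volume) (triPlus_subset (L := L)) le_rfl
  have hh := memLp_nonlocal hg hk.1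
  refine ⟨E, ⟨hE.measurable, hE.memLp, hE.integrable, hE.eq_zero, EventuallyEq.rfl⟩, ?_, ?_⟩
  · refine (HasWeakDeriv.sub isOpen_triMinus.measurableSet triMinus_subset hγm.1 (hh.mono_measure rm)
      hFm (hH.mono_measure rm) hdm (hHd.mono triMinus_subset isOpen_square.measurableSet)).congr
      (ae_mono rm hq.ae_eq) ?_
    filter_upwards [ae_mono rm hE.ae_eq, glue_ae_eq_minus (A := Fm) (B := Fp)] with p h1 h2
    rw [h1, Pi.sub_apply, h2]
  · refine (HasWeakDeriv.sub isOpen_triPlus.measurableSet triPlus_subset hγp.1 (hh.mono_measure rp)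
      hFp (hH.mono_measure rp) hdp (hHd.mono triPlus_subset isOpen_square.measurableSet)).congr
      (ae_mono rp hq.ae_eq) ?_
    filter_upwards [ae_mono rp hE.ae_eq, glue_ae_eq_plus (A := Fm) (B := Fp)] with p h1 h2
    rw [h1, Pi.sub_apply, h2]

theorem fderiv_translate {ψ : ℝ × ℝ → ℂ} (a p v : ℝ × ℝ) :
    fderiv ℝ (fun p => ψ (p - a)) p v = fderiv ℝ ψ (p - a) v := by
  simp only [sub_eq_add_neg, fderiv_comp_add_right]

theorem integral_eq_setIntegral_triMinus (h0 : ∀ p, p ∉ square L → q p = 0) {φ : ℝ × ℝ → ℂ}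
    (hφ : ∀ p : ℝ × ℝ, p.1 ≤ p.2 → φ p = 0) :
    ∫ p, q p * φ p = ∫ p in triMinus L, q p * φ p := by
  refine (setIntegral_eq_integral_of_forall_compl_eq_zero fun p hp => ?_).symm
  by_cases hs : p ∈ square L
  · rw [hφ p (not_lt.1 fun h => hp ⟨hs, h⟩), mul_zero]
  · rw [h0 p hs, zero_mul]

theorem integral_eq_setIntegral_triPlus (h0 : ∀ p, p ∉ square L → q p = 0) {φ : ℝ × ℝ → ℂ}
    (hφ : ∀ p : ℝ × ℝ, p.2 ≤ p.1 → φ p = 0) :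
    ∫ p, q p * φ p = ∫ p in triPlus L, q p * φ p := by
  refine (setIntegral_eq_integral_of_forall_compl_eq_zero fun p hp => ?_).symm
  by_cases hs : p ∈ square L
  · rw [hφ p (not_lt.1 fun h => hp ⟨hs, h⟩), mul_zero]
  · rw [h0 p hs, zero_mul]

/-- Translating a test function of the lower triangle along `(1,1)` keeps it away from the diagonal
and from `y = 0`. It may cross `x = L`, but this side is parallel to `(0,1)` and imposes no
condition. -/
theorem hasWeakDeriv_lineIntegral_triMinus {f f' : ℝ × ℝ → ℂ} (hq : IsExtension (square L) f q)
    (hE : IsExtension (square L) f' E) (h : HasWeakDeriv (triMinus L) (0, 1) q E) :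
    HasWeakDeriv (triMinus L) (0, 1) (lineIntegral L (1, 1) q) (lineIntegral L (1, 1) E) := by
  refine HasWeakDeriv.lineIntegral hq.integrable hE.integrable fun ψ hψ s hs => ?_
  have hz : ∀ {χ : ℝ × ℝ → ℂ}, IsTest (triMinus L) χ → ∀ p : ℝ × ℝ, p.1 ≤ p.2 ∨ p.2 ≤ 0 →
      χ (p - s • ((1 : ℝ), (1 : ℝ))) = 0 := fun hχ p hp => hχ.eq_zero fun h' => by
    have h1 := h'.2
    have h2 := h'.1.2.1
    simp only [Prod.fst_sub, Prod.snd_sub, Prod.smul_mk, smul_eq_mul, mul_one] at h1 h2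
    rcases hp with hp | hp
    · linarith
    · linarith [hs.1]
  rw [integral_eq_setIntegral_triMinus hq.eq_zero fun p hp => hz (hψ.fderiv_apply _) p (Or.inl hp),
    integral_eq_setIntegral_triMinus hE.eq_zero fun p hp => hz hψ p (Or.inl hp)]
  have e := h.integral_triMinus (hq.memLp.restrict _) (hE.memLp.restrict _)
    (φ := fun p => ψ (p - s • ((1 : ℝ), (1 : ℝ)))) (hψ.contDiff.comp (by fun_prop))
    (fun h => by simp at h) (fun _ x => hz hψ _ (Or.inr le_rfl)) (fun _ x => hz hψ _ (Or.inl le_rfl))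
  simpa only [fderiv_translate] using e

/-- Above the diagonal the translation goes backwards: it stays off the diagonal and off `y = L`,
and the side `x = 0` that it may cross is parallel to `(0,1)`. -/
theorem hasWeakDeriv_lineIntegral_triPlus {f f' : ℝ × ℝ → ℂ} (hq : IsExtension (square L) f q)
    (hE : IsExtension (square L) f' E) (h : HasWeakDeriv (triPlus L) (0, 1) q E) :
    HasWeakDeriv (triPlus L) (0, 1) (lineIntegral L (-1, -1) q) (lineIntegral L (-1, -1) E) := by
  refine HasWeakDeriv.lineIntegral hq.integrable hE.integrable fun ψ hψ s hs => ?_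
  have hz : ∀ {χ : ℝ × ℝ → ℂ}, IsTest (triPlus L) χ → ∀ p : ℝ × ℝ, p.2 ≤ p.1 ∨ L ≤ p.2 →
      χ (p - s • ((-1 : ℝ), (-1 : ℝ))) = 0 := fun hχ p hp => hχ.eq_zero fun h' => by
    have h1 := h'.2
    have h2 := h'.1.2.2
    simp only [Prod.fst_sub, Prod.snd_sub, Prod.smul_mk, smul_eq_mul, mul_neg, mul_one] at h1 h2
    rcases hp with hp | hp
    · linarith
    · linarith [hs.1]
  rw [integral_eq_setIntegral_triPlus hq.eq_zero fun p hp => hz (hψ.fderiv_apply _) p (Or.inl hp),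
    integral_eq_setIntegral_triPlus hE.eq_zero fun p hp => hz hψ p (Or.inl hp)]
  have e := h.integral_triPlus (hq.memLp.restrict _) (hE.memLp.restrict _)
    (φ := fun p => ψ (p - s • ((-1 : ℝ), (-1 : ℝ)))) (hψ.contDiff.comp (by fun_prop))
    (fun h => by simp at h) (fun _ x => hz hψ _ (Or.inr le_rfl)) (fun _ x => hz hψ _ (Or.inl le_rfl))
  simpa only [fderiv_translate] using e

/-- The kernel equation along the characteristics. -/
theorem IsKernelSolution.hasWeakDeriv_characteristic (hL : 0 < L)
    (hg : MemLp (Function.uncurry g) 2 (volume.restrict (square L)))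
    {U : L2 L} {k : ℝ → L2 L} (hk : IsKernelSolution L g U k) (hk0 : k 0 = 0)
    (hq : IsExtension (square L) (kernelRhs L g k) q) :
    HasWeakDeriv (square L) (1, 1) (kernelFormula L q) q := by
  intro φ h1 h2 h3
  have hφ : IsTest (square L) φ := ⟨h1, h2, h3⟩
  have hψ := hφ.star
  have hψ1 : ContDiff ℝ 1 (Function.uncurry fun x y => conj (φ (x, y))) := hψ.contDiff.of_le (by simp)
  have hw := hk.weak_form hL.le hg hq.ae_eq (ξ := 0) ⟨le_rfl, hL.le⟩ hψ1
    fun x _ => hψ.eq_zero (x := (x, 0)) fun h => lt_irrefl _ h.2.1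
  have hzL : ∀ x, φ (x, L) = 0 := fun x => hφ.eq_zero fun h => lt_irrefl _ h.2.2
  simp only [hk0, inner_zero_right, Complex.conj_conj, hzL, mul_zero, intervalIntegral.integral_zero,
    sub_zero, add_zero] at hw
  have hd : ∀ x y, conj (transport (fun x y => conj (φ (x, y))) x y) = -fderiv ℝ φ (x, y) (1, 1) := by
    intro x y
    rw [transport_eq hψ1]
    have d1 := ((Complex.conjCLE : ℂ →L[ℝ] ℂ).hasFDerivAt).comp (x, y)
      (h1.differentiable (by simp) (x, y)).hasFDerivAt
    have d2 : HasFDerivAt (Function.uncurry fun x y => conj (φ (x, y))) _ (x, y) := d1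
    rw [d2.fderiv]
    simp
  have i1 := integrableOn_mul_continuous isOpen_square.measurableSet Subset.rfl
    (memLp_kernelFormula (L := L) hq.measurable hq.memLp) (continuous_fderiv_apply h1 (1, 1))
  have i2 := integrableOn_mul_continuous isOpen_square.measurableSet Subset.rfl
    (hq.memLp.restrict (square L)) h1.continuous
  rw [IntegrableOn, volume_restrict_square] at i1 i2
  rw [volume_restrict_square, integral_prod _ i1, integral_prod _ i2, ← hw,
    intervalIntegral_eq_Ioo hL.le, ← integral_neg]
  refine setIntegral_congr_fun measurableSet_Ioo fun x hx => ?_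
  rw [inner_toL2 hL.le (Continuous.memLp_Ioo (ContDiff.continuous_slice (continuous_transport hψ1) x)),
    intervalIntegral_eq_Ioo hL.le, ← integral_neg]
  refine integral_congr_ae ?_
  filter_upwards [hk.ae_eq_kernelFormula hL.le hg hk0 hq (Ioo_subset_Icc_self hx)] with y hy
  rw [hy, hd]
  ring

/-- The solution of the kernel equation is piecewise `H¹` if it vanishes at `x = 0`. -/
theorem IsKernelSolution.kernelMemH1 (hL : 0 < L)
    (hg : MemLp (Function.uncurry g) 2 (volume.restrict (square L)))
    (hm : MemH1 (triMinus L) (Function.uncurry g)) (hp : MemH1 (triPlus L) (Function.uncurry g))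
    {U : L2 L} {k : ℝ → L2 L} (hk : IsKernelSolution L g U k) (hk0 : k 0 = 0) :
    KernelMemH1 L k := by
  obtain ⟨q, hq⟩ := exists_isExtension isOpen_square.measurableSet (memLp_kernelRhs hg hk.1)
  obtain ⟨E, hE, hEm, hEp⟩ := hk.exists_kernelRhs_deriv hL hg hm hp hk0 hq
  have hK := memLp_kernelFormula (L := L) hq.measurable hq.memLp
  have hc := hk.hasWeakDeriv_characteristic hL hg hk0 hq
  have rm := Measure.restrict_mono (μ := volume) (triMinus_subset (L := L)) le_rfl
  have rp := Measure.restrict_mono (μ := volume) (triPlus_subset (L := L)) le_rfl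
  refine ⟨Function.curry (kernelFormula L q), ?_, ?_, ?_, ?_⟩ <;>
    try simp only [Function.uncurry_curry]
  · exact hK
  · filter_upwards [ae_restrict_mem measurableSet_Ioo] with x hx
    exact hk.ae_eq_kernelFormula hL.le hg hk0 hq (Ioo_subset_Icc_self hx)
  · refine memH1_of_characteristic isOpen_triMinus.measurableSet triMinus_subset
      (hK.mono_measure rm) (hq.memLp.restrict _)
      ((memLp_lineIntegral hE.measurable hE.memLp (e := (1, 1)) (by simp)).mono_measure rm).neg
      (hc.mono triMinus_subset isOpen_square.measurableSet) ?_
    exact (hasWeakDeriv_lineIntegral_triMinus hq hE hEm).neg.congr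
      (kernelFormula_eq_glue ▸ glue_ae_eq_minus) EventuallyEq.rfl
  · refine memH1_of_characteristic isOpen_triPlus.measurableSet triPlus_subset
      (hK.mono_measure rp) (hq.memLp.restrict _)
      ((memLp_lineIntegral hE.measurable hE.memLp (e := (-1, -1)) (by simp)).mono_measure rp)
      (hc.mono triPlus_subset isOpen_square.measurableSet) ?_
    exact (hasWeakDeriv_lineIntegral_triPlus hq hE hEp).congr
      (kernelFormula_eq_glue ▸ glue_ae_eq_plus) EventuallyEq.rfl

end KernelDeriv

end IntegroDiff

/-! ### Regularity of the boundary value. -/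

namespace IntegroDiff

open Filter Topology TopologicalSpace

variable {L : ℝ} {g : ℝ → ℝ → ℂ}

section Boundary

variable {f Fx Fy H q : ℝ × ℝ → ℂ} {χ : ℝ → ℂ}

theorem contDiff_comp_snd_sub_fst (hχ : ContDiff ℝ ∞ χ) :
    ContDiff ℝ ∞ fun p : ℝ × ℝ => χ (p.2 - p.1) := hχ.comp (by fun_prop)

theorem hasFDerivAt_comp_snd_sub_fst (hχ : ContDiff ℝ ∞ χ) (p : ℝ × ℝ) :
    HasFDerivAt (fun p : ℝ × ℝ => χ (p.2 - p.1))
      ((ContinuousLinearMap.toSpanSingleton ℝ (deriv χ (p.2 - p.1))).comp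
        (ContinuousLinearMap.snd ℝ ℝ ℝ - ContinuousLinearMap.fst ℝ ℝ ℝ)) p :=
  (hχ.differentiable (by simp) (p.2 - p.1)).hasDerivAt.hasFDerivAt.comp p
    (hasFDerivAt_snd.sub hasFDerivAt_fst)

theorem fderiv_comp_snd_sub_fst (hχ : ContDiff ℝ ∞ χ) (p v : ℝ × ℝ) :
    fderiv ℝ (fun p : ℝ × ℝ => χ (p.2 - p.1)) p v = (v.2 - v.1 : ℝ) * deriv χ (p.2 - p.1) := by
  rw [(hasFDerivAt_comp_snd_sub_fst hχ p).fderiv]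
  simp [sub_mul]

theorem fderiv_fst_mul_comp_snd_sub_fst (hχ : ContDiff ℝ ∞ χ) (p v : ℝ × ℝ) :
    fderiv ℝ (fun p : ℝ × ℝ => (p.1 : ℂ) * χ (p.2 - p.1)) p v
      = v.1 * χ (p.2 - p.1) + p.1 * ((v.2 - v.1 : ℝ) * deriv χ (p.2 - p.1)) := by
  have h1 : HasFDerivAt (fun p : ℝ × ℝ => (p.1 : ℂ))
      (Complex.ofRealCLM.comp (ContinuousLinearMap.fst ℝ ℝ ℝ)) p :=
    (Complex.ofRealCLM.comp (ContinuousLinearMap.fst ℝ ℝ ℝ)).hasFDerivAt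
  rw [show (fun p : ℝ × ℝ => (p.1 : ℂ) * χ (p.2 - p.1))
    = (fun p : ℝ × ℝ => (p.1 : ℂ)) * fun p : ℝ × ℝ => χ (p.2 - p.1) from rfl,
    (h1.mul (hasFDerivAt_comp_snd_sub_fst hχ p)).fderiv]
  simp
  ring

/-- Integration by parts in the upper triangle that moves the contribution of the side `y = L` to
the integrals over the triangle. -/
theorem boundary_triPlus (hf : MemLp f 2 (volume.restrict (triPlus L)))
    (hFx : MemLp Fx 2 (volume.restrict (triPlus L))) (hFy : MemLp Fy 2 (volume.restrict (triPlus L)))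
    (hx : HasWeakDeriv (triPlus L) (1, 0) f Fx) (hy : HasWeakDeriv (triPlus L) (0, 1) f Fy)
    (hχ : IsTest (Ioo 0 L) χ) :
    L * ∫ p in triPlus L, f p * deriv χ (p.2 - p.1)
      = (∫ p in triPlus L, (f p + Fx p * p.1 + Fy p * (p.1 - L)) * χ (p.2 - p.1))
        + ∫ p in triPlus L, (f p + Fy p * (p.2 - p.1)) * χ (L - p.1) := by
  have hm := (isOpen_triPlus (L := L)).measurableSet
  have hi := fun {f φ : ℝ × ℝ → ℂ} => integrableOn_mul_continuous (f := f) (φ := φ) hm triPlus_subset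
  have χ0 : χ 0 = 0 := hχ.eq_zero fun h => lt_irrefl _ h.1
  have s1 := contDiff_comp_snd_sub_fst hχ.contDiff
  have s3 : ContDiff ℝ ∞ fun p : ℝ × ℝ => (p.1 : ℂ) * χ (p.2 - p.1) :=
    (contDiff_coe.comp contDiff_fst).mul s1
  have r1 : ContDiff ℝ ∞ fun x : ℝ => χ (L - x) := hχ.contDiff.comp (by fun_prop)
  have r2 : ContDiff ℝ ∞ fun x : ℝ => -(x * χ (L - x)) := (contDiff_coe.mul r1).neg
  have t1 := contDiff_mul_fst_snd r1 contDiff_coe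
  have t2 := contDiff_mul_fst_snd r2 (contDiff_const (c := (1 : ℂ)))
  have s2 := t1.add t2
  -- The test function `L χ(y-x) - (y-x) χ(L-x) - x χ(y-x)` vanishes on `y = L`, as `(L-x) + x = L`,
  -- and on the diagonal, as `χ 0 = 0`. Again the splitting avoids a division by `L - x`, singular
  -- at the corner `(L,L)`.
  have e1 := integral_mul_fderiv_of_sub hm triPlus_subset hf hFy (L : ℂ) s1 s2 s3
    (hy.integral_triPlus hf hFy (((contDiff_const.mul s1).sub s2).sub s3)
      (fun h => by simp at h) (fun _ x => by simp only; ring) (fun _ x => by simp [χ0]; ring))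
  -- The remaining derivative of `χ`, with the weight `x`, is removed along `(1,0)`, a direction
  -- parallel to `y = L`; the weight kills the side `x = 0`.
  have e2 := hx.integral_triPlus hf hFx s3 (fun _ y => by simp) (fun h => by simp at h)
    (fun _ x => by simp [χ0])
  have hd2 : ∀ p, fderiv ℝ (fun p : ℝ × ℝ => χ (L - p.1) * p.2 + -(p.1 * χ (L - p.1)) * 1) p (0, 1)
      = χ (L - p.1) := fun p => by
    have d1 := (t1.differentiable (by simp) p).hasFDerivAt
    have d2 := (t2.differentiable (by simp) p).hasFDerivAt
    have d : HasFDerivAt (fun p : ℝ × ℝ => χ (L - p.1) * p.2 + -(p.1 * χ (L - p.1)) * 1) _ p := d1.add d2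
    rw [d.fderiv, add_apply, fderiv_mul_fst_snd r1 contDiff_coe,
      fderiv_mul_fst_snd r2 contDiff_const]
    simp [deriv_coe]
  simp only [hd2] at e1
  simp only [fderiv_comp_snd_sub_fst hχ.contDiff, fderiv_fst_mul_comp_snd_sub_fst hχ.contDiff,
    Complex.ofReal_zero, Complex.ofReal_one, zero_mul, zero_add, sub_zero, zero_sub,
    Complex.ofReal_neg, mul_one, one_mul] at e1 e2
  have cχ : Continuous fun p : ℝ × ℝ => χ (p.2 - p.1) := s1.continuous
  have cχ' : Continuous fun p : ℝ × ℝ => (p.1 : ℂ) * deriv χ (p.2 - p.1) :=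
    (Complex.continuous_ofReal.comp continuous_fst).mul
      ((hχ.contDiff.continuous_deriv (by simp)).comp (by fun_prop))
  have cη : Continuous fun p : ℝ × ℝ => χ (L - p.1) := r1.continuous.comp continuous_fst
  have i1 : ∫ p in triPlus L, f p * (χ (p.2 - p.1) + p.1 * (-1 * deriv χ (p.2 - p.1)))
      = (∫ p in triPlus L, f p * χ (p.2 - p.1))
        - ∫ p in triPlus L, f p * (p.1 * deriv χ (p.2 - p.1)) := by
    rw [← integral_sub (hi hf cχ) (hi hf cχ')]
    congr 1; ext p; ring
  have i2 : ∫ p in triPlus L, (f p + Fy p * (p.2 - p.1)) * χ (L - p.1)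
      = (∫ p in triPlus L, f p * χ (L - p.1))
        + ∫ p in triPlus L, Fy p * (χ (L - p.1) * p.2 + -(p.1 * χ (L - p.1))) := by
    have hc : Continuous fun p : ℝ × ℝ => χ (L - p.1) * p.2 + -(p.1 * χ (L - p.1)) := by
      simpa using s2.continuous
    rw [← integral_add (hi hf cη) (hi hFy hc)]
    congr 1; ext p; ring
  have j1 := hi hf cχ
  have j2 := hi hFx s3.continuous
  have j12 : IntegrableOn (fun p => f p * χ (p.2 - p.1) + Fx p * (p.1 * χ (p.2 - p.1))) (triPlus L) :=
    j1.add j2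
  have j3 := hi hFy s3.continuous
  have j4 := (hi hFy cχ).const_mul (L : ℂ)
  have j34 : IntegrableOn (fun p => Fy p * (p.1 * χ (p.2 - p.1)) - L * (Fy p * χ (p.2 - p.1)))
      (triPlus L) := j3.sub j4
  have i3 : ∫ p in triPlus L, (f p + Fx p * p.1 + Fy p * (p.1 - L)) * χ (p.2 - p.1)
      = (∫ p in triPlus L, f p * χ (p.2 - p.1)) + (∫ p in triPlus L, Fx p * (p.1 * χ (p.2 - p.1)))
        + ((∫ p in triPlus L, Fy p * (p.1 * χ (p.2 - p.1)))
          - L * ∫ p in triPlus L, Fy p * χ (p.2 - p.1)) := by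
    rw [← integral_const_mul, ← integral_add j1 j2, ← integral_sub j3 j4, ← integral_add j12 j34]
    congr 1; ext p; ring
  rw [i1] at e2
  rw [i2, i3]
  linear_combination e1 - e2

/-- `L χ(y-x) - y χ(L-x)` vanishes on `y = L`, and on `y = 0` for `x > 0`. On the square the
vertical sections have constant length, so the derivative in `y` alone suffices; the integral term
offers no other. -/
theorem boundary_square (hf : MemLp f 2 (volume.restrict (square L)))
    (hH : MemLp H 2 (volume.restrict (square L))) (hy : HasWeakDeriv (square L) (0, 1) f H)
    (hχ : IsTest (Ioo 0 L) χ) :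
    L * ∫ p in square L, f p * deriv χ (p.2 - p.1)
      = (∫ p in square L, H p * -L * χ (p.2 - p.1))
        + ∫ p in square L, (f p + H p * p.2) * χ (L - p.1) := by
  have hm := (isOpen_square (L := L)).measurableSet
  have hi := fun {f φ : ℝ × ℝ → ℂ} => integrableOn_mul_continuous (f := f) (φ := φ) hm Subset.rfl
  have s1 := contDiff_comp_snd_sub_fst hχ.contDiff
  have r1 : ContDiff ℝ ∞ fun x : ℝ => χ (L - x) := hχ.contDiff.comp (by fun_prop)
  have s2 := contDiff_mul_fst_snd r1 contDiff_coe
  have s3 : ContDiff ℝ ∞ fun _ : ℝ × ℝ => (0 : ℂ) := contDiff_const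
  have e1 := integral_mul_fderiv_of_sub hm Subset.rfl hf hH (L : ℂ) s1 s2 s3
    (hy.integral_square hf hH (((contDiff_const.mul s1).sub s2).sub s3)
      (fun x hx => by
        have : χ (0 - x) = 0 := hχ.eq_zero fun h => by linarith [h.1, hx.1]
        simp only [this]; simp)
      (fun x _ => by simp only; ring))
  simp only [fderiv_mul_fst_snd r1 contDiff_coe, fderiv_comp_snd_sub_fst hχ.contDiff, deriv_coe,
    fderiv_const_apply, zero_apply, integral_zero, add_zero,
    Complex.ofReal_zero, Complex.ofReal_one, mul_zero, zero_mul, zero_add, sub_zero, mul_one,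
    one_mul] at e1
  have i2 : ∫ p in square L, (f p + H p * p.2) * χ (L - p.1)
      = (∫ p in square L, f p * χ (L - p.1)) + ∫ p in square L, H p * (χ (L - p.1) * p.2) := by
    have cη : Continuous fun p : ℝ × ℝ => χ (L - p.1) := r1.continuous.comp continuous_fst
    rw [← integral_add (hi hf cη) (hi hH s2.continuous)]
    congr 1; ext p; ring
  have i3 : ∫ p in square L, H p * -L * χ (p.2 - p.1)
      = -(L * ∫ p in square L, H p * χ (p.2 - p.1)) := by
    rw [← integral_const_mul, ← integral_neg]
    congr 1; ext p; ring
  rw [i2, i3]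
  linear_combination e1

/-- Integral along the characteristic that meets the axis `x = 0` at height `t`. -/
theorem memLp_integral_characteristic {A : ℝ × ℝ → ℂ} (hA2 : MemLp A 2 volume) :
    MemLp (fun t => ∫ x in Ioo 0 L, A (x, t + x)) 2 (volume.restrict (Ioo 0 L)) := by
  have h1 : MeasurePreserving (fun z : ℝ × ℝ => (z.1, z.2 + z.1))
      ((volume.restrict (Ioo 0 L)).prod volume) ((volume.restrict (Ioo 0 L)).prod volume) :=
    (MeasurePreserving.id _).skew_product (g := fun (x y : ℝ) => y + x)
      (by fun_prop) (Eventually.of_forall fun s => map_add_right_eq_self _ _)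
  have h2 : MemLp A 2 ((volume.restrict (Ioo 0 L)).prod volume) := by
    refine hA2.mono_measure ?_
    rw [show (volume : Measure (ℝ × ℝ)) = volume.prod volume from rfl]
    exact Measure.prod_mono Measure.restrict_le_self le_rfl
  have h3 : MemLp (fun z : ℝ × ℝ => A (z.1, z.2 + z.1)) 2 (volume.restrict (square L)) := by
    rw [volume_restrict_square]
    exact (h2.comp_measurePreserving h1).mono_measure
      (Measure.prod_mono le_rfl Measure.restrict_le_self)
  exact memLp_integral_fst h3

theorem integral_reflect (f : ℝ → ℂ) : ∫ s in Ioo 0 L, f (L - s) = ∫ s in Ioo 0 L, f s := by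
  refine (measurePreserving_reflect L).integral_comp ?_ f
  exact (MeasurableEquiv.subLeft L).measurableEmbedding

theorem IsTest.reflect (h : IsTest (Ioo 0 L) χ) : IsTest (Ioo 0 L) fun s => χ (L - s) := by
  have hs : tsupport (fun s => χ (L - s)) ⊆ (fun s => L - s) ⁻¹' tsupport χ :=
    closure_minimal (fun y hy => subset_tsupport _ hy)
      ((isClosed_tsupport χ).preimage (by fun_prop))
  refine ⟨h.contDiff.comp (by fun_prop), HasCompactSupport.intro (isCompact_Icc (a := 0) (b := L))
    fun y hy => h.eq_zero fun h' => hy ⟨by linarith [h'.2], by linarith [h'.1]⟩, fun y hy => ?_⟩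
  have := h.subset (hs hy)
  exact ⟨by linarith [this.2], by linarith [this.1]⟩

theorem IsTest.deriv (h : IsTest (Ioo 0 L) χ) : IsTest (Ioo 0 L) (deriv χ) := by
  have hs : tsupport (_root_.deriv χ) ⊆ tsupport χ :=
    closure_minimal (support_deriv_subset) (isClosed_tsupport χ)
  refine ⟨?_, h.compact.deriv, hs.trans h.subset⟩
  exact (contDiff_infty_iff_deriv.1 h.contDiff).2

theorem integral_mul_characteristic (hq : Integrable q) (h0 : ∀ p, p ∉ square L → q p = 0)
    (hq2 : MemLp q 2 volume) (hχ : IsTest (Ioo 0 L) χ) :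
    ∫ p in square L, q p * χ (p.2 - p.1)
      = ∫ t in Ioo 0 L, (∫ x in Ioo 0 L, q (x, t + x)) * χ t := by
  have h := integral_shear hq h0 hχ 0 (Ioo 0 L)
  simp only [sub_zero] at h
  have i := integrableOn_mul_continuous isOpen_square.measurableSet Subset.rfl
    (hq2.restrict (square L)) (contDiff_comp_snd_sub_fst hχ.contDiff).continuous
  rw [IntegrableOn, volume_restrict_square] at i
  rw [← h, volume_restrict_square, integral_prod _ i]

/-- The boundary value of the solution of the kernel equation is in `H¹` if the solution vanishes at
`x = 0`. -/
theorem IsKernelSolution.boundary_memH1 (hL : 0 < L)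
    (hg : MemLp (Function.uncurry g) 2 (volume.restrict (square L)))
    (hm : MemH1 (triMinus L) (Function.uncurry g)) (hp : MemH1 (triPlus L) (Function.uncurry g))
    {U : L2 L} {k : ℝ → L2 L} (hk : IsKernelSolution L g U k) (hk0 : k 0 = 0) :
    MemH1 (Ioo 0 L) U := by
  obtain ⟨q, hq⟩ := exists_isExtension isOpen_square.measurableSet (memLp_kernelRhs hg hk.1)
  obtain ⟨H, hH, hHd⟩ := hk.exists_nonlocal_deriv hL hg hm hp hk0 hq
  set γ : ℝ × ℝ → ℂ := fun p => conj (g p.2 p.1) with hγd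
  have hγ : MemH1 (triPlus L) γ := swap_preimage_triMinus (L := L) ▸ hm.conj_swap
  obtain ⟨Fx, hFx, hdx⟩ := hγ.2 (1, 0)
  obtain ⟨Fy, hFy, hdy⟩ := hγ.2 (0, 1)
  have hγs : MemLp γ 2 (volume.restrict (square L)) := memLp_conj_swap hg
  have hh := memLp_nonlocal hg hk.1
  have ms := fun {f φ : ℝ × ℝ → ℂ} => memLp_mul_continuous (f := f) (φ := φ)
    (isOpen_square (L := L)).measurableSet Subset.rfl
  have mp := fun {f φ : ℝ × ℝ → ℂ} => memLp_mul_continuous (f := f) (φ := φ)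
    (isOpen_triPlus (L := L)).measurableSet triPlus_subset
  have hA1 : MemLp (fun p => γ p + Fx p * p.1 + Fy p * (p.1 - L)) 2 (volume.restrict (triPlus L)) :=
    (hγ.1.add (mp hFx (by fun_prop))).add (mp hFy (by fun_prop))
  have hB1 : MemLp (fun p => γ p + Fy p * (p.2 - p.1)) 2 (volume.restrict (triPlus L)) :=
    hγ.1.add (mp hFy (by fun_prop))
  have hA2 : MemLp (fun p => H p * -L) 2 (volume.restrict (square L)) :=
    ms hH (φ := fun _ => -(L : ℂ)) continuous_const
  have hB2 : MemLp (fun p => nonlocal L g k p + H p * p.2) 2 (volume.restrict (square L)) :=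
    hh.add (ms hH (by fun_prop))
  have h0 : MemLp (fun _ : ℝ × ℝ => (0 : ℂ)) 2 (volume.restrict (triMinus L)) := MemLp.zero
  have hgA := memLp_glue h0 hA1
  have hgB := memLp_glue h0 hB1
  obtain ⟨A, hA⟩ := exists_isExtension isOpen_square.measurableSet (hgA.sub hA2)
  set B : ℝ × ℝ → ℂ := fun p => glue (fun _ => 0) (fun p => γ p + Fy p * (p.2 - p.1)) p
    - (nonlocal L g k p + H p * p.2) with hBd
  have hB : MemLp B 2 (volume.restrict (square L)) := hgB.sub hB2
  -- The left side is the weak derivative of `t ↦ ∫ q(x,t+x) dx`. On the right, `A` is the interior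
  -- contribution and `B` represents the trace on `y = L`, met at `x = L - t`.
  have key : ∀ χ, IsTest (Ioo 0 L) χ → L * ∫ p in square L, q p * deriv χ (p.2 - p.1)
      = (∫ p in square L, A p * χ (p.2 - p.1)) + ∫ p in square L, B p * χ (L - p.1) := by
    intro χ hχ
    have hi := fun {f φ : ℝ × ℝ → ℂ} => integrableOn_mul_continuous (f := f) (φ := φ)
      (isOpen_square (L := L)).measurableSet Subset.rfl
    have c1 : Continuous fun p : ℝ × ℝ => deriv χ (p.2 - p.1) :=
      (contDiff_comp_snd_sub_fst hχ.deriv.contDiff).continuous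
    have c2 : Continuous fun p : ℝ × ℝ => χ (p.2 - p.1) :=
      (contDiff_comp_snd_sub_fst hχ.contDiff).continuous
    have c3 : Continuous fun p : ℝ × ℝ => χ (L - p.1) := hχ.contDiff.continuous.comp (by fun_prop)
    have e1 := boundary_triPlus hγ.1 hFx hFy hdx hdy hχ
    have e2 := boundary_square hh hH hHd hχ
    have r1 : ∫ p in square L, q p * deriv χ (p.2 - p.1)
        = (∫ p in triPlus L, γ p * deriv χ (p.2 - p.1))
          - ∫ p in square L, nonlocal L g k p * deriv χ (p.2 - p.1) := by
      -- The factor `χ'(y-x)` vanishes off the upper triangle, so only one piece of `g` matters and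
      -- its jump plays no role. The integral term stays on the square, where `boundary_square`
      -- applies.
      rw [← setIntegral_eq_of_subset_of_forall_sdiff_eq_zero isOpen_square.measurableSet triPlus_subset
        fun p hp => by rw [hχ.deriv.eq_zero fun h => hp.2 ⟨hp.1, sub_pos.1 h.1⟩, mul_zero],
        ← integral_sub (hi hγs c1) (hi hh c1)]
      refine integral_congr_ae ?_
      filter_upwards [hq.ae_eq] with p hp
      rw [hp, kernelRhs, sub_mul]
    have r2 : ∫ p in square L, A p * χ (p.2 - p.1)
        = (∫ p in triPlus L, (γ p + Fx p * p.1 + Fy p * (p.1 - L)) * χ (p.2 - p.1))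
          - ∫ p in square L, H p * -L * χ (p.2 - p.1) := by
      have := integral_glue_mul h0 hA1 c2
      simp only [zero_mul, integral_zero, zero_add] at this
      rw [← this, ← integral_sub (hi hgA c2) (hi hA2 c2)]
      refine integral_congr_ae ?_
      filter_upwards [hA.ae_eq] with p hp
      rw [hp, Pi.sub_apply, sub_mul]
    have r3 : ∫ p in square L, B p * χ (L - p.1)
        = (∫ p in triPlus L, (γ p + Fy p * (p.2 - p.1)) * χ (L - p.1))
          - ∫ p in square L, (nonlocal L g k p + H p * p.2) * χ (L - p.1) := by
      have := integral_glue_mul h0 hB1 c3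
      simp only [zero_mul, integral_zero, zero_add] at this
      rw [← this, ← integral_sub (hi hgB c3) (hi hB2 c3)]
      simp only [hBd, sub_mul]
    rw [r1, r2, r3]
    linear_combination e1 - e2
  have ha := memLp_integral_characteristic (L := L) hA.memLp
  have hb := memLp_integral_snd hB
  have hU' : MemLp (fun s => (L : ℂ)⁻¹ * ((∫ x in Ioo 0 L, A (x, L - s + x))
      + ∫ y in Ioo 0 L, B (s, y))) 2 (volume.restrict (Ioo 0 L)) :=
    ((ha.comp_measurePreserving (measurePreserving_reflect L)).add hb).const_mul _
  refine ⟨Lp.memLp U, fun v => ⟨fun s => v * ((L : ℂ)⁻¹ * ((∫ x in Ioo 0 L, A (x, L - s + x))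
      + ∫ y in Ioo 0 L, B (s, y))), hU'.const_mul _, fun η h1 h2 h3 => ?_⟩⟩
  have hη : IsTest (Ioo 0 L) η := ⟨h1, h2, h3⟩
  -- The formula gives `U (L - t)`, so the test function is reflected by `s = L - t`.
  have hχ := hη.reflect
  have hdχ : ∀ t, deriv (fun s => η (L - s)) t = -deriv η (L - t) := fun t =>
    deriv_comp_const_sub ..
  have e := key _ hχ
  have eU : ∫ p in square L, q p * deriv (fun s => η (L - s)) (p.2 - p.1)
      = -∫ s in Ioo 0 L, U s * deriv η s := by
    rw [integral_mul_characteristic hq.integrable hq.eq_zero hq.memLp hχ.deriv,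
      ← integral_reflect, ← integral_neg]
    refine integral_congr_ae ?_
    have hbd := ae_restrict_of_ae (s := Ioo 0 L) (hk.boundary_ae_eq hL.le hg hk0 hq)
    filter_upwards [(measurePreserving_reflect L).quasiMeasurePreserving.ae hbd,
      ae_restrict_mem measurableSet_Ioo] with s hs hsm
    rw [← hs ⟨by linarith [hsm.2], by linarith [hsm.1]⟩, hdχ, sub_sub_cancel]
    ring
  have eA : ∫ p in square L, A p * η (L - (p.2 - p.1))
      = ∫ s in Ioo 0 L, (∫ x in Ioo 0 L, A (x, L - s + x)) * η s := by
    rw [integral_mul_characteristic hA.integrable hA.eq_zero hA.memLp hχ, ← integral_reflect]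
    simp only [sub_sub_cancel]
  have eB : ∫ p in square L, B p * η (L - (L - p.1))
      = ∫ s in Ioo 0 L, (∫ y in Ioo 0 L, B (s, y)) * η s := by
    simp only [sub_sub_cancel]
    exact integral_mul_fst hB h1.continuous
  rw [eU, eA, eB] at e
  have i1 : IntegrableOn (fun s => (∫ x in Ioo 0 L, A (x, L - s + x)) * η s) (Ioo 0 L) :=
    (ha.comp_measurePreserving (measurePreserving_reflect L)).integrable_mul hη.memLp
  have i2 : IntegrableOn (fun s => (∫ y in Ioo 0 L, B (s, y)) * η s) (Ioo 0 L) :=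
    hb.integrable_mul hη.memLp
  have hne : (L : ℂ) ≠ 0 := Complex.ofReal_ne_zero.2 hL.ne'
  have f1 : ∫ s in Ioo 0 L, U s * fderiv ℝ η s v = v * ∫ s in Ioo 0 L, U s * deriv η s := by
    rw [← integral_const_mul]
    congr 1; ext s
    rw [fderiv_eq_smul_deriv, Complex.real_smul]
    ring
  have f2 : ∫ s in Ioo 0 L, v * ((L : ℂ)⁻¹ * ((∫ x in Ioo 0 L, A (x, L - s + x))
      + ∫ y in Ioo 0 L, B (s, y))) * η s
      = v * (L : ℂ)⁻¹ * ((∫ s in Ioo 0 L, (∫ x in Ioo 0 L, A (x, L - s + x)) * η s)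
        + ∫ s in Ioo 0 L, (∫ y in Ioo 0 L, B (s, y)) * η s) := by
    rw [← integral_add i1 i2, ← integral_const_mul]
    congr 1; ext s; ring
  rw [f1, f2, ← e, mul_assoc, inv_mul_cancel_left₀ hne]
  ring

end Boundary

end IntegroDiff

theorem mainTheorem7 (L : ℝ) (hL : 0 < L) (g : ℝ → ℝ → ℂ)
    (hg : MemLp (Function.uncurry g) 2 (volume.restrict (IntegroDiff.square L))) :
    (IntegroDiff.ExactlyControllable L L g →
      ∃ U : IntegroDiff.L2 L, ∃ k : ℝ → IntegroDiff.L2 L,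
        IntegroDiff.IsKernelSolution L g U k ∧
        (∀ k' : ℝ → IntegroDiff.L2 L, IntegroDiff.IsKernelSolution L g U k' →
          EqOn k' k (Icc 0 L)) ∧
        k 0 = 0) ∧
    (IntegroDiff.MemH1 (IntegroDiff.triMinus L) (Function.uncurry g) →
      IntegroDiff.MemH1 (IntegroDiff.triPlus L) (Function.uncurry g) →
      ∀ (U : IntegroDiff.L2 L) (k : ℝ → IntegroDiff.L2 L),
        IntegroDiff.IsKernelSolution L g U k → k 0 = 0 →
          IntegroDiff.MemH1 (Ioo 0 L) U ∧ IntegroDiff.KernelMemH1 L k) := by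
  refine ⟨fun h => ?_, fun hm hp _ _ hk hk0 => ⟨hk.boundary_memH1 hL hg hm hp hk0,
    hk.kernelMemH1 hL hg hm hp hk0⟩⟩
  obtain ⟨U, k, hk, hk0⟩ := h.exists_isKernelSolution hL hg
  exact ⟨U, k, hk, fun k' hk' => hk.eqOn hL hg hk', hk0⟩
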